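/- Let $k$ be a field of characteristic zero. A graded mixed complex is a family $(E(n))_{n\in\mathbb Z}$ of cochain complexes of $k$-vector spaces with morphisms of complexes $\epsilon : E(n)\to E(n+1)[-1]$ satisfying $\epsilon^2=0$; a morphism of graded mixed complexes (a family of morphisms of complexes commuting with $\epsilon$) is a quasi-isomorphism if it is one in each weight $n$. Let $\epsilon\text{-}\mathrm{dg}^{gr}$ be the $\infty$-category obtained from the category of graded mixed complexes by inverting the quasi-isomorphisms. Let $\mathrm{dg}^{fil}$ be the $\infty$-category of filtered complexes, obtained from the category of diagrams $\cdots\to F^iE\to F^{i+1}E\to\cdots$ $(i\in\mathbb Z)$ of complexes of $k$-vector spaces by inverting the morphisms which are quasi-isomorphisms on each $F^i$. For a graded mixed complex $E$ put $$F^i|E|^t=\prod_{p\ge -i}E(p)[-2p],$$ with the total differential (the sum of the cohomological differential and of $\epsilon$) and the evident inclusions $F^i|E|^t\subset F^{i+1}|E|^t$ as transition maps. Then this construction induces an $\infty$-functor (the filtered Tate realization) $$|-|^t:\epsilon\text{-}\mathrm{dg}^{gr}\longrightarrow \mathrm{dg}^{fil},$$ which is fully faithful, i.e. induces equivalences on all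 mapping spaces, and whose essential image consists exactly of the filtered complexes $E$ that are complete, i.e. such that for all $i\in\mathbb Z$ the natural morphism $$F^iE\longrightarrow \lim_{j\le i}\,(F^iE)/(F^jE)$$ is an equivalence, where the quotients (cofibres) and the limit are taken in the $\infty$-category of complexes. -/

import Mathlib

open CategoryTheory Limits MonoidalCategory Simplicial

universe u v

/-! ### Mapping spaces, equivalences and localizations of quasi-categories -/

namespace InftyCat

/-- The mapping space `Map_X(x, y)` of a simplicial set (in practice a quasi-category) `X`, that is
the fibre of `Fun(Δ[1], X) ⟶ X × X` over `(x, y)`: an `n`-simplex is a map `Δ[n] × Δ[1] ⟶ X` which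
is constant at `x` on `Δ[n] × {0}` and constant at `y` on `Δ[n] × {1}`. -/
def mapSpace (X : SSet.{u}) (x y : X _⦋0⦌) : SSet.{u} where
  obj n := {σ : SSet.stdSimplex.obj n.unop ⊗ Δ[1] ⟶ X //
    SSet.ι₀ ≫ σ = SSet.const x ∧ SSet.ι₁ ≫ σ = SSet.const y}
  map f := ↾fun σ ↦ ⟨SSet.stdSimplex.map f.unop ▷ Δ[1] ≫ σ.1, by
    rw [SSet.ι₀_comp_assoc, σ.2.1, SSet.comp_const], by
    rw [SSet.ι₁_comp_assoc, σ.2.2, SSet.comp_const]⟩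
  map_id n := by
    apply ConcreteCategory.hom_ext
    intro σ
    apply Subtype.ext
    show SSet.stdSimplex.map (𝟙 n.unop) ▷ Δ[1] ≫ σ.1 = σ.1
    have h : SSet.stdSimplex.{u}.map (𝟙 n.unop) = 𝟙 _ := SSet.stdSimplex.map_id _
    erw [h, id_whiskerRight, Category.id_comp]
  map_comp f g := by
    apply ConcreteCategory.hom_ext
    intro σ
    apply Subtype.ext
    show SSet.stdSimplex.map (g.unop ≫ f.unop) ▷ Δ[1] ≫ σ.1 =
      SSet.stdSimplex.map g.unop ▷ Δ[1] ≫ SSet.stdSimplex.map f.unop ▷ Δ[1] ≫ σ.1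
    have h : SSet.stdSimplex.{u}.map (g.unop ≫ f.unop) =
        SSet.stdSimplex.map g.unop ≫ SSet.stdSimplex.map f.unop := SSet.stdSimplex.map_comp _ _
    erw [h, comp_whiskerRight, Category.assoc]

/-- The map `Map_X(x, y) ⟶ Map_Y(f x, f y)` induced by a map `f : X ⟶ Y`. -/
def mapSpaceMap {X Y : SSet.{u}} (f : X ⟶ Y) (x y : X _⦋0⦌) :
    mapSpace X x y ⟶ mapSpace Y (f.app _ x) (f.app _ y) where
  app n := ↾fun σ ↦ ⟨σ.1 ≫ f, by
    rw [← Category.assoc, σ.2.1, SSet.const_comp], by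
    rw [← Category.assoc, σ.2.2, SSet.const_comp]⟩

/-- Simplicial homotopy equivalences. (They are only applied to mapping spaces of quasi-categories,
which are Kan complexes.) -/
def IsHomotopyEquiv {X Y : SSet.{u}} (f : X ⟶ Y) : Prop :=
  ∃ g : Y ⟶ X, Nonempty (SSet.Homotopy (f ≫ g) (𝟙 X)) ∧ Nonempty (SSet.Homotopy (g ≫ f) (𝟙 Y))

/-- An edge of a quasi-category is an equivalence if it has an inverse. -/
def IsEquivalence {X : SSet.{u}} {x y : X _⦋0⦌} (e : X.Edge x y) : Prop :=
  Nonempty e.InvStruct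

/-- Two objects of a quasi-category are equivalent. -/
def Equivalent {X : SSet.{u}} (x y : X _⦋0⦌) : Prop :=
  ∃ e : X.Edge x y, IsEquivalence e

/-- An `∞`-functor is fully faithful if it induces equivalences on all mapping spaces. -/
def IsFullyFaithful {X Y : SSet.{u}} (f : X ⟶ Y) : Prop :=
  ∀ x y : X _⦋0⦌, IsHomotopyEquiv (mapSpaceMap f x y)

/-- The object `y` lies in the essential image of the `∞`-functor `f`. -/
def InEssImage {X Y : SSet.{u}} (f : X ⟶ Y) (y : Y _⦋0⦌) : Prop :=
  ∃ x : X _⦋0⦌, Equivalent (f.app _ x) y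

/-- A map `f : X ⟶ Y` as an object of the `∞`-category of functors `Fun(X, Y)`. -/
noncomputable def funObj {X Y : SSet.{u}} (f : X ⟶ Y) : ((ihom X).obj Y) _⦋0⦌ :=
  SSet.unitHomEquiv _ (MonoidalClosed.curry' f)

/-- An `∞`-functor out of (the nerve of) a category `C` inverts the class of morphisms `W` of `C`
if it sends the morphisms in `W` to equivalences. -/
def Inverts {C : Type u} [Category.{v} C] (W : MorphismProperty C) {E : SSet.{max u v}}
    (f : nerve C ⟶ E) : Prop :=
  ∀ ⦃X Y : C⦄ (w : X ⟶ Y), W w → IsEquivalence ((nerve.edgeMk w).map f)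

/-- The map `γ` exhibits the quasi-category `D` as the `∞`-category obtained from the category `C`
by inverting the class of morphisms `W`: for every quasi-category `E`, the precomposition
`Fun(D, E) ⟶ Fun(C, E)` is fully faithful with essential image the functors which invert `W`. -/
structure IsLocalizationAt {C : Type u} [Category.{v} C] (W : MorphismProperty C)
    {D : SSet.{max u v}} (γ : nerve C ⟶ D) : Prop where
  quasicategory : SSet.Quasicategory D
  fullyFaithful (E : SSet.{max u v}) [SSet.Quasicategory E] :
    IsFullyFaithful ((MonoidalClosed.pre γ).app E)
  inEssImage_iff (E : SSet.{max u v}) [SSet.Quasicategory E] (f : nerve C ⟶ E) :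
    InEssImage ((MonoidalClosed.pre γ).app E) (funObj f) ↔ Inverts W f

/-- Let `γ : C ⟶ D` and `γ' : C' ⟶ D'` be localizations. The `∞`-functor `G : D ⟶ D'` is induced
by the functor `F : C ⥤ C'` if `G ∘ γ` and `γ' ∘ F` are equivalent in `Fun(C, D')`. -/
def IsInducedBy {C C' : Type u} [Category.{v} C] [Category.{v} C'] {D D' : SSet.{max u v}}
    (γ : nerve C ⟶ D) (γ' : nerve C' ⟶ D') (F : C ⥤ C') (G : D ⟶ D') : Prop :=
  Equivalent (funObj (γ ≫ G)) (funObj (nerveMap F ≫ γ'))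

/-- The object of `D` given by an object of `C`, where `γ : C ⟶ D`. -/
def objOf {C : Type u} [Category.{v} C] {D : SSet.{max u v}} (γ : nerve C ⟶ D) (X : C) :
    D _⦋0⦌ :=
  γ.app _ (nerveEquiv.symm X)

end InftyCat

/-! ### Graded mixed complexes -/

/-- A graded mixed complex over `k`: a family of cochain complexes `E(n)` for `n : ℤ` with
morphisms of complexes `ε : E(n) ⟶ E(n+1)[-1]` such that `ε² = 0`. As for the differential of
`HomologicalComplex`, the component `ε n n' a b : E(n)^a ⟶ E(n')^b` is there for all indices, and
vanishes unless `n' = n + 1` and `b = a - 1`. The differential of `E(n+1)[-1]` is the opposite of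
that of `E(n+1)`, hence the sign in `d_ε`. -/
structure GradedMixedComplex (k : Type u) [Field k] where
  /-- The part of weight `n`. -/
  E (n : ℤ) : CochainComplex (ModuleCat.{u} k) ℤ
  /-- The mixed structure. -/
  ε (n n' a b : ℤ) : (E n).X a ⟶ (E n').X b
  shape (n n' a b : ℤ) (h : ¬ (n + 1 = n' ∧ b + 1 = a)) : ε n n' a b = 0
  d_ε (n n' a b c e : ℤ) (hab : a + 1 = b) (hea : e + 1 = a) (hcb : c + 1 = b) :
    (E n).d a b ≫ ε n n' b c + ε n n' a e ≫ (E n').d e c = 0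
  ε_ε (n n' n'' a b c : ℤ) : ε n n' a b ≫ ε n' n'' b c = 0

namespace GradedMixedComplex

variable {k : Type u} [Field k]

/-- Morphisms of graded mixed complexes: families of morphisms of complexes `E(n) ⟶ E'(n)` which
commute with `ε`. -/
@[ext]
structure Hom (E E' : GradedMixedComplex k) where
  f (n : ℤ) : E.E n ⟶ E'.E n
  comm (n n' a b : ℤ) : E.ε n n' a b ≫ (f n').f b = (f n).f a ≫ E'.ε n n' a b

instance : Category (GradedMixedComplex k) where
  Hom := Hom
  id E := { f := fun n ↦ 𝟙 _, comm := by simp }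
  comp φ ψ :=
    { f := fun n ↦ φ.f n ≫ ψ.f n
      comm := fun n n' a b ↦ by
        simp only [HomologicalComplex.comp_f]
        rw [← Category.assoc, φ.comm, Category.assoc, ψ.comm, Category.assoc] }

variable (k) in
/-- Quasi-isomorphisms of graded mixed complexes: the morphisms which are quasi-isomorphisms in
each weight. -/
def quasiIso : MorphismProperty (GradedMixedComplex k) :=
  fun _ _ φ ↦ ∀ n, QuasiIso (φ.f n)

/-! ### The filtered Tate realization -/

/-- The elements of degree `m` of `F^i|E|^t = ∏_{p ≥ -i} E(p)[-2p]`: families of elements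
`x_p ∈ E(p)^{m-2p}` for `p ≥ -i`, which are extended by `0` to all `p : ℤ`. -/
def tateSubmodule (E : GradedMixedComplex k) (i m : ℤ) :
    Submodule k (∀ p : ℤ, (E.E p).X (m - 2 * p)) where
  carrier := {x | ∀ p, p < -i → x p = 0}
  zero_mem' := fun _ _ ↦ rfl
  add_mem' := fun {x y} hx hy p hp ↦ by
    show x p + y p = 0
    rw [hx p hp, hy p hp, add_zero]
  smul_mem' := fun c x hx p hp ↦ by
    show c • x p = 0
    rw [hx p hp, smul_zero]

/-- The total differential, sum of the cohomological differential and of the mixed structure: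
`(D x)_p = d x_p + ε x_{p-1}`. (It vanishes unless `m' = m + 1`.) -/
def tateD (E : GradedMixedComplex k) (i m m' : ℤ) :
    E.tateSubmodule i m →ₗ[k] E.tateSubmodule i m' where
  toFun x := ⟨fun p ↦ ((E.E p).d (m - 2 * p) (m' - 2 * p)).hom (x.1 p) +
      (E.ε (p - 1) p (m - 2 * (p - 1)) (m' - 2 * p)).hom (x.1 (p - 1)), fun p hp ↦ by
    beta_reduce
    rw [x.2 p hp, x.2 (p - 1) (by lia), map_zero, map_zero, add_zero]⟩
  map_add' x y := by
    ext p
    simp only [Submodule.coe_add, Pi.add_apply, map_add]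
    abel
  map_smul' c x := by
    ext p
    simp only [Submodule.coe_smul, Pi.smul_apply, map_smul, smul_add, RingHom.id_apply]

/-- The complex `F^i|E|^t = ∏_{p ≥ -i} E(p)[-2p]` with the total differential. -/
def tateComplex (E : GradedMixedComplex k) (i : ℤ) : CochainComplex (ModuleCat.{u} k) ℤ where
  X m := ModuleCat.of k (E.tateSubmodule i m)
  d m m' := ModuleCat.ofHom (E.tateD i m m')
  shape m m' h := by
    have h' : ¬ m + 1 = m' := h
    ext x p
    show ((E.E p).d (m - 2 * p) (m' - 2 * p)).hom (x.1 p) +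
      (E.ε (p - 1) p (m - 2 * (p - 1)) (m' - 2 * p)).hom (x.1 (p - 1)) = 0
    rw [(E.E p).shape _ _ (by simp only [ComplexShape.up_Rel]; lia), E.shape _ _ _ _ (by lia)]
    simp
  d_comp_d' m m' m'' hm hm' := by
    obtain rfl : m + 1 = m' := hm
    obtain rfl : m + 1 + 1 = m'' := hm'
    ext x p
    have h₁ := congr($((E.E p).d_comp_d (m - 2 * p) (m + 1 - 2 * p) (m + 1 + 1 - 2 * p)).hom
      (x.1 p))
    have h₂ := congr($(E.d_ε (p - 1) p (m - 2 * (p - 1)) (m + 1 - 2 * (p - 1))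
      (m + 1 + 1 - 2 * p) (m + 1 - 2 * p) (by lia) (by lia) (by lia)).hom (x.1 (p - 1)))
    have h₃ := congr($(E.ε_ε (p - 1 - 1) (p - 1) p (m - 2 * (p - 1 - 1)) (m + 1 - 2 * (p - 1))
      (m + 1 + 1 - 2 * p)).hom (x.1 (p - 1 - 1)))
    simp only [ModuleCat.hom_comp, ModuleCat.hom_add, ModuleCat.hom_zero, LinearMap.comp_apply,
      LinearMap.add_apply, LinearMap.zero_apply] at h₁ h₂ h₃
    show ((E.E p).d (m + 1 - 2 * p) (m + 1 + 1 - 2 * p)).hom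
        (((E.E p).d (m - 2 * p) (m + 1 - 2 * p)).hom (x.1 p) +
          (E.ε (p - 1) p (m - 2 * (p - 1)) (m + 1 - 2 * p)).hom (x.1 (p - 1))) +
      (E.ε (p - 1) p (m + 1 - 2 * (p - 1)) (m + 1 + 1 - 2 * p)).hom
        (((E.E (p - 1)).d (m - 2 * (p - 1)) (m + 1 - 2 * (p - 1))).hom (x.1 (p - 1)) +
          (E.ε (p - 1 - 1) (p - 1) (m - 2 * (p - 1 - 1)) (m + 1 - 2 * (p - 1))).hom
            (x.1 (p - 1 - 1))) = 0
    rw [map_add, map_add, h₁, h₃, zero_add, add_zero, ← h₂]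
    exact add_comm _ _

end GradedMixedComplex

/-- Filtered complexes `⋯ ⟶ F^i ⟶ F^{i+1} ⟶ ⋯`, indexed by the ordered set of integers. -/
abbrev FilteredComplex (k : Type u) [Field k] := ℤ ⥤ CochainComplex (ModuleCat.{u} k) ℤ

namespace GradedMixedComplex

variable {k : Type u} [Field k]

/-- The filtered Tate realization of `E`, with the inclusions `F^i|E|^t ⊆ F^j|E|^t` for `i ≤ j` as
transition maps. -/
def tateObj (E : GradedMixedComplex k) : FilteredComplex k where
  obj i := E.tateComplex i
  map {i j} h :=
    { f := fun m ↦ ModuleCat.ofHom (Submodule.inclusion (show E.tateSubmodule i m ≤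
        E.tateSubmodule j m from fun x hx p hp ↦ hx p (by have := leOfHom h; lia))) }

variable (k) in
/-- The filtered Tate realization `|-|^t`, as a functor from graded mixed complexes to filtered
complexes. -/
def tate : GradedMixedComplex k ⥤ FilteredComplex k where
  obj E := E.tateObj
  map {E E'} φ :=
    { app := fun i ↦
        { f := fun m ↦ ModuleCat.ofHom
            { toFun := fun x ↦ ⟨fun p ↦ ((φ.f p).f (m - 2 * p)).hom (x.1 p), fun p hp ↦ by
                beta_reduce
                rw [x.2 p hp, map_zero]⟩
              map_add' := fun x y ↦ by
                ext p
                simp only [Submodule.coe_add, Pi.add_apply, map_add]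
              map_smul' := fun c x ↦ by
                ext p
                simp only [Submodule.coe_smul, Pi.smul_apply, map_smul, RingHom.id_apply] }
          comm' := fun m m' _ ↦ by
            ext x
            apply Subtype.ext
            funext p
            have h₁ := congr($((φ.f p).comm (m - 2 * p) (m' - 2 * p)).hom (x.1 p))
            have h₂ := congr($(φ.comm (p - 1) p (m - 2 * (p - 1)) (m' - 2 * p)).hom (x.1 (p - 1)))
            simp only [ModuleCat.hom_comp, LinearMap.comp_apply] at h₁ h₂
            show ((E'.E p).d (m - 2 * p) (m' - 2 * p)).hom (((φ.f p).f (m - 2 * p)).hom (x.1 p)) +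
                (E'.ε (p - 1) p (m - 2 * (p - 1)) (m' - 2 * p)).hom
                  (((φ.f (p - 1)).f (m - 2 * (p - 1))).hom (x.1 (p - 1))) =
              ((φ.f p).f (m' - 2 * p)).hom (((E.E p).d (m - 2 * p) (m' - 2 * p)).hom (x.1 p) +
                (E.ε (p - 1) p (m - 2 * (p - 1)) (m' - 2 * p)).hom (x.1 (p - 1)))
            rw [map_add, h₁, h₂] } }

end GradedMixedComplex

/-! ### Complete filtered complexes -/

section

variable {k : Type u} [Field k] (C : ℕ → CochainComplex (ModuleCat.{u} k) ℤ)
  (t : ∀ n, C (n + 1) ⟶ C n)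

/-- The map `1 - shift : ∏ C_n ⟶ ∏ C_n` attached to a tower `⋯ ⟶ C_2 ⟶ C_1 ⟶ C_0`. -/
noncomputable def oneSubShift : ∏ᶜ C ⟶ ∏ᶜ C :=
  Pi.lift fun n ↦ Pi.π C n - Pi.π C (n + 1) ≫ t n

/-- The limit, in the `∞`-category of complexes, of a tower `⋯ ⟶ C_2 ⟶ C_1 ⟶ C_0` of complexes:
the homotopy fibre of `1 - shift : ∏ C_n ⟶ ∏ C_n`. -/
noncomputable def towerHolim : CochainComplex (ModuleCat.{u} k) ℤ :=
  CochainComplex.mappingCocone (oneSubShift C t)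

/-- The natural map from a complex `A` to the homotopy limit of a tower given by a family of
morphisms `A ⟶ C_n` compatible with the transition maps. -/
noncomputable def towerHolimLift {A : CochainComplex (ModuleCat.{u} k) ℤ} (f : ∀ n, A ⟶ C n)
    (hf : ∀ n, f (n + 1) ≫ t n = f n) : A ⟶ towerHolim C t :=
  CochainComplex.mappingCocone.lift (oneSubShift C t) (Pi.lift f) 0 (by
    have : Pi.lift f ≫ oneSubShift C t = 0 := by
      apply Pi.hom_ext
      intro n
      simp [oneSubShift, hf]
    simp [this])

end

namespace FilteredComplex

variable {k : Type u} [Field k]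

variable (k) in
/-- Quasi-isomorphisms of filtered complexes: the morphisms inducing quasi-isomorphisms on each
`F^i`. -/
def quasiIso : MorphismProperty (FilteredComplex k) :=
  fun _ _ φ ↦ ∀ i, QuasiIso (φ.app i)

/-- The quotient `F^i / F^j` for `j ≤ i`, i.e. the cofibre of `F^j ⟶ F^i` in the `∞`-category of
complexes, given by the mapping cone. -/
noncomputable def quot (F : FilteredComplex k) {j i : ℤ} (h : j ≤ i) :
    CochainComplex (ModuleCat.{u} k) ℤ :=
  CochainComplex.mappingCone (F.map (homOfLE h))

/-- The transition map `F^i / F^j' ⟶ F^i / F^j` for `j' ≤ j ≤ i`. -/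
noncomputable def quotMap (F : FilteredComplex k) {j' j i : ℤ} (h' : j' ≤ j) (h : j ≤ i) :
    F.quot (h'.trans h) ⟶ F.quot h :=
  CochainComplex.mappingCone.map _ _ (F.map (homOfLE h')) (𝟙 _) (by
    rw [Category.comp_id, ← F.map_comp]
    rfl)

/-- The projection `F^i ⟶ F^i / F^j` for `j ≤ i`. -/
noncomputable def toQuot (F : FilteredComplex k) {j i : ℤ} (h : j ≤ i) : F.obj i ⟶ F.quot h :=
  CochainComplex.mappingCone.inr _

/-- The natural morphism `F^i ⟶ lim_{j ≤ i} F^i / F^j`, where the indices `j ≤ i` are written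
`j = i - n` with `n : ℕ`, and the limit is a homotopy limit. -/
noncomputable def toLimQuot (F : FilteredComplex k) (i : ℤ) :
    F.obj i ⟶ towerHolim (fun n : ℕ ↦ F.quot (show i - n ≤ i by lia))
      (fun n : ℕ ↦ F.quotMap (show i - (n + 1 : ℕ) ≤ i - n by lia) (by lia)) :=
  towerHolimLift _ _ (fun n : ℕ ↦ F.toQuot (show i - n ≤ i by lia)) (fun n ↦ by
    dsimp only [toQuot, quotMap, CochainComplex.mappingCone.map]
    erw [CochainComplex.mappingCone.inr_desc]
    exact Category.id_comp _)

/-- A filtered complex is complete if `F^i ⟶ lim_{j ≤ i} F^i / F^j` is an equivalence for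
all `i`. -/
def IsComplete (F : FilteredComplex k) : Prop :=
  ∀ i, QuasiIso (F.toLimQuot i)

end FilteredComplex

namespace InftyCat

open SSet Opposite

/-! ### The homotopy category of a quasi-category -/

section HomotopyCategory

/-! The inverse construction is explicit. To a filtered complex F, `toMixed` attaches the graded
mixed complex whose part of weight p is the cone of F^{-p-1} → F^{-p}, shifted by 2p. The factor
F^{-p-1} in weight p reappears as the target factor in weight p + 1, so the connecting map is a
strict mixed structure, of square zero on the nose.

For a graded mixed complex E, the inclusion F^{-p-1} ⊂ F^{-p} of its realization has quotient
E(p)[-2p], and x ↦ (-εx, x) is a natural quasi-isomorphism from E to the graded mixed complex of its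
realization (`toMixedTate_f_quasiIso`). In the other order, the realization of the graded mixed
complex of F is a product of cones which telescopes to the cofibre of holim_{j ≤ i} F^j → F^i, that
is, to the completion of F (`tateToCompletion_app_quasiIso`). So F and its round trip are joined by
a zigzag F → completion ← round trip, whose second arrow is always a quasi-isomorphism. The first is
one exactly when the homotopy limit of the F^j is acyclic, which is the completeness of F
(`isComplete_iff`). A Tate realization is complete because its filtration is by tails of products
(`isTowerAcyclic_tateObj`), and the realization preserves quasi-isomorphisms because the equations
can be solved one weight at a time (`tate_map_quasiIso`).

`isFullyFaithful_of_isInducedBy` turns these zigzags into the theorem. Let T and S be induced on the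
localizations by the two constructions. Then ST is equivalent to the identity, and there is a
transformation from the identity to TS which is invertible precisely at the complete objects, in
particular at all objects T(x). On mapping spaces, S ∘ T is then an equivalence, and so is T ∘ S
between objects in the image of T; two-out-of-six gives that T is fully faithful. The essential
image is the locus where the transformation is invertible. Here it is needed that a map which
becomes invertible in the localization is a quasi-isomorphism; homology functors detect this.

The remaining part is quasi-category theory from horn filling alone. Its root is Joyal's lifting
theorem for special outer horns (`exists_lift_of_special_horn`), proved by induction on the
dimension through the décalage. Decomposing prisms into simplices, it yields the extension of
pointwise invertible transformations along monomorphisms (`exists_extension`). From this follow that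
pointwise invertible transformations are invertible (`isInv_natSimplex_iff`), and that a functor
joined to the identity by a transformation invertible at x and y induces an equivalence on Map(x, y)
(`isHomotopyEquiv_mapSpaceMap`). -/

lemma stdSimplex_δ_comp_yonedaEquiv_symm {X : SSet.{u}} {n : ℕ} (i : Fin (n + 2)) (x : X _⦋n + 1⦌) :
    stdSimplex.δ i ≫ yonedaEquiv.symm x = yonedaEquiv.symm (X.δ i x) :=
  yonedaEquiv_symm_naturality_left _ _

lemma yonedaEquiv_δ_comp {X : SSet.{u}} {n : ℕ} (i : Fin (n + 2)) (f : Δ[n + 1] ⟶ X) :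
    yonedaEquiv (stdSimplex.δ i ≫ f) = X.δ i (yonedaEquiv f) :=
  (yonedaEquiv_naturality _ _).symm

/-- The compatibility of a family of simplices indexed by the faces of a horn. -/
def HornCompat {X : SSet.{u}} {n : ℕ} (i : Fin (n + 2))
    (x : ∀ j : Fin (n + 2), j ≠ i → X _⦋n⦌) : Prop :=
  match n with
  | 0 => True
  | _ + 1 => ∀ j k (hj : j ≠ i) (hk : k ≠ i) (hjk : j < k),
      X.δ (k.pred (Fin.ne_zero_of_lt hjk)) (x j hj) =
        X.δ (j.castPred (Fin.ne_last_of_lt hjk)) (x k hk)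

lemma HornCompat.exists_hom {X : SSet.{u}} {n : ℕ} {i : Fin (n + 2)}
    {x : ∀ j : Fin (n + 2), j ≠ i → X _⦋n⦌} (hx : HornCompat i x) :
    ∃ g : (Λ[n + 1, i] : SSet) ⟶ X, ∀ j hj, g.app _ (horn.face i j hj) = x j hj := by
  have h : horn.IsCompatible (fun j hj ↦ yonedaEquiv.symm (x j hj)) := by
    cases n with
    | zero => trivial
    | succ n =>
      intro j k hj hk hjk
      rw [stdSimplex_δ_comp_yonedaEquiv_symm, stdSimplex_δ_comp_yonedaEquiv_symm,
        hx j k hj hk hjk]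
  obtain ⟨φ, hφ⟩ := h.exists_desc
  refine ⟨φ, fun j hj ↦ ?_⟩
  have := congr(yonedaEquiv $(hφ j hj))
  rw [Equiv.apply_symm_apply] at this
  exact this

lemma HornCompat.of_hom {X : SSet.{u}} {n : ℕ} {i : Fin (n + 2)}
    (g : (Λ[n + 1, i] : SSet) ⟶ X) :
    HornCompat i (fun j hj ↦ g.app _ (horn.face i j hj)) := by
  cases n with
  | zero => trivial
  | succ n =>
    intro j k hj hk hjk
    have := congr(yonedaEquiv $(horn.IsCompatible.of_hom g j k hj hk hjk))
    rw [yonedaEquiv_δ_comp, yonedaEquiv_δ_comp] at this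
    exact this

/-- The lifting property with respect to a horn inclusion, in terms of simplices. -/
lemma exists_lift_of_hornCompat {X Y : SSet.{u}} {n : ℕ} {i : Fin (n + 2)} (p : X ⟶ Y)
    [HasLiftingProperty Λ[n + 1, i].ι p] (x : ∀ j : Fin (n + 2), j ≠ i → X _⦋n⦌)
    (hx : HornCompat i x) (y : Y _⦋n + 1⦌) (hy : ∀ j hj, Y.δ j y = p.app _ (x j hj)) :
    ∃ z : X _⦋n + 1⦌, (∀ j hj, X.δ j z = x j hj) ∧ p.app _ z = y := by
  obtain ⟨g, hg⟩ := hx.exists_hom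
  have sq : CommSq g Λ[n + 1, i].ι p (yonedaEquiv.symm y) := ⟨by
    apply horn.hom_ext
    intro j hj
    simp only [NatTrans.comp_app]
    show p.app _ (g.app _ _) = _
    rw [hg, ← hy]
    rfl⟩
  refine ⟨yonedaEquiv sq.lift, fun j hj ↦ ?_, ?_⟩
  · rw [← hg, ← yonedaEquiv_δ_comp, ← horn.ι_ι i j hj, Category.assoc, sq.fac_left]
    rfl
  · rw [← yonedaEquiv_comp, sq.fac_right, Equiv.apply_symm_apply]

lemma exists_filler_of_hornCompat {X : SSet.{u}} [Quasicategory X] {n : ℕ} {i : Fin (n + 2)}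
    (h0 : 0 < i) (hn : i < Fin.last _) (x : ∀ j : Fin (n + 2), j ≠ i → X _⦋n⦌)
    (hx : HornCompat i x) :
    ∃ z : X _⦋n + 1⦌, ∀ j hj, X.δ j z = x j hj := by
  obtain ⟨g, hg⟩ := hx.exists_hom
  obtain ⟨σ, hσ⟩ := Quasicategory.hornFilling h0 hn g
  refine ⟨SSet.yonedaEquiv σ, fun j hj ↦ ?_⟩
  rw [← hg, ← yonedaEquiv_δ_comp, ← horn.ι_ι i j hj, Category.assoc, ← hσ]
  rfl

-- The three axioms are the fillings of the inner horns Λ[2,1], Λ[3,1] and Λ[3,2]. The instance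
-- gives access to the homotopy category of the 2-truncation.
open Truncated in
instance (X : SSet.{u}) [Quasicategory X] : Quasicategory₂ ((truncation 2).obj X) where
  fill21 {x₀ x₁ x₂} e f := by
    let e' : X.Edge x₀ x₁ := e
    let f' : X.Edge x₁ x₂ := f
    obtain ⟨z, hz⟩ := exists_filler_of_hornCompat (X := X) (i := (1 : Fin 3)) (by simp) (by decide)
      (fun j _ ↦ match j with
        | 0 => f'.edge
        -- Arbitrary value: this face is missing from the horn, and the index is excluded by the
        -- unnamed hypothesis `j ≠ i`. The same convention is used in the other explicit horns.
        | 1 => f'.edge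
        | 2 => e'.edge) (fun j k hj hk hjk ↦ by
          fin_cases j <;> fin_cases k <;> simp at hj hk hjk
          exact f'.src_eq.trans e'.tgt_eq.symm)
    have h0 : X.δ 0 z = f'.edge := hz 0 (by decide)
    have h2 : X.δ 2 z = e'.edge := hz 2 (by decide)
    exact ⟨⟨SSet.Edge.mk (X.δ 1 z)
      ((ConcreteCategory.congr_hom (X.δ_comp_δ (i := 1) (j := 1) le_rfl) z).symm.trans
        ((congrArg (X.δ 1) h2).trans e'.src_eq))
      ((ConcreteCategory.congr_hom (X.δ_comp_δ (i := 0) (j := 0) le_rfl) z).trans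
        ((congrArg (X.δ 0) h0).trans f'.tgt_eq)), SSet.Edge.CompStruct.mk z h2 h0 rfl⟩⟩
  fill31 {x₀ x₁ x₂ x₃ e₀₁ e₁₂ e₂₃ e₀₂ e₁₃ e₀₃} f₃ f₀ f₂ := by
    let g₃ : SSet.Edge.CompStruct (X := X) e₀₁ e₁₂ e₀₂ := f₃
    let g₀ : SSet.Edge.CompStruct (X := X) e₁₂ e₂₃ e₁₃ := f₀
    let g₂ : SSet.Edge.CompStruct (X := X) e₀₁ e₁₃ e₀₃ := f₂
    obtain ⟨z, hz⟩ := exists_filler_of_hornCompat (X := X) (i := (1 : Fin 4)) (by simp) (by decide)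
      (fun j _ ↦ match j with
        | 0 => g₀.simplex
        | 1 => g₀.simplex
        | 2 => g₂.simplex
        | 3 => g₃.simplex) (fun j k hj hk hjk ↦ by
          fin_cases j <;> fin_cases k <;> simp at hj hk hjk
          · exact g₀.d₁.trans g₂.d₀.symm
          · exact g₀.d₂.trans g₃.d₀.symm
          · exact g₂.d₂.trans g₃.d₂.symm)
    have h0 : X.δ 0 z = g₀.simplex := hz 0 (by decide)
    have h2 : X.δ 2 z = g₂.simplex := hz 2 (by decide)
    have h3 : X.δ 3 z = g₃.simplex := hz 3 (by decide)
    exact ⟨SSet.Edge.CompStruct.mk (X.δ 1 z)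
      ((ConcreteCategory.congr_hom (X.δ_comp_δ (i := 1) (j := 2) (by decide)) z).symm.trans
        ((congrArg (X.δ 1) h3).trans g₃.d₁))
      ((ConcreteCategory.congr_hom (X.δ_comp_δ (i := 0) (j := 0) (by decide)) z).trans
        ((congrArg (X.δ 0) h0).trans g₀.d₀))
      ((ConcreteCategory.congr_hom (X.δ_comp_δ (i := 1) (j := 1) (by decide)) z).symm.trans
        ((congrArg (X.δ 1) h2).trans g₂.d₁))⟩
  fill32 {x₀ x₁ x₂ x₃ e₀₁ e₁₂ e₂₃ e₀₂ e₁₃ e₀₃} f₃ f₀ f₁ := by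
    let g₃ : SSet.Edge.CompStruct (X := X) e₀₁ e₁₂ e₀₂ := f₃
    let g₀ : SSet.Edge.CompStruct (X := X) e₁₂ e₂₃ e₁₃ := f₀
    let g₁ : SSet.Edge.CompStruct (X := X) e₀₂ e₂₃ e₀₃ := f₁
    obtain ⟨z, hz⟩ := exists_filler_of_hornCompat (X := X) (i := (2 : Fin 4)) (by simp) (by decide)
      (fun j _ ↦ match j with
        | 0 => g₀.simplex
        | 1 => g₁.simplex
        | 2 => g₁.simplex
        | 3 => g₃.simplex) (fun j k hj hk hjk ↦ by
          fin_cases j <;> fin_cases k <;> simp at hj hk hjk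
          · exact g₀.d₀.trans g₁.d₀.symm
          · exact g₀.d₂.trans g₃.d₀.symm
          · exact g₁.d₂.trans g₃.d₁.symm)
    have h0 : X.δ 0 z = g₀.simplex := hz 0 (by decide)
    have h1 : X.δ 1 z = g₁.simplex := hz 1 (by decide)
    have h3 : X.δ 3 z = g₃.simplex := hz 3 (by decide)
    exact ⟨SSet.Edge.CompStruct.mk (X.δ 2 z)
      ((ConcreteCategory.congr_hom (X.δ_comp_δ (i := 2) (j := 2) (by decide)) z).symm.trans
        ((congrArg (X.δ 2) h3).trans g₃.d₂))
      ((ConcreteCategory.congr_hom (X.δ_comp_δ (i := 0) (j := 1) (by decide)) z).trans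
        ((congrArg (X.δ 1) h0).trans g₀.d₁))
      ((ConcreteCategory.congr_hom (X.δ_comp_δ (i := 1) (j := 1) (by decide)) z).trans
        ((congrArg (X.δ 1) h1).trans g₁.d₁))⟩

/-- An object of a quasi-category as an object of its homotopy category. -/
abbrev hoObj {X : SSet.{u}} (x : X _⦋0⦌) : Truncated.HomotopyCategory₂ ((truncation 2).obj X) := ⟨x⟩

/-- The homotopy class of an edge. -/
def hoHom {X : SSet.{u}} [Quasicategory X] {x y : X _⦋0⦌} (e : X.Edge x y) : hoObj x ⟶ hoObj y :=
  Truncated.HomotopyCategory₂.homMk e.toTruncated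

variable {X : SSet.{u}} [Quasicategory X] {x y z : X _⦋0⦌}

lemma hoHom_surjective (f : hoObj x ⟶ hoObj y) : ∃ e : X.Edge x y, hoHom e = f :=
  Truncated.HomotopyCategory₂.homMk_surjective f

@[simp]
lemma hoHom_id (x : X _⦋0⦌) : hoHom (Edge.id x) = 𝟙 (hoObj x) := rfl

lemma nonempty_compStruct_iff {f : X.Edge x y} {g : X.Edge y z} {h : X.Edge x z} :
    Nonempty (Edge.CompStruct f g h) ↔ hoHom f ≫ hoHom g = hoHom h :=
  Truncated.Edge.CompStruct.nonempty_iff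

lemma compStruct_fac {f : X.Edge x y} {g : X.Edge y z} {h : X.Edge x z}
    (s : Edge.CompStruct f g h) : hoHom f ≫ hoHom g = hoHom h :=
  nonempty_compStruct_iff.1 ⟨s⟩

/-- Equivalences are thereby handled by cancellation in an ordinary category. -/
lemma isEquivalence_iff_isIso (e : X.Edge x y) : IsEquivalence e ↔ IsIso (hoHom e) := by
  constructor
  · rintro ⟨i⟩
    exact ⟨hoHom i.inv, by rw [compStruct_fac i.homInvId, hoHom_id],
      by rw [compStruct_fac i.invHomId, hoHom_id]⟩
  · intro h
    obtain ⟨e', he'⟩ := hoHom_surjective (inv (hoHom e))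
    obtain ⟨h₁⟩ := nonempty_compStruct_iff.2 (show hoHom e ≫ hoHom e' = hoHom (Edge.id x) by
      rw [he', IsIso.hom_inv_id, hoHom_id])
    obtain ⟨h₂⟩ := nonempty_compStruct_iff.2 (show hoHom e' ≫ hoHom e = hoHom (Edge.id y) by
      rw [he', IsIso.inv_hom_id, hoHom_id])
    exact ⟨⟨e', h₁, h₂⟩⟩

lemma equivalent_iff_nonempty_iso : Equivalent x y ↔ Nonempty (hoObj x ≅ hoObj y) := by
  constructor
  · rintro ⟨e, he⟩
    have := (isEquivalence_iff_isIso e).1 he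
    exact ⟨asIso (hoHom e)⟩
  · rintro ⟨i⟩
    obtain ⟨e, he⟩ := hoHom_surjective i.hom
    exact ⟨e, (isEquivalence_iff_isIso e).2 (by rw [he]; infer_instance)⟩

omit [Quasicategory X] in
lemma IsEquivalence.map {Y : SSet.{u}} {e : X.Edge x y} (h : IsEquivalence e) (f : X ⟶ Y) :
    IsEquivalence (e.map f) := by
  obtain ⟨i⟩ := h
  exact ⟨i.map f⟩

omit [Quasicategory X] in
lemma IsEquivalence.ofEq {x' y' : X _⦋0⦌} {e : X.Edge x y} {e' : X.Edge x' y'}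
    (h : IsEquivalence e) (he : e.edge = e'.edge) : IsEquivalence e' := by
  obtain ⟨i⟩ := h
  exact ⟨i.ofEq he⟩

omit [Quasicategory X] in
lemma isEquivalence_id (x : X _⦋0⦌) : IsEquivalence (Edge.id x) :=
  ⟨Edge.InvStruct.invStructId x⟩

omit [Quasicategory X] in
lemma Equivalent.map {Y : SSet.{u}} (h : Equivalent x y) (f : X ⟶ Y) :
    Equivalent (f.app _ x) (f.app _ y) := by
  obtain ⟨e, he⟩ := h
  exact ⟨e.map f, he.map f⟩

omit [Quasicategory X] in
lemma Equivalent.refl (x : X _⦋0⦌) : Equivalent x x := ⟨_, isEquivalence_id x⟩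

lemma Equivalent.symm (h : Equivalent x y) : Equivalent y x := by
  rw [equivalent_iff_nonempty_iso] at h ⊢
  exact ⟨h.some.symm⟩

lemma Equivalent.trans (h : Equivalent x y) (h' : Equivalent y z) : Equivalent x z := by
  rw [equivalent_iff_nonempty_iso] at *
  exact ⟨h.some ≪≫ h'.some⟩

lemma hoHom_map_congr {Y : SSet.{u}} [Quasicategory Y] (f : X ⟶ Y) {e e' : X.Edge x y}
    (h : hoHom e = hoHom e') : hoHom (e.map f) = hoHom (e'.map f) := by
  obtain ⟨s⟩ := nonempty_compStruct_iff.2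
    (show hoHom e ≫ hoHom (Edge.id y) = hoHom e' by rw [h, hoHom_id, Category.comp_id])
  have := compStruct_fac (s.map f)
  rwa [Edge.map_id, hoHom_id, Category.comp_id] at this

end HomotopyCategory

end InftyCat

namespace InftyCat

open SSet Opposite

/-! ### Décalage and right fibrations -/

section Decalage

/-- The monotone map `f ⋆ id : ⦋n⦌ ⋆ ⦋0⦌ ⟶ ⦋m⦌ ⋆ ⦋0⦌`. -/
def addLastOrderHom {n m : ℕ} (f : Fin (n + 1) →o Fin (m + 1)) : Fin (n + 2) →o Fin (m + 2) where
  toFun := Fin.lastCases (Fin.last _) (fun i ↦ (f i).castSucc)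
  monotone' := by
    intro i j
    induction i using Fin.lastCases with
    | last =>
      intro h
      obtain rfl := Fin.last_le_iff.1 h
      rfl
    | cast i =>
      induction j using Fin.lastCases with
      | last =>
        intro _
        simp only [Fin.lastCases_last]
        exact Fin.le_last _
      | cast j =>
        intro h
        simp only [Fin.lastCases_castSucc, Fin.castSucc_le_castSucc_iff] at h ⊢
        exact f.monotone h

@[simp]
lemma addLastOrderHom_last {n m : ℕ} (f : Fin (n + 1) →o Fin (m + 1)) :
    addLastOrderHom f (Fin.last _) = Fin.last _ :=
  Fin.lastCases_last (motive := fun _ ↦ Fin (m + 2))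

@[simp]
lemma addLastOrderHom_castSucc {n m : ℕ} (f : Fin (n + 1) →o Fin (m + 1)) (i : Fin (n + 1)) :
    addLastOrderHom f i.castSucc = (f i).castSucc :=
  Fin.lastCases_castSucc (motive := fun _ ↦ Fin (m + 2)) _

/-- The functor `⦋n⦌ ↦ ⦋n⦌ ⋆ ⦋0⦌ = ⦋n + 1⦌` on the simplex category. -/
def addLast : SimplexCategory ⥤ SimplexCategory where
  obj n := ⦋n.len + 1⦌
  map f := SimplexCategory.Hom.mk (addLastOrderHom f.toOrderHom)
  map_id n := by
    ext i : 3
    induction i using Fin.lastCases with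
    | last => exact addLastOrderHom_last _
    | cast i => exact addLastOrderHom_castSucc _ i
  map_comp f g := by
    ext i : 3
    induction i using Fin.lastCases with
    | last =>
      show addLastOrderHom _ _ = addLastOrderHom _ (addLastOrderHom _ _)
      simp
    | cast i =>
      show addLastOrderHom _ _ = addLastOrderHom _ (addLastOrderHom _ _)
      simp

lemma addLast_map_δ {n : ℕ} (j : Fin (n + 2)) :
    addLast.map (SimplexCategory.δ j) = SimplexCategory.δ (n := n + 1) j.castSucc := by
  ext i : 3
  induction i using Fin.lastCases with
  | last =>
    refine (addLastOrderHom_last _).trans ?_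
    exact (Fin.succAbove_ne_last_last (Fin.castSucc_ne_last j)).symm
  | cast i =>
    refine (addLastOrderHom_castSucc _ i).trans ?_
    exact (Fin.castSucc_succAbove_castSucc).symm

/-- The natural inclusion `⦋n⦌ ⟶ ⦋n⦌ ⋆ ⦋0⦌`. -/
def toAddLast : 𝟭 SimplexCategory ⟶ addLast where
  app n := SimplexCategory.δ (Fin.last _)
  naturality n m f := by
    ext i : 3
    show Fin.succAbove (Fin.last _) (f.toOrderHom i) =
      addLastOrderHom f.toOrderHom (Fin.succAbove (Fin.last _) i)
    simp [Fin.succAbove_last]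

/-- The décalage of a simplicial set: its `n`-simplices are the `n + 1`-simplices of `X`, and the
last face is forgotten. -/
def dec (X : SSet.{u}) : SSet.{u} := addLast.op ⋙ X

/-- The functoriality of the décalage. -/
def decMap {X Y : SSet.{u}} (f : X ⟶ Y) : dec X ⟶ dec Y := Functor.whiskerLeft addLast.op f

/-- The last face, as a map from the décalage. -/
def decπ (X : SSet.{u}) : dec X ⟶ X := Functor.whiskerRight (NatTrans.op toAddLast) X

/-- The added vertex is the last one, so the faces of the décalage are those faces of X which keep
it, with unchanged numbering. -/
lemma dec_δ (X : SSet.{u}) {n : ℕ} (j : Fin (n + 2)) (x : (dec X) _⦋n + 1⦌) :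
    (dec X).δ j x = X.δ (n := n + 1) j.castSucc x := by
  show X.map (addLast.map (SimplexCategory.δ j)).op x = _
  rw [addLast_map_δ]
  rfl

lemma decMap_comp_decπ {X Y : SSet.{u}} (p : X ⟶ Y) : decMap p ≫ decπ Y = decπ X ≫ p := by
  ext n x
  exact (ConcreteCategory.congr_hom (p.naturality (toAddLast.app n.unop).op) x).symm

/-- The relative décalage `dec X ⟶ dec Y ×_Y X` of a map `p : X ⟶ Y`. -/
noncomputable def relDec {X Y : SSet.{u}} (p : X ⟶ Y) : dec X ⟶ pullback (decπ Y) p :=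
  pullback.lift (decMap p) (decπ X) (decMap_comp_decπ p)

lemma relDec_fst {X Y : SSet.{u}} (p : X ⟶ Y) : relDec p ≫ pullback.fst _ _ = decMap p :=
  pullback.lift_fst _ _ _

lemma relDec_snd {X Y : SSet.{u}} (p : X ⟶ Y) : relDec p ≫ pullback.snd _ _ = decπ X :=
  pullback.lift_snd _ _ _

lemma app_face_eq {X Y Z : SSet.{u}} {n : ℕ} {i : Fin (n + 2)} {p : X ⟶ Y}
    {g : (Λ[n + 1, i] : SSet) ⟶ X} {y : Δ[n + 1] ⟶ Y} (w : g ≫ p = Λ[n + 1, i].ι ≫ y)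
    (q : Y ⟶ Z) (r : X ⟶ Z) (hr : p ≫ q = r) (j : Fin (n + 2)) (hj : j ≠ i) :
    r.app _ (g.app _ (horn.face i j hj)) = Z.δ j (SSet.yonedaEquiv (y ≫ q)) := by
  rw [← yonedaEquiv_δ_comp, ← horn.ι_ι i j hj, Category.assoc, ← reassoc_of% w, hr]
  rfl

lemma yonedaEquiv_symm_comp_eq {A B : SSet.{u}} {n : ℕ} (z : A _⦋n⦌) (f : A ⟶ B) (h : Δ[n] ⟶ B)
    (hh : f.app _ z = SSet.yonedaEquiv h) : SSet.yonedaEquiv.symm z ≫ f = h := by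
  apply SSet.yonedaEquiv.injective
  rw [← hh, SSet.yonedaEquiv_comp, Equiv.apply_symm_apply]

/-- Adding a last vertex turns Λ[n+1, i] into Λ[n+2, i.castSucc]. The faces of the horn in `dec X`
are the faces containing the new vertex, and the component in `X` of the given simplex of the
pullback is the face opposite to it. -/
lemma hasLiftingProperty_relDec {X Y : SSet.{u}} (p : X ⟶ Y) {n : ℕ} (i : Fin (n + 2))
    [HasLiftingProperty (horn (n + 2) i.castSucc).ι p] :
    HasLiftingProperty Λ[n + 1, i].ι (relDec p) where
  sq_hasLift {g y} sq := by
    have h₁ := app_face_eq sq.w (pullback.fst _ _) (decMap p) (pullback.lift_fst _ _ _)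
    have h₂ := app_face_eq sq.w (pullback.snd _ _) (decπ X) (pullback.lift_snd _ _ _)
    have h₃ : (decπ Y).app _ (SSet.yonedaEquiv (y ≫ pullback.fst _ _)) =
        p.app _ (SSet.yonedaEquiv (y ≫ pullback.snd _ _)) :=
      congr(SSet.yonedaEquiv (y ≫ $(pullback.condition (f := decπ Y) (g := p))))
    set y₁ := SSet.yonedaEquiv (y ≫ pullback.fst _ _)
    set x' := SSet.yonedaEquiv (y ≫ pullback.snd _ _)
    let x : ∀ j : Fin (n + 3), j ≠ i.castSucc → X _⦋n + 1⦌ := fun j ↦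
      Fin.lastCases (motive := fun j ↦ j ≠ i.castSucc → X _⦋n + 1⦌) (fun _ ↦ x')
        (fun j hj ↦ g.app _ (horn.face i j (fun h ↦ hj (by rw [h])))) j
    have hx₁ (h) : x (Fin.last _) h = x' :=
      congrFun (Fin.lastCases_last (motive := fun j ↦ j ≠ i.castSucc → X _⦋n + 1⦌)) h
    have hx₂ (j : Fin (n + 2)) (h) :
        x j.castSucc h = g.app _ (horn.face i j (fun h' ↦ h (by rw [h']))) :=
      congrFun (Fin.lastCases_castSucc (motive := fun j ↦ j ≠ i.castSucc → X _⦋n + 1⦌) j) h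
    obtain ⟨z, hz, hz'⟩ := exists_lift_of_hornCompat p x (by
      intro j k hj hk hjk
      obtain ⟨j, rfl⟩ := j.eq_castSucc_of_ne_last (Fin.ne_last_of_lt hjk)
      induction k using Fin.lastCases with
      | last =>
        rw [hx₁, hx₂, Fin.castPred_castSucc, ← h₂]
        rfl
      | cast k =>
        rw [hx₂, hx₂, Fin.castPred_castSucc]
        have hjk' : j < k := hjk
        -- For n = 0 there is a single face other than i, hence no pair j < k of such faces.
        obtain _ | n := n
        · exfalso
          have h₁ : j ≠ i := fun h ↦ hj (by rw [h])
          have h₂ : k ≠ i := fun h ↦ hk (by rw [h])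
          omega
        · have := HornCompat.of_hom g j k (fun h ↦ hj (by rw [h])) (fun h ↦ hk (by rw [h])) hjk'
          rw [dec_δ, dec_δ] at this
          exact this) y₁ (by
      intro j hj
      induction j using Fin.lastCases with
      | last => rw [hx₁]; exact h₃
      | cast j =>
        rw [hx₂]
        exact ((h₁ j _).trans (dec_δ _ _ _)).symm)
    refine ⟨⟨(SSet.yonedaEquiv (X := dec X) (n := ⦋n + 1⦌)).symm z, ?_, ?_⟩⟩
    · apply horn.hom_ext
      intro j hj
      refine Eq.trans ?_ ((hz j.castSucc (fun h ↦ hj (by simpa using h))).trans (hx₂ _ _))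
      exact dec_δ X j z
    · apply pullback.hom_ext
      · rw [Category.assoc, relDec_fst]
        exact yonedaEquiv_symm_comp_eq _ _ _ hz'
      · rw [Category.assoc, relDec_snd]
        exact yonedaEquiv_symm_comp_eq _ _ _
          ((hz (Fin.last _) (Fin.castSucc_ne_last i).symm).trans (hx₁ _))

/-- Right fibrations of simplicial sets. -/
def IsRightFibration {X Y : SSet.{u}} (p : X ⟶ Y) : Prop :=
  ∀ ⦃n : ℕ⦄ (i : Fin (n + 2)), 0 < i → HasLiftingProperty Λ[n + 1, i].ι p

lemma IsRightFibration.innerFibration {X Y : SSet.{u}} {p : X ⟶ Y} (hp : IsRightFibration p) :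
    InnerFibration p :=
  ⟨fun _ _ _ ⟨i, h0, _⟩ ↦ hp i h0⟩

lemma IsRightFibration.of_isPullback {X Y Z W : SSet.{u}} {p : X ⟶ Y} {q : Z ⟶ W} {f : X ⟶ Z}
    {g : Y ⟶ W} (sq : IsPullback f p q g) (hq : IsRightFibration q) : IsRightFibration p :=
  fun _ i hi ↦ by
    have := hq i hi
    exact sq.hasLiftingProperty _

/-- For i > 0 the horn index `i.castSucc` is neither the first nor the last, so only inner horns of
`p` are involved. -/
lemma isRightFibration_relDec {X Y : SSet.{u}} (p : X ⟶ Y) [hp : InnerFibration p] :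
    IsRightFibration (relDec p) := fun n i hi ↦ by
  have : HasLiftingProperty (horn (n + 2) i.castSucc).ι p :=
    hp.mem _ (horn_ι_mem_innerHornInclusions (by simpa using hi) (Fin.castSucc_lt_last i))
  exact hasLiftingProperty_relDec p i

/-- The map to the décalage of a terminal simplicial set. -/
noncomputable def toDecTerminal (A : SSet.{u}) : A ⟶ dec (⊤_ SSet.{u}) where
  app n := ↾fun _ ↦ SSet.yonedaEquiv (X := ⊤_ SSet.{u}) (terminal.from _)
  naturality n m f := by
    ext a
    exact (SSet.yonedaEquiv (X := ⊤_ SSet.{u})).symm.injective (Subsingleton.elim _ _)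

/-- This is the relative statement for X → pt, since maps to the décalage of the point are unique.
-/
lemma isRightFibration_decπ (X : SSet.{u}) [Quasicategory X] : IsRightFibration (decπ X) := by
  have hs {A : SSet.{u}} (f g : A ⟶ dec (⊤_ SSet.{u})) : f = g := by
    ext n a
    have := Subsingleton.elim ((SSet.yonedaEquiv (X := ⊤_ SSet.{u})).symm (f.app _ a))
      ((SSet.yonedaEquiv (X := ⊤_ SSet.{u})).symm (g.app _ a))
    exact (SSet.yonedaEquiv (X := ⊤_ SSet.{u})).symm.injective this
  refine fun n i hi ↦ ⟨fun {g y} sq ↦ ?_⟩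
  have := isRightFibration_relDec (terminal.from X) i hi
  have sq' : CommSq g Λ[n + 1, i].ι (relDec (terminal.from X))
      (pullback.lift (toDecTerminal _) y (Subsingleton.elim _ _)) :=
    ⟨by
      apply pullback.hom_ext
      · exact hs _ _
      · rw [Category.assoc, Category.assoc, relDec_snd, pullback.lift_snd, sq.w]⟩
  refine ⟨⟨sq'.lift, sq'.fac_left, ?_⟩⟩
  have := congr($(sq'.fac_right) ≫ pullback.snd _ _)
  rwa [Category.assoc, relDec_snd, pullback.lift_snd] at this

/-- A simplex of dimension `1` is invertible if it is an equivalence. -/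
def IsInv {X : SSet.{u}} (e : X _⦋1⦌) : Prop := IsEquivalence (Edge.mk' e)

lemma isEquivalence_iff_isInv {X : SSet.{u}} {x y : X _⦋0⦌} (e : X.Edge x y) :
    IsEquivalence e ↔ IsInv e.edge :=
  ⟨fun h ↦ h.ofEq rfl, fun h ↦ h.ofEq rfl⟩

lemma IsInv.map {X Y : SSet.{u}} {e : X _⦋1⦌} (h : IsInv e) (f : X ⟶ Y) : IsInv (f.app _ e) :=
  IsEquivalence.ofEq (IsEquivalence.map h f) rfl

/-- Fill the horn Λ[2,2] with faces e and the identity of b, above the triangle which exhibits an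
inverse of the image of e. The new face is a one-sided inverse which still maps to an equivalence,
so the construction can be iterated. -/
lemma IsRightFibration.exists_retraction {X Y : SSet.{u}} {p : X ⟶ Y} (hp : IsRightFibration p)
    {a b : X _⦋0⦌} (e : X.Edge a b) (he : IsEquivalence (e.map p)) :
    ∃ f : X.Edge b a, Nonempty (Edge.CompStruct f e (Edge.id b)) ∧ IsEquivalence (f.map p) := by
  obtain ⟨i⟩ := he
  have := hp (n := 1) 2 (by simp)
  obtain ⟨z, hz, hz'⟩ := exists_lift_of_hornCompat (i := (2 : Fin 3)) p
      (fun j _ ↦ match j with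
        | 0 => e.edge
        | 1 => (Edge.id b).edge
        | 2 => e.edge) (fun j k hj hk hjk ↦ by
          fin_cases j <;> fin_cases k <;> simp at hj hk hjk
          exact e.tgt_eq.trans (Edge.id b).tgt_eq.symm) i.invHomId.simplex (fun j hj ↦ by
          fin_cases j
          · exact i.invHomId.d₀
          · exact i.invHomId.d₁.trans congr(($(Edge.map_id b p)).edge).symm
          · simp at hj)
  have h0 : X.δ 0 z = e.edge := hz 0 (by decide)
  have h1 : X.δ 1 z = (Edge.id b).edge := hz 1 (by decide)
  have h2 : p.app _ (X.δ 2 z) = i.inv.edge := by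
    refine Eq.trans ?_ i.invHomId.d₂
    rw [← hz']
    exact (ConcreteCategory.congr_hom (p.naturality (SimplexCategory.δ 2).op) z)
  refine ⟨Edge.mk (X.δ 2 z) ?_ ?_, ⟨Edge.CompStruct.mk z rfl h0 h1⟩, ?_⟩
  · exact (ConcreteCategory.congr_hom (X.δ_comp_δ (i := 1) (j := 1) le_rfl) z).trans
      ((congrArg (X.δ 1) h1).trans (Edge.id b).src_eq)
  · exact (ConcreteCategory.congr_hom (X.δ_comp_δ (i := 0) (j := 1) (by decide)) z).trans
      ((congrArg (X.δ 1) h0).trans e.src_eq)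
  · exact IsEquivalence.ofEq (e := i.inv) ⟨i.invStructInv⟩ h2.symm

/-- The one-sided inverse f of e itself has a one-sided inverse e', and the usual argument in the
homotopy category shows that e' and e agree. -/
lemma IsRightFibration.isEquivalence_of_map {X Y : SSet.{u}} [Quasicategory Y] {p : X ⟶ Y}
    (hp : IsRightFibration p) {a b : X _⦋0⦌} (e : X.Edge a b) (he : IsEquivalence (e.map p)) :
    IsEquivalence e := by
  have := hp.innerFibration
  have := quasicategory_of_innerFibration p
  obtain ⟨f, ⟨s⟩, hf⟩ := hp.exists_retraction e he
  obtain ⟨e', ⟨s'⟩, -⟩ := hp.exists_retraction f hf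
  have h := compStruct_fac s
  have h' := compStruct_fac s'
  rw [hoHom_id] at h h'
  have h₁ : hoHom e' = hoHom e := by
    rw [← Category.comp_id (hoHom e'), ← h, ← Category.assoc, h', Category.id_comp]
  rw [h₁] at h'
  exact (isEquivalence_iff_isIso e).2 ⟨hoHom f, h', h⟩

lemma IsRightFibration.isInv_of_map {X Y : SSet.{u}} [Quasicategory Y] {p : X ⟶ Y}
    (hp : IsRightFibration p) {e : X _⦋1⦌} (he : IsInv (p.app _ e)) : IsInv e :=
  hp.isEquivalence_of_map (Edge.mk' e) (IsEquivalence.ofEq he rfl)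

/-- A right fibration lifts edges with prescribed target, whereas here the source is prescribed. So
lift the inverse of e to an edge f ending at a, then fill the Λ[2,2] with faces f and the identity
of a above the triangle composing e with its inverse; its new face lifts e. -/
lemma IsRightFibration.exists_lift_edge {X Y : SSet.{u}} {p : X ⟶ Y} (hp : IsRightFibration p)
    (a : X _⦋0⦌) (e : Y _⦋1⦌) (ha : Y.δ 1 e = p.app _ a) (he : IsInv e) :
    ∃ e' : X _⦋1⦌, X.δ 1 e' = a ∧ p.app _ e' = e := by
  obtain ⟨i⟩ := he
  have := hp (n := 0) 1 (by simp)
  have := hp (n := 1) 2 (by simp)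
  obtain ⟨f, hf, hf'⟩ := exists_lift_of_hornCompat (i := (1 : Fin 2)) p
      (fun j _ ↦ a) trivial i.inv.edge (fun j hj ↦ by
        fin_cases j
        · exact i.inv.tgt_eq.trans ha
        · simp at hj)
  replace hf : X.δ 0 f = a := hf 0 (by simp)
  obtain ⟨z, hz, hz'⟩ := exists_lift_of_hornCompat (i := (2 : Fin 3)) p
      (fun j _ ↦ match j with
        | 0 => f
        | 1 => (Edge.id a).edge
        | 2 => f) (fun j k hj hk hjk ↦ by
          fin_cases j <;> fin_cases k <;> simp at hj hk hjk
          exact hf.trans (Edge.id a).tgt_eq.symm) i.homInvId.simplex (fun j hj ↦ by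
          fin_cases j
          · exact i.homInvId.d₀.trans hf'.symm
          · refine i.homInvId.d₁.trans (Eq.trans ?_ congr(($(Edge.map_id a p)).edge).symm)
            show Y.σ 0 _ = Y.σ 0 _
            rw [ha]
          · simp at hj)
  have h1 : X.δ 1 z = (Edge.id a).edge := hz 1 (by decide)
  refine ⟨X.δ 2 z, ?_, ?_⟩
  · exact (ConcreteCategory.congr_hom (X.δ_comp_δ (i := 1) (j := 1) le_rfl) z).trans
      ((congrArg (X.δ 1) h1).trans (Edge.id a).src_eq)
  · refine Eq.trans ?_ i.homInvId.d₂
    rw [← hz']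
    exact (ConcreteCategory.congr_hom (p.naturality (SimplexCategory.δ 2).op) z)

/-- The initial edge of the standard simplex of dimension `n + 1`. -/
def front (n : ℕ) : ⦋1⦌ ⟶ ⦋n + 1⦌ :=
  SimplexCategory.Hom.mk (Fin.castLEOrderEmb (show 2 ≤ n + 2 by omega)).toOrderHom

lemma front_zero : front 0 = 𝟙 _ := rfl

lemma front_comp_δ (n : ℕ) : front n ≫ SimplexCategory.δ (Fin.last _) = front (n + 1) := by
  ext i : 3
  exact Fin.succAbove_last_apply _

lemma pullback_app_ext {X Y Z : SSet.{u}} {f : X ⟶ Z} {g : Y ⟶ Z} {n : ℕ}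
    {a b : (pullback f g) _⦋n⦌}
    (h₁ : (pullback.fst f g).app _ a = (pullback.fst f g).app _ b)
    (h₂ : (pullback.snd f g).app _ a = (pullback.snd f g).app _ b) : a = b := by
  apply SSet.yonedaEquiv.symm.injective
  apply pullback.hom_ext
  · exact yonedaEquiv_symm_comp_eq _ _ _ (h₁.trans (by
      rw [SSet.yonedaEquiv_comp, Equiv.apply_symm_apply]))
  · exact yonedaEquiv_symm_comp_eq _ _ _ (h₂.trans (by
      rw [SSet.yonedaEquiv_comp, Equiv.apply_symm_apply]))

lemma exists_pullback_app {X Y Z : SSet.{u}} {f : X ⟶ Z} {g : Y ⟶ Z} {n : ℕ}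
    (x : X _⦋n⦌) (y : Y _⦋n⦌) (h : f.app _ x = g.app _ y) :
    ∃ a : (pullback f g) _⦋n⦌, (pullback.fst f g).app _ a = x ∧ (pullback.snd f g).app _ a = y := by
  refine ⟨SSet.yonedaEquiv (pullback.lift (SSet.yonedaEquiv.symm x) (SSet.yonedaEquiv.symm y)
    (yonedaEquiv_symm_comp_eq _ _ _ (h.trans (by
      rw [SSet.yonedaEquiv_comp, Equiv.apply_symm_apply])))), ?_, ?_⟩
  · rw [← SSet.yonedaEquiv_comp, pullback.lift_fst, Equiv.apply_symm_apply]
  · rw [← SSet.yonedaEquiv_comp, pullback.lift_snd, Equiv.apply_symm_apply]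

lemma app_δ {X Y : SSet.{u}} (f : X ⟶ Y) {n : ℕ} (j : Fin (n + 2)) (x : X _⦋n + 1⦌) :
    f.app _ (X.δ j x) = Y.δ j (f.app _ x) :=
  ConcreteCategory.congr_hom (f.naturality (SimplexCategory.δ j).op) x

lemma castSucc_ne_zero' {n : ℕ} {j : Fin (n + 2)} (hj : j ≠ 0) : j.castSucc ≠ 0 :=
  fun h ↦ hj (Fin.castSucc_injective _ h)

/-- All faces but the last one, as simplices of the décalage. -/
def decFaces {X : SSet.{u}} {n : ℕ} (x : ∀ j : Fin (n + 3), j ≠ 0 → X _⦋n + 1⦌)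
    (j : Fin (n + 2)) (hj : j ≠ 0) : (dec X) _⦋n⦌ :=
  x j.castSucc (castSucc_ne_zero' hj)

lemma hornCompat_decFaces {X : SSet.{u}} {n : ℕ} (x : ∀ j : Fin (n + 3), j ≠ 0 → X _⦋n + 1⦌)
    (hx : HornCompat 0 x) : HornCompat (X := dec X) 0 (decFaces x) := by
  obtain _ | n := n
  · trivial
  · intro j k hj hk hjk
    have h₁ := dec_δ X (k.pred (Fin.ne_zero_of_lt hjk)) (decFaces x j hj)
    have h₂ := dec_δ X (j.castPred (Fin.ne_last_of_lt hjk)) (decFaces x k hk)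
    have h₃ := hx j.castSucc k.castSucc (castSucc_ne_zero' hj) (castSucc_ne_zero' hk) hjk
    rw [h₁, h₂]
    exact h₃

/-- A lifting problem for Λ[n+2,0] against `p` becomes one for Λ[n+1,0] against `relDec p`: the last
face of the horn passes to the component in `X` of the simplex of the pullback. This lowers the
dimension in the induction. -/
lemma exists_lift_of_dec {X Y : SSet.{u}} (p : X ⟶ Y) {n : ℕ}
    (x : ∀ j : Fin (n + 3), j ≠ 0 → X _⦋n + 1⦌) (hx : HornCompat 0 x)
    (y : Y _⦋n + 2⦌) (hy : ∀ j hj, Y.δ j y = p.app _ (x j hj))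
    (H : HornCompat (X := dec X) 0 (decFaces x) →
      ∀ y' : (pullback (decπ Y) p) _⦋n + 1⦌,
        (∀ j hj, (pullback (decπ Y) p).δ j y' =
          (relDec p).app _ (decFaces x j hj)) →
        (pullback.snd (decπ Y) p).app _ y' = x (Fin.last _) (Fin.last_pos.ne') →
        ∃ z' : (dec X) _⦋n + 1⦌,
          (∀ j hj, (dec X).δ j z' = decFaces x j hj) ∧
            (relDec p).app _ z' = y') :
    ∃ z : X _⦋n + 2⦌, (∀ j hj, X.δ j z = x j hj) ∧ p.app _ z = y := by
  obtain ⟨y', hy₁, hy₂⟩ := exists_pullback_app (f := decπ Y) (g := p) (n := n + 1) y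
    (x (Fin.last _) (Fin.last_pos.ne')) (hy _ _)
  have h₁ (a) : (pullback.fst (decπ Y) p).app _ ((relDec p).app (op ⦋n⦌) a) = p.app _ a :=
    ConcreteCategory.congr_hom (congr_app (relDec_fst p) (op ⦋n⦌)) a
  have h₁' (a) : (pullback.fst (decπ Y) p).app _ ((relDec p).app (op ⦋n + 1⦌) a) = p.app _ a :=
    ConcreteCategory.congr_hom (congr_app (relDec_fst p) (op ⦋n + 1⦌)) a
  have h₂ (a) : (pullback.snd (decπ Y) p).app _ ((relDec p).app (op ⦋n⦌) a) =
      X.δ (Fin.last (n + 1)) a :=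
    ConcreteCategory.congr_hom (congr_app (relDec_snd p) (op ⦋n⦌)) a
  have h₂' (a) : (pullback.snd (decπ Y) p).app _ ((relDec p).app (op ⦋n + 1⦌) a) =
      X.δ (Fin.last (n + 2)) a :=
    ConcreteCategory.congr_hom (congr_app (relDec_snd p) (op ⦋n + 1⦌)) a
  obtain ⟨z', hz, hz'⟩ := H (hornCompat_decFaces x hx) y' (fun j hj ↦ by
      apply pullback_app_ext
      · rw [app_δ, hy₁, h₁]
        refine (dec_δ Y j y).trans ?_
        exact hy j.castSucc (castSucc_ne_zero' hj)
      · rw [app_δ, hy₂, h₂]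
        exact (hx j.castSucc (Fin.last _) (castSucc_ne_zero' hj) (Fin.last_pos.ne')
          (Fin.castSucc_lt_last j)).symm) hy₂
  refine ⟨z', fun j hj ↦ ?_, ?_⟩
  · induction j using Fin.lastCases with
    | last => exact (h₂' z').symm.trans ((congrArg _ hz').trans hy₂)
    | cast j => exact (dec_δ X j z').symm.trans (hz j (fun h ↦ hj (by rw [h]; rfl)))
  · exact (h₁' z').symm.trans ((congrArg _ hz').trans hy₁)

/-- Joyal's lifting theorem for special outer horns. -/
theorem exists_lift_of_special_horn {X Y : SSet.{u}} (p : X ⟶ Y) [Quasicategory Y]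
    [InnerFibration p] {n : ℕ} (x : ∀ j : Fin (n + 3), j ≠ 0 → X _⦋n + 1⦌)
    (hx : HornCompat 0 x)
    (hx' : IsInv (X.map (front n).op (x (Fin.last _) (Fin.last_pos.ne'))))
    (y : Y _⦋n + 2⦌) (hy : ∀ j hj, Y.δ j y = p.app _ (x j hj)) :
    ∃ z : X _⦋n + 2⦌, (∀ j hj, X.δ j z = x j hj) ∧ p.app _ z = y := by
  induction n generalizing X Y with
  | zero =>
    have := quasicategory_of_innerFibration p
    refine exists_lift_of_dec p x hx y hy (fun _ y' hy' hy'' ↦ ?_)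
    have h : IsRightFibration (pullback.snd (decπ Y) p) :=
      (isRightFibration_decπ Y).of_isPullback (IsPullback.of_hasPullback _ _)
    have hX : IsRightFibration (relDec p) := isRightFibration_relDec p
    -- A lifting problem for Λ[1,0] against a right fibration is the lifting of an edge with given
    -- source. That edge is invertible because its projection to `X` is the special edge of the
    -- horn, and this projection is conservative.
    obtain ⟨z, hz, hz'⟩ := hX.exists_lift_edge (x 1 (by simp)) y' (hy' 1 (by simp))
      (h.isInv_of_map (by
        rw [hy'']
        rw [front_zero, op_id, X.map_id] at hx'
        exact hx'))
    refine ⟨z, fun j hj ↦ ?_, hz'⟩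
    obtain rfl : j = 1 := by fin_cases j <;> simp at hj ⊢
    exact hz
  | succ n hn =>
    have := quasicategory_of_innerFibration p
    refine exists_lift_of_dec p x hx y hy (fun hg y' hy' hy'' ↦ ?_)
    have h : IsRightFibration (pullback.snd (decπ Y) p) :=
      (isRightFibration_decπ Y).of_isPullback (IsPullback.of_hasPullback _ _)
    have := h.innerFibration
    have := quasicategory_of_innerFibration (pullback.snd (decπ Y) p)
    have := (isRightFibration_relDec p).innerFibration
    -- The special edge of the new horn projects under `decπ X` to the old one, so it is invertible
    -- by conservativity of right fibrations.
    refine hn (relDec p) _ hg ((isRightFibration_decπ X).isInv_of_map ?_) y' hy'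
    have h₁ := ConcreteCategory.congr_hom ((decπ X).naturality (front n).op)
      (x (Fin.last (n + 2)).castSucc (castSucc_ne_zero' Fin.last_pos.ne'))
    have h₂ : X.δ (Fin.last (n + 2)) (x (Fin.last (n + 2)).castSucc
          (castSucc_ne_zero' Fin.last_pos.ne')) =
        X.δ (Fin.last (n + 2)) (x (Fin.last _) Fin.last_pos.ne') :=
      (hx (Fin.last (n + 2)).castSucc (Fin.last _) (castSucc_ne_zero' Fin.last_pos.ne')
        Fin.last_pos.ne' (Fin.castSucc_lt_last _))
    have h₃ : (decπ X).app _ ((dec X).map (front n).op (x (Fin.last (n + 2)).castSucc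
          (castSucc_ne_zero' Fin.last_pos.ne'))) =
        X.map (front (n + 1)).op (x (Fin.last _) Fin.last_pos.ne') := by
      refine h₁.trans ?_
      refine (congrArg (X.map (front n).op) h₂).trans ?_
      rw [← front_comp_δ, op_comp, X.map_comp]
      rfl
    exact h₃ ▸ hx'

end Decalage
end InftyCat

namespace InftyCat

open SSet Opposite

/-! ### Extending natural equivalences along monomorphisms -/

section Prism

lemma exists_filler_of_special_horn {Y : SSet.{u}} [Quasicategory Y] {n : ℕ}
    (g : (Λ[n + 2, 0] : SSet) ⟶ Y)
    (hg : IsInv (Y.map (front n).op (g.app _ (horn.face 0 (Fin.last _) Fin.last_pos.ne')))) :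
    ∃ l : Δ[n + 2] ⟶ Y, Λ[n + 2, 0].ι ≫ l = g := by
  have : Quasicategory (⊤_ SSet.{u}) := by
    rw [quasicategory_iff_hasLiftingProperty.{u} _ terminalIsTerminal]
    intro _ _ _ _
    have : terminalIsTerminal.from (⊤_ SSet.{u}) = 𝟙 _ := Subsingleton.elim _ _
    rw [this]
    infer_instance
  obtain ⟨z, hz, -⟩ := exists_lift_of_special_horn (terminal.from Y)
    (fun j hj ↦ g.app _ (horn.face 0 j hj)) (HornCompat.of_hom g) hg
    (SSet.yonedaEquiv (terminal.from _)) (fun j hj ↦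
      SSet.yonedaEquiv.symm.injective (Subsingleton.elim _ _))
  refine ⟨SSet.yonedaEquiv.symm z, ?_⟩
  apply horn.hom_ext
  intro j hj
  exact hz j hj

lemma exists_extend {Z Y : SSet.{u}} (S : Z.Subcomplex) {m : ℕ} (σ : Δ[m] ⟶ Z) [Mono σ]
    (g : (S : SSet) ⟶ Y) (l : Δ[m] ⟶ Y)
    (hl : S.fromPreimage σ ≫ g = (S.preimage σ).ι ≫ l) (T : Z.Subcomplex)
    (hT : S ⊔ Subcomplex.range σ = T) :
    ∃ g' : (T : SSet) ⟶ Y, ∀ (d : SimplexCategoryᵒᵖ) (x : S.obj d) (h : x.1 ∈ T.obj d),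
      g'.app d ⟨x.1, h⟩ = g.app d x := by
  subst hT
  have sq : Subcomplex.BicartSq (S ⊓ Subcomplex.range σ) S (Subcomplex.range σ)
    (S ⊔ Subcomplex.range σ) := ⟨rfl, rfl⟩
  have w : Subcomplex.homOfLE sq.le₁₂ ≫ g =
      Subcomplex.homOfLE sq.le₁₃ ≫ inv (Subcomplex.toRange σ) ≫ l := by
    ext d ⟨x, hx, ⟨a, rfl⟩⟩
    have h₁ := ConcreteCategory.congr_hom (congr_app hl d) ⟨a, hx⟩
    have h₂ := ConcreteCategory.congr_hom
      (congr_app (IsIso.hom_inv_id (Subcomplex.toRange σ)) d) a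
    refine h₁.trans (congrArg (l.app d) h₂.symm)
  refine ⟨sq.isPushout.desc g _ w, fun d x h ↦ ?_⟩
  exact ConcreteCategory.congr_hom (congr_app (sq.isPushout.inl_desc g _ w) d) x

variable (n : ℕ)

/-- The filtration of the prism `Δ[n] ⊗ Δ[1]`, starting from
`∂Δ[n] ⊗ Δ[1] ∪ Δ[n] ⊗ {0}` for `t = n + 1` and finishing with everything for `t = 0`. -/
def prismFiltration (t : ℕ) : (Δ[n] ⊗ Δ[1] : SSet.{u}).Subcomplex where
  obj d := Set.ofPred fun x ↦
    (∃ v, ∀ i, stdSimplex.asOrderHom x.1 i ≠ v) ∨ (∀ i, stdSimplex.asOrderHom x.2 i = 0) ∨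
      ∃ q : Fin (n + 1), t ≤ q ∧ ∀ i,
        (stdSimplex.asOrderHom x.2 i = 0 → stdSimplex.asOrderHom x.1 i ≤ q) ∧
        (stdSimplex.asOrderHom x.2 i = 1 → q ≤ stdSimplex.asOrderHom x.1 i)
  map {d d'} f := by
    rintro x (⟨v, hv⟩ | h | ⟨q, hq, h⟩)
    · exact Or.inl ⟨v, fun i ↦ hv (f.unop.toOrderHom i)⟩
    · exact Or.inr (Or.inl (fun i ↦ h (f.unop.toOrderHom i)))
    · exact Or.inr (Or.inr ⟨q, hq, fun i ↦ h (f.unop.toOrderHom i)⟩)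

variable {n}

/-- The nondegenerate simplices of maximal dimension of the prism. -/
noncomputable def prismσ (t : Fin (n + 1)) : Δ[n + 1] ⟶ (Δ[n] ⊗ Δ[1] : SSet.{u}) :=
  CartesianMonoidalCategory.lift (stdSimplex.σ t)
    (SSet.yonedaEquiv.symm (stdSimplex.objMk₁ t.succ.castSucc))

lemma prismσ_fst (t : Fin (n + 1)) {d : SimplexCategoryᵒᵖ} (x : (Δ[n + 1] : SSet.{u}).obj d) (i) :
    stdSimplex.asOrderHom ((prismσ t).app d x).1 i = t.predAbove (stdSimplex.asOrderHom x i) := rfl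

lemma prismσ_snd (t : Fin (n + 1)) {d : SimplexCategoryᵒᵖ} (x : (Δ[n + 1] : SSet.{u}).obj d) (i) :
    stdSimplex.asOrderHom ((prismσ t).app d x).2 i =
      if (stdSimplex.asOrderHom x i).castSucc < t.succ.castSucc then 0 else 1 := rfl

lemma asOrderHom_ext {m : ℕ} {d : SimplexCategoryᵒᵖ} {x y : (Δ[m] : SSet.{u}).obj d}
    (h : ∀ i, stdSimplex.asOrderHom x i = stdSimplex.asOrderHom y i) : x = y := by
  apply stdSimplex.objEquiv.injective
  ext i : 3
  exact h i

lemma exists_asOrderHom {m : ℕ} {d : SimplexCategoryᵒᵖ}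
    (f : Fin (d.unop.len + 1) → Fin (m + 1)) (hf : Monotone f) :
    ∃ x : (Δ[m] : SSet.{u}).obj d, ∀ i, stdSimplex.asOrderHom x i = f i :=
  ⟨stdSimplex.objMk ⟨f, hf⟩, fun _ ↦ rfl⟩

/-- The vertices of this simplex are, in order, (0,0), …, (t,0), (t,1), …, (n,1). In this form the
combinatorics of the prism is linear arithmetic. -/
lemma prismσ_val (t : Fin (n + 1)) {d : SimplexCategoryᵒᵖ} (x : (Δ[n + 1] : SSet.{u}).obj d) (i) :
    ((stdSimplex.asOrderHom x i : ℕ) ≤ t ∧ stdSimplex.asOrderHom ((prismσ t).app d x).2 i = 0 ∧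
      (stdSimplex.asOrderHom ((prismσ t).app d x).1 i : ℕ) = stdSimplex.asOrderHom x i) ∨
    ((t : ℕ) + 1 ≤ stdSimplex.asOrderHom x i ∧
      stdSimplex.asOrderHom ((prismσ t).app d x).2 i = 1 ∧
      (stdSimplex.asOrderHom ((prismσ t).app d x).1 i : ℕ) + 1 = stdSimplex.asOrderHom x i) := by
  rw [prismσ_fst, prismσ_snd]
  generalize stdSimplex.asOrderHom x i = y
  by_cases h : (y : ℕ) ≤ t
  · refine Or.inl ⟨h, if_pos ?_, ?_⟩
    · simp [Fin.lt_def]; omega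
    · rw [Fin.predAbove_of_le_castSucc _ _ (by simpa [Fin.le_def] using h)]
      simp
  · refine Or.inr ⟨by omega, if_neg ?_, ?_⟩
    · simp [Fin.lt_def]; omega
    · rw [Fin.predAbove_of_castSucc_lt _ _ (by simp [Fin.lt_def]; omega)]
      simp; omega

instance (t : Fin (n + 1)) : Mono (prismσ.{u} t) := by
  have h (d : SimplexCategoryᵒᵖ) : Mono ((prismσ.{u} t).app d) := by
    rw [mono_iff_injective]
    intro x y h
    apply asOrderHom_ext
    intro i
    have h₁ := prismσ_val t x i
    have h₂ := prismσ_val t y i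
    rw [h] at h₁
    ext
    rcases h₁ with h₁ | h₁ <;> rcases h₂ with h₂ | h₂
    · omega
    · have := h₁.2.1.symm.trans h₂.2.1; simp at this
    · have := h₁.2.1.symm.trans h₂.2.1; simp at this
    · omega
  exact NatTrans.mono_of_mono_app _

lemma prismFiltration_sup_range (t : Fin (n + 1)) :
    prismFiltration.{u} n (t + 1) ⊔ Subcomplex.range (prismσ t) = prismFiltration n t := by
  ext d x
  constructor
  · rintro ((h | h | ⟨q, hq, h⟩) | ⟨a, rfl⟩)
    · exact Or.inl h
    · exact Or.inr (Or.inl h)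
    · exact Or.inr (Or.inr ⟨q, by omega, h⟩)
    · refine Or.inr (Or.inr ⟨t, le_rfl, fun i ↦ ?_⟩)
      rcases prismσ_val t a i with h | h
      · exact ⟨fun _ ↦ by rw [Fin.le_def]; omega, fun h' ↦ by
          have := h'.symm.trans h.2.1; simp at this⟩
      · exact ⟨fun h' ↦ by have := h'.symm.trans h.2.1; simp at this,
          fun _ ↦ by rw [Fin.le_def]; omega⟩
  · rintro (h | h | ⟨q, hq, h⟩)
    · exact Or.inl (Or.inl h)
    · exact Or.inl (Or.inr (Or.inl h))
    · by_cases hq' : (t : ℕ) + 1 ≤ q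
      · exact Or.inl (Or.inr (Or.inr ⟨q, hq', h⟩))
      · obtain rfl : q = t := by ext; omega
        refine Or.inr ?_
        obtain ⟨a, ha⟩ := exists_asOrderHom.{u} (d := d) (m := n + 1)
          (fun i ↦ if stdSimplex.asOrderHom x.2 i = 0 then
              (stdSimplex.asOrderHom x.1 i).castSucc else (stdSimplex.asOrderHom x.1 i).succ)
            (fun i j hij ↦ by
              have h₁ := (stdSimplex.asOrderHom x.1).monotone hij
              have h₂ := (stdSimplex.asOrderHom x.2).monotone hij
              dsimp only
              rw [Fin.le_def] at h₁ ⊢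
              split_ifs with h₃ h₄ h₄
              · simpa
              · simp; omega
              · rw [h₄] at h₂; exact absurd (Fin.le_zero_iff.1 h₂) h₃
              · simpa)
        refine ⟨a, ?_⟩
        have key (i) :
            stdSimplex.asOrderHom ((prismσ q).app d a).1 i = stdSimplex.asOrderHom x.1 i ∧
            stdSimplex.asOrderHom ((prismσ q).app d a).2 i = stdSimplex.asOrderHom x.2 i := by
          have h₁ := prismσ_val q a i
          rw [ha] at h₁
          by_cases h₂ : stdSimplex.asOrderHom x.2 i = 0
          · have h₃ := (h i).1 h₂
            rw [if_pos h₂, Fin.le_def] at *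
            simp only [Fin.val_castSucc] at h₁
            rw [h₂]
            refine ⟨Fin.ext ?_, ?_⟩
            · omega
            · rcases h₁ with h₁ | h₁
              · exact h₁.2.1
              · omega
          · have h₂' : stdSimplex.asOrderHom x.2 i = 1 := Fin.eq_one_of_ne_zero _ h₂
            have h₃ := (h i).2 h₂'
            rw [if_neg h₂, Fin.le_def] at *
            simp only [Fin.val_succ] at h₁
            rw [h₂']
            refine ⟨Fin.ext ?_, ?_⟩
            · omega
            · rcases h₁ with h₁ | h₁
              · omega
              · exact h₁.2.1
        exact Prod.ext (asOrderHom_ext fun i ↦ (key i).1) (asOrderHom_ext fun i ↦ (key i).2)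

/-- Removing the vertex (t,1) gives a face of the next simplex, or of the bottom if t = n. Removing
any vertex other than (t,0) and (t,1) gives a face above ∂Δ[n]. The only new face is the one
opposite to (t,0). -/
lemma prismFiltration_preimage (t : Fin (n + 1)) :
    (prismFiltration.{u} n (t + 1)).preimage (prismσ t) = Λ[n + 1, t.castSucc] := by
  ext d x
  rw [mem_horn_iff, Set.ne_univ_iff_exists_notMem]
  constructor
  · rintro (⟨v, hv⟩ | h | ⟨q, hq, h⟩)
    · refine ⟨t.castSucc.succAbove v, ?_⟩
      rintro (⟨i, hi⟩ | h)
      · refine hv i ?_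
        have := prismσ_val t x i
        ext
        rw [hi] at this
        rcases lt_or_ge v.castSucc t.castSucc with h | h
        · rw [Fin.succAbove_of_castSucc_lt _ _ h] at this
          replace h : (v : ℕ) < t := h
          rw [Fin.val_castSucc] at this
          omega
        · rw [Fin.succAbove_of_le_castSucc _ _ h] at this
          replace h : (t : ℕ) ≤ v := h
          rw [Fin.val_succ] at this
          omega
      · exact Fin.succAbove_ne _ _ h
    · refine ⟨t.succ, ?_⟩
      rintro (⟨i, hi⟩ | h')
      · have := prismσ_val t x i
        rw [hi] at this
        rcases this with h₁ | h₁
        · simp at h₁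
        · have := h₁.2.1.symm.trans (h i); simp at this
      · exact (Fin.castSucc_lt_succ (i := t)).ne h'.symm
    · refine ⟨t.succ, ?_⟩
      rintro (⟨i, hi⟩ | h')
      · have := prismσ_val t x i
        rw [hi] at this
        rcases this with h₁ | h₁
        · simp at h₁
        · have := (h i).2 h₁.2.1
          rw [Fin.le_def] at this
          simp at h₁
          omega
      · exact (Fin.castSucc_lt_succ (i := t)).ne h'.symm
  · rintro ⟨j, hj⟩
    have hj₁ : j ≠ t.castSucc := fun h ↦ hj (Or.inr h)
    have hj₂ : ∀ i, stdSimplex.asOrderHom x i ≠ j := fun i h ↦ hj (Or.inl ⟨i, h⟩)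
    have hj₁' : (j : ℕ) ≠ t := fun h ↦ hj₁ (Fin.ext h)
    have hj₂' : ∀ i, (stdSimplex.asOrderHom x i : ℕ) ≠ j := fun i h ↦ hj₂ i (Fin.ext h)
    by_cases h₁ : (j : ℕ) = t + 1
    · by_cases h₂ : (t : ℕ) = n
      · refine Or.inr (Or.inl fun i ↦ ?_)
        have := hj₂' i
        rcases prismσ_val t x i with h₃ | h₃
        · exact h₃.2.1
        · exfalso
          have := (stdSimplex.asOrderHom x i).isLt
          omega
      · refine Or.inr (Or.inr ⟨⟨t + 1, by omega⟩, le_rfl, fun i ↦ ?_⟩)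
        have := hj₂' i
        simp only [Fin.le_def]
        rcases prismσ_val t x i with h₃ | h₃
        · exact ⟨fun _ ↦ by omega, fun h' ↦ by
            have := h'.symm.trans h₃.2.1; simp at this⟩
        · exact ⟨fun h' ↦ by have := h'.symm.trans h₃.2.1; simp at this, fun _ ↦ by omega⟩
    · refine Or.inl ⟨t.predAbove j, fun i h ↦ ?_⟩
      have h₃ := hj₂' i
      have h₄ := prismσ_val t x i
      rw [h] at h₄
      rcases le_or_gt j t.castSucc with h₅ | h₅
      · rw [Fin.predAbove_of_le_castSucc _ _ h₅] at h₄
        replace h₅ : (j : ℕ) ≤ t := h₅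
        rw [Fin.coe_castPred] at h₄
        omega
      · rw [Fin.predAbove_of_castSucc_lt _ _ h₅] at h₄
        replace h₅ : (t : ℕ) < j := h₅
        rw [Fin.val_pred] at h₄
        omega

lemma prismFiltration_zero : prismFiltration.{u} n 0 = ⊤ := by
  ext d x
  simp only [Subfunctor.top_obj, Set.top_eq_univ, Set.mem_univ, iff_true]
  by_cases h : ∀ i, stdSimplex.asOrderHom x.2 i = 0
  · exact Or.inr (Or.inl h)
  · push Not at h
    -- The simplex lies in the cell numbered by the first coordinate of its first vertex on the
    -- upper level.
    let S : Finset (Fin (d.unop.len + 1)) := Finset.univ.filter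
      (fun i ↦ stdSimplex.asOrderHom x.2 i ≠ 0)
    have hS : S.Nonempty := by
      obtain ⟨i, hi⟩ := h
      exact ⟨i, by simpa [S] using hi⟩
    have h₁ := S.min'_mem hS
    simp only [S, Finset.mem_filter, Finset.mem_univ, true_and] at h₁
    refine Or.inr (Or.inr ⟨stdSimplex.asOrderHom x.1 (S.min' hS), Nat.zero_le _, fun i ↦ ⟨?_, ?_⟩⟩)
    · intro hi
      apply (stdSimplex.asOrderHom x.1).monotone
      by_contra! h'
      have := (stdSimplex.asOrderHom x.2).monotone h'.le
      rw [hi] at this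
      exact h₁ (Fin.le_zero_iff.1 this)
    · intro hi
      apply (stdSimplex.asOrderHom x.1).monotone
      exact S.min'_le _ (by simp [S, hi])

/-- The edge of `K ⊗ Δ[1]` given by a vertex of `K`. -/
def vEdge {K : SSet.{u}} (x : K _⦋0⦌) : (K ⊗ Δ[1] : SSet.{u}) _⦋1⦌ :=
  (K.σ 0 x, stdSimplex.objEquiv.symm (𝟙 _))

/-- A natural transformation is pointwise invertible if it gives equivalences at all vertices. -/
def PtInv {K Y : SSet.{u}} (h : K ⊗ Δ[1] ⟶ Y) : Prop :=
  ∀ x : K _⦋0⦌, IsInv (h.app _ (vEdge x))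

lemma app_σ {X Y : SSet.{u}} (f : X ⟶ Y) {n : ℕ} (j : Fin (n + 1)) (x : X _⦋n⦌) :
    f.app _ (X.σ j x) = Y.σ j (f.app _ x) :=
  ConcreteCategory.congr_hom (f.naturality (SimplexCategory.σ j).op) x

/-- The subcomplex `{0}` of `Δ[1]`. -/
def zeroSubcomplex : (Δ[1] : SSet.{u}).Subcomplex where
  obj _ := Set.ofPred fun x ↦ ∀ i, stdSimplex.asOrderHom x i = 0
  map {_ _} f _ hx i := hx (f.unop.toOrderHom i)

lemma prismFiltration_last :
    prismFiltration.{u} n (n + 1) = (∂Δ[n]).unionProd zeroSubcomplex := by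
  ext d x
  refine Iff.trans ?_ (Subcomplex.mem_unionProd_iff _ _ x).symm
  constructor
  · rintro (⟨v, hv⟩ | h | ⟨q, hq, h⟩)
    · refine Or.inr ?_
      intro h
      obtain ⟨i, hi⟩ := h v
      exact hv i hi
    · exact Or.inl h
    · omega
  · rintro (h | h)
    · exact Or.inr (Or.inl h)
    · refine Or.inl ?_
      by_contra! h'
      exact h h'

variable {Y : SSet.{u}}

/-- A map on a stage of the filtration of the prism extends given maps on `Δ[n] ⊗ {0}` and
`∂Δ[n] ⊗ Δ[1]`. -/
structure PrismExtends (u : Δ[n] ⟶ Y) (h : (∂Δ[n] : SSet) ⊗ Δ[1] ⟶ Y) {t : ℕ}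
    (g : (prismFiltration.{u} n t : SSet) ⟶ Y) : Prop where
  zero (d : SimplexCategoryᵒᵖ) (x : (Δ[n] : SSet.{u}).obj d) (z : (Δ[1] : SSet.{u}).obj d)
    (hz : z ∈ zeroSubcomplex.obj d) (hx : (x, z) ∈ (prismFiltration n t).obj d) :
    g.app d ⟨(x, z), hx⟩ = u.app d x
  boundary (d : SimplexCategoryᵒᵖ) (x : ∂Δ[n].obj d) (z : (Δ[1] : SSet.{u}).obj d)
    (hx : (x.1, z) ∈ (prismFiltration n t).obj d) :
    g.app d ⟨(x.1, z), hx⟩ = h.app d (x, z)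

lemma exists_prismExtends_last (u : Δ[n] ⟶ Y) (h : (∂Δ[n] : SSet) ⊗ Δ[1] ⟶ Y)
    (w : ι₀ ≫ h = ∂Δ[n].ι ≫ u) :
    ∃ g : (prismFiltration.{u} n (n + 1) : SSet) ⟶ Y, PrismExtends u h g := by
  have w' : ∂Δ[n].ι ▷ (zeroSubcomplex : SSet) ≫ CartesianMonoidalCategory.fst _ _ ≫ u =
      (∂Δ[n] : SSet) ◁ zeroSubcomplex.ι ≫ h := by
    ext d ⟨x, z⟩
    have h₁ := ConcreteCategory.congr_hom (congr_app w d) x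
    refine h₁.symm.trans (congrArg (h.app d) (Prod.ext rfl ?_))
    exact asOrderHom_ext fun i ↦ (z.2 i).symm
  let g := (Subcomplex.unionProd.isPushout ∂Δ[n] zeroSubcomplex).desc _ _ w'
  refine ⟨Subcomplex.homOfLE prismFiltration_last.le ≫ g, ⟨fun d x z hz hx ↦ ?_, fun d x z hx ↦ ?_⟩⟩
  · let a : (Δ[n] ⊗ (zeroSubcomplex : SSet.{u}) : SSet.{u}).obj d := ⟨x, ⟨z, hz⟩⟩
    exact ConcreteCategory.congr_hom (congr_app
      ((Subcomplex.unionProd.isPushout ∂Δ[n] zeroSubcomplex).inl_desc _ _ w') d) a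
  · let a : ((∂Δ[n] : SSet.{u}) ⊗ Δ[1] : SSet.{u}).obj d := ⟨x, z⟩
    exact ConcreteCategory.congr_hom (congr_app
      ((Subcomplex.unionProd.isPushout ∂Δ[n] zeroSubcomplex).inr_desc _ _ w') d) a

lemma exists_filler_of_eq_horn [Quasicategory Y] {A : (Δ[n + 1] : SSet.{u}).Subcomplex}
    {i : Fin (n + 2)} (hA : A = Λ[n + 1, i]) (h0 : 0 < i) (hi : i < Fin.last _)
    (f : (A : SSet) ⟶ Y) : ∃ l : Δ[n + 1] ⟶ Y, f = A.ι ≫ l := by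
  subst hA
  exact Quasicategory.hornFilling h0 hi f

lemma exists_filler_of_eq_special_horn [Quasicategory Y]
    {A : (Δ[n + 2] : SSet.{u}).Subcomplex} (hA : A = Λ[n + 2, 0]) (f : (A : SSet) ⟶ Y)
    (hf : ∀ a : A.obj (op ⦋1⦌), a.1 = stdSimplex.objEquiv.symm (front (n + 1)) →
      IsInv (f.app _ a)) :
    ∃ l : Δ[n + 2] ⟶ Y, f = A.ι ≫ l := by
  subst hA
  obtain ⟨l, hl⟩ := exists_filler_of_special_horn f (by
    have := ConcreteCategory.congr_hom (f.naturality (front n).op)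
      (horn.face (0 : Fin (n + 3)) (Fin.last _) Fin.last_pos.ne')
    refine this ▸ hf _ ?_
    exact congrArg stdSimplex.objEquiv.symm (front_comp_δ n))
  exact ⟨l, hl.symm⟩

lemma mem_boundary_of_vertex {n : ℕ} (x : (Δ[n + 1] : SSet.{u}) _⦋0⦌) :
    x ∈ ∂Δ[n + 1].obj (op ⦋0⦌) := by
  have := boundary_obj_eq_univ.{u} 0 (n + 1)
  exact this ▸ Set.mem_univ x

/-- The maximal simplices are attached in decreasing order of t, each along Λ[n+2, t]. These horns
are inner for t > 0. The last one, for t = 0, is a special outer horn: its initial edge is the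
vertical edge above the vertex 0, on which h is invertible. The base has positive dimension, so that
this vertex lies in the boundary. -/
lemma exists_prismExtends [Quasicategory Y] {n : ℕ} (u : Δ[n + 1] ⟶ Y)
    (h : (∂Δ[n + 1] : SSet) ⊗ Δ[1] ⟶ Y) (w : ι₀ ≫ h = ∂Δ[n + 1].ι ≫ u) (hh : PtInv h) (s : ℕ)
    (hs : s ≤ n + 2) :
    ∃ g : (prismFiltration.{u} (n + 1) (n + 2 - s) : SSet) ⟶ Y, PrismExtends u h g := by
  induction s with
  | zero => exact exists_prismExtends_last u h w
  | succ s hs' =>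
    obtain ⟨t, ht⟩ : ∃ t : Fin (n + 2), (t : ℕ) = n + 2 - (s + 1) := ⟨⟨_, by omega⟩, rfl⟩
    replace hs' := hs' (by omega)
    rw [show n + 2 - s = t + 1 by omega] at hs'
    obtain ⟨g, hg⟩ := hs'
    rw [← ht]
    obtain ⟨l, hl⟩ : ∃ l : Δ[n + 2] ⟶ Y,
        (prismFiltration.{u} (n + 1) (t + 1)).fromPreimage (prismσ t) ≫ g =
          ((prismFiltration.{u} (n + 1) (t + 1)).preimage (prismσ t)).ι ≫ l := by
      obtain rfl | h0 := eq_or_ne t 0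
      · refine exists_filler_of_eq_special_horn (prismFiltration_preimage 0) _ ?_
        rintro ⟨a, ha⟩ ha'
        let v : (∂Δ[n + 1] : SSet.{u}) _⦋0⦌ :=
          ⟨stdSimplex.obj₀Equiv.symm 0, mem_boundary_of_vertex _⟩
        have hv : (prismσ 0).app _ a = (((∂Δ[n + 1] : SSet.{u}).σ 0 v).1,
            stdSimplex.objEquiv.symm (𝟙 _)) := by
          dsimp only at ha'
          subst ha'
          refine Prod.ext (asOrderHom_ext fun i ↦ ?_) (asOrderHom_ext fun i ↦ ?_)
          · match i with
            | 0 => rfl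
            | 1 => rfl
          · match i with
            | 0 => rfl
            | 1 => rfl
        have hv' := hg.boundary _ ((∂Δ[n + 1] : SSet.{u}).σ 0 v) (stdSimplex.objEquiv.symm (𝟙 _))
          (by rw [← hv]; exact ha)
        have hv'' : (Subcomplex.fromPreimage _ (prismσ 0) ≫ g).app _ ⟨a, ha⟩ =
            h.app _ (vEdge v) :=
          (congrArg (g.app _) (Subtype.ext hv)).trans hv'
        exact hv'' ▸ hh v
      · exact exists_filler_of_eq_horn (prismFiltration_preimage t) (by
          simpa [Fin.pos_iff_ne_zero] using h0) (Fin.castSucc_lt_last t) _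
    obtain ⟨g', hg'⟩ := exists_extend _ (prismσ t) g l hl _ (prismFiltration_sup_range t)
    have hle : prismFiltration.{u} (n + 1) (t + 1) ≤ prismFiltration (n + 1) t := by
      rw [← prismFiltration_sup_range t]
      exact le_sup_left
    have hle' : (∂Δ[n + 1]).unionProd zeroSubcomplex ≤ prismFiltration.{u} (n + 1) (t + 1) := by
      rw [← prismFiltration_last]
      rintro d x (h | h | ⟨q, hq, h⟩)
      · exact Or.inl h
      · exact Or.inr (Or.inl h)
      · exact Or.inr (Or.inr ⟨q, by omega, h⟩)
    refine ⟨g', ⟨fun d x z hz hx ↦ ?_, fun d x z hx ↦ ?_⟩⟩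
    · refine (hg' d ⟨(x, z), hle' _ ?_⟩ hx).trans (hg.zero d x z hz _)
      exact Or.inl ⟨Set.mem_univ _, hz⟩
    · refine (hg' d ⟨(x.1, z), hle' _ ?_⟩ hx).trans (hg.boundary d x z _)
      exact Or.inr ⟨x.2, Set.mem_univ _⟩

lemma exists_extension_boundary [Quasicategory Y] {n : ℕ} (u : Δ[n] ⟶ Y)
    (h : (∂Δ[n] : SSet) ⊗ Δ[1] ⟶ Y) (w : ι₀ ≫ h = ∂Δ[n].ι ≫ u) (hh : PtInv h) :
    ∃ H : Δ[n] ⊗ Δ[1] ⟶ Y, PtInv H ∧ ι₀ ≫ H = u ∧ ∂Δ[n].ι ▷ _ ≫ H = h := by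
  obtain _ | n := n
  · refine ⟨CartesianMonoidalCategory.fst _ _ ≫ u, fun x ↦ ?_, rfl, ?_⟩
    · exact (isEquivalence_id (u.app _ x)).ofEq (app_σ u 0 x).symm
    · ext d ⟨x, y⟩
      have := x.2
      simp at this
  · obtain ⟨g, hg⟩ := exists_prismExtends u h w hh (n + 2) le_rfl
    have hle : ⊤ ≤ prismFiltration.{u} (n + 1) (n + 2 - (n + 2)) := by
      rw [Nat.sub_self, prismFiltration_zero]
    refine ⟨(Subcomplex.topIso _).inv ≫ Subcomplex.homOfLE hle ≫ g, fun x ↦ ?_, ?_, ?_⟩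
    · exact (hg.boundary _ ⟨_, _⟩ _ _).symm ▸ hh ⟨x, mem_boundary_of_vertex x⟩
    · ext d x
      refine hg.zero d x (ι₀.app d x).2 (fun _ ↦ rfl) _
    · ext d ⟨x, z⟩
      exact hg.boundary d x z _

end Prism

end InftyCat

namespace InftyCat

open SSet Opposite

/-! ### Extension of pointwise invertible transformations along all monomorphisms. -/

section Extension

/-- A simplex of a product. -/
abbrev prodMk {K L : SSet.{u}} {d : SimplexCategoryᵒᵖ} (x : K.obj d) (z : L.obj d) :
    (K ⊗ L : SSet.{u}).obj d := (x, z)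

lemma app_congr {K L : SSet.{u}} {f g : K ⟶ L} (h : f = g) (d : SimplexCategoryᵒᵖ) (x : K.obj d) :
    f.app d x = g.app d x := by rw [h]

lemma app_map {K L : SSet.{u}} (f : K ⟶ L) {d d' : SimplexCategoryᵒᵖ} (g : d ⟶ d')
    (x : K.obj d) : f.app d' (K.map g x) = L.map g (f.app d x) :=
  ConcreteCategory.congr_hom (f.naturality g) x

/-- A natural family of maps `Δ[n] ⊗ Δ[1] ⟶ Y` indexed by the simplices of `K` gives a map
`K ⊗ Δ[1] ⟶ Y`. -/
def uncurryFamily {K Y : SSet.{u}}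
    (F : ∀ (n : SimplexCategory) (_ : K.obj (op n)), (stdSimplex.obj n ⊗ Δ[1] ⟶ Y))
    (hF : ∀ ⦃n m : SimplexCategory⦄ (f : n ⟶ m) (x : K.obj (op m)),
      F n (K.map f.op x) = SSet.stdSimplex.map f ▷ Δ[1] ≫ F m x) : K ⊗ Δ[1] ⟶ Y where
  app d := ↾fun x ↦ (F d.unop x.1).app d (stdSimplex.objEquiv.symm (𝟙 _), x.2)
  naturality d d' f := by
    ext ⟨x, z⟩
    have h₁ := app_congr (hF f.unop x) d'
      (prodMk (stdSimplex.objEquiv.symm (𝟙 _)) ((Δ[1] : SSet.{u}).map f z))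
    have h₂ := app_map (F d.unop x) f
      (prodMk (stdSimplex.objEquiv.symm (𝟙 _)) z)
    refine h₁.trans (Eq.trans ?_ h₂)
    refine congrArg ((F d.unop x).app d') (Prod.ext ?_ rfl)
    show stdSimplex.objEquiv.symm (𝟙 _ ≫ f.unop) = stdSimplex.objEquiv.symm (f.unop ≫ 𝟙 _)
    rw [Category.id_comp, Category.comp_id]

lemma yonedaEquiv_symm_whiskerRight_app {K Y : SSet.{u}} (H : K ⊗ Δ[1] ⟶ Y)
    {d : SimplexCategoryᵒᵖ} (x : K.obj d) (z : (Δ[1] : SSet.{u}).obj d) :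
    ((SSet.yonedaEquiv (n := d.unop)).symm x ▷ Δ[1] ≫ H).app d
      (stdSimplex.objEquiv.symm (𝟙 _), z) = H.app d (x, z) := by
  refine congrArg (H.app d) (Prod.ext ?_ rfl)
  exact ConcreteCategory.congr_hom (K.map_id d) x

lemma whiskerRight_uncurryFamily {K Y : SSet.{u}}
    (F : ∀ (n : SimplexCategory) (_ : K.obj (op n)), (stdSimplex.obj n ⊗ Δ[1] ⟶ Y))
    (hF : ∀ ⦃n m : SimplexCategory⦄ (f : n ⟶ m) (x : K.obj (op m)),
      F n (K.map f.op x) = SSet.stdSimplex.map f ▷ Δ[1] ≫ F m x)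
    {n : SimplexCategory} (x : K.obj (op n)) :
    SSet.yonedaEquiv.symm x ▷ Δ[1] ≫ uncurryFamily F hF = F n x := by
  ext d ⟨a, z⟩
  have h₁ := app_congr (hF (stdSimplex.objEquiv a) x) d
    (prodMk (stdSimplex.objEquiv.symm (𝟙 _)) z)
  refine h₁.trans ?_
  refine congrArg ((F n x).app d) (Prod.ext ?_ rfl)
  exact congrArg stdSimplex.objEquiv.symm (Category.id_comp (stdSimplex.objEquiv a))

lemma tensor_hom_ext {K Y : SSet.{u}} {H H' : K ⊗ Δ[1] ⟶ Y}
    (h : ∀ (n : ℕ) (x : K _⦋n⦌),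
      SSet.yonedaEquiv.symm x ▷ Δ[1] ≫ H = SSet.yonedaEquiv.symm x ▷ Δ[1] ≫ H') : H = H' := by
  ext d ⟨x, z⟩
  refine (yonedaEquiv_symm_whiskerRight_app H x z).symm.trans (Eq.trans ?_
    (yonedaEquiv_symm_whiskerRight_app H' x z))
  exact app_congr (h d.unop.len x) d _

lemma PtInv.whiskerRight {K L Y : SSet.{u}} {h : L ⊗ Δ[1] ⟶ Y} (hh : PtInv h) (f : K ⟶ L) :
    PtInv (f ▷ Δ[1] ≫ h) := fun x ↦ by
  have : (f ▷ Δ[1]).app _ (vEdge x) = vEdge (f.app _ x) :=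
    Prod.ext (app_σ f 0 x) rfl
  show IsInv (h.app _ ((f ▷ Δ[1]).app _ (vEdge x)))
  rw [this]
  exact hh (f.app _ x)

/-- The simplicial set of (homotopy coherent) invertible paths in `Y`. -/
def isoPath (Y : SSet.{u}) : SSet.{u} where
  obj n := {σ : SSet.stdSimplex.obj n.unop ⊗ Δ[1] ⟶ Y // PtInv σ}
  map f := ↾fun σ ↦ ⟨SSet.stdSimplex.map f.unop ▷ Δ[1] ≫ σ.1, σ.2.whiskerRight _⟩
  map_id n := by
    apply ConcreteCategory.hom_ext
    intro σ
    apply Subtype.ext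
    show SSet.stdSimplex.map (𝟙 n.unop) ▷ Δ[1] ≫ σ.1 = σ.1
    erw [SSet.stdSimplex.map_id, id_whiskerRight, Category.id_comp]
  map_comp f g := by
    apply ConcreteCategory.hom_ext
    intro σ
    apply Subtype.ext
    show SSet.stdSimplex.map (g.unop ≫ f.unop) ▷ Δ[1] ≫ σ.1 =
      SSet.stdSimplex.map g.unop ▷ Δ[1] ≫ SSet.stdSimplex.map f.unop ▷ Δ[1] ≫ σ.1
    have h : SSet.stdSimplex.{u}.map (g.unop ≫ f.unop) =
        SSet.stdSimplex.map g.unop ≫ SSet.stdSimplex.map f.unop := SSet.stdSimplex.map_comp _ _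
    erw [h, comp_whiskerRight, Category.assoc]

/-- The source of paths. -/
noncomputable def isoPathSrc (Y : SSet.{u}) : isoPath Y ⟶ Y where
  app n := ↾fun σ ↦ SSet.yonedaEquiv (ι₀ ≫ σ.1)
  naturality d d' f := by
    apply ConcreteCategory.hom_ext
    intro σ
    exact (yonedaEquiv_naturality f.unop (ι₀ ≫ σ.1)).symm

/-- A map to the space of invertible paths gives a pointwise invertible natural transformation. -/
def isoPathUncurry {K Y : SSet.{u}} (f : K ⟶ isoPath Y) : K ⊗ Δ[1] ⟶ Y :=
  uncurryFamily (fun _ x ↦ (f.app _ x).1)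
    (fun _ _ g x ↦ congrArg Subtype.val (ConcreteCategory.congr_hom (f.naturality g.op) x))

lemma whiskerRight_isoPathUncurry {K Y : SSet.{u}} (f : K ⟶ isoPath Y) {n : ℕ} (x : K _⦋n⦌) :
    SSet.yonedaEquiv.symm x ▷ Δ[1] ≫ isoPathUncurry f = (f.app _ x).1 :=
  whiskerRight_uncurryFamily _ _ _

lemma comp_isoPathUncurry {K L Y : SSet.{u}} (g : K ⟶ L) (f : L ⟶ isoPath Y) :
    g ▷ Δ[1] ≫ isoPathUncurry f = isoPathUncurry (g ≫ f) := rfl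

lemma ptInv_isoPathUncurry {K Y : SSet.{u}} (f : K ⟶ isoPath Y) : PtInv (isoPathUncurry f) := by
  intro x
  have h : SSet.yonedaEquiv.symm x ▷ Δ[1] ≫ isoPathUncurry f = (f.app _ x).1 :=
    whiskerRight_isoPathUncurry f (n := 0) x
  have h₂ := (f.app _ x).2
  rw [← h] at h₂
  have h₃ := h₂ (stdSimplex.objEquiv.symm (𝟙 _))
  have e : (SSet.yonedaEquiv.symm x ▷ Δ[1]).app _ (vEdge (stdSimplex.objEquiv.symm (𝟙 _))) =
      vEdge x :=
    Prod.ext ((app_σ (SSet.yonedaEquiv.symm x) 0 _).trans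
      (congrArg (K.σ 0) (ConcreteCategory.congr_hom (K.map_id _) x))) rfl
  exact (congrArg (fun t ↦ IsInv ((isoPathUncurry f).app _ t)) e).mp h₃

lemma ι₀_isoPathUncurry {K Y : SSet.{u}} (f : K ⟶ isoPath Y) :
    ι₀ ≫ isoPathUncurry f = f ≫ isoPathSrc Y := rfl

/-- The inverse of `isoPathUncurry`. -/
def isoPathCurry {K Y : SSet.{u}} (h : K ⊗ Δ[1] ⟶ Y) (hh : PtInv h) : K ⟶ isoPath Y where
  app d := ↾fun x ↦ ⟨(SSet.yonedaEquiv (n := d.unop)).symm x ▷ Δ[1] ≫ h, hh.whiskerRight _⟩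
  naturality d d' f := by
    apply ConcreteCategory.hom_ext
    intro x
    apply Subtype.ext
    have := yonedaEquiv_symm_naturality_left f.unop x
    show (SSet.yonedaEquiv (n := d'.unop)).symm (K.map f x) ▷ Δ[1] ≫ h =
      SSet.stdSimplex.map f.unop ▷ Δ[1] ≫ (SSet.yonedaEquiv (n := d.unop)).symm x ▷ Δ[1] ≫ h
    erw [← comp_whiskerRight_assoc, this]
    rfl

lemma isoPathUncurry_isoPathCurry {K Y : SSet.{u}} (h : K ⊗ Δ[1] ⟶ Y) (hh : PtInv h) :
    isoPathUncurry (isoPathCurry h hh) = h := by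
  apply tensor_hom_ext
  intro n x
  rw [whiskerRight_isoPathUncurry]
  rfl

lemma isoPathUncurry_injective {K Y : SSet.{u}} {f g : K ⟶ isoPath Y}
    (h : isoPathUncurry f = isoPathUncurry g) : f = g := by
  apply NatTrans.ext
  funext d
  apply ConcreteCategory.hom_ext
  intro x
  apply Subtype.ext
  have h₁ := whiskerRight_isoPathUncurry f x (n := d.unop.len)
  rw [h] at h₁
  exact h₁.symm.trans (whiskerRight_isoPathUncurry g x (n := d.unop.len))

-- Lifting against ∂Δ[n] → Δ[n] is the prism extension, and these inclusions suffice for the lifting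
-- property against all monomorphisms.
open modelCategoryQuillen in
lemma rlp_isoPathSrc (Y : SSet.{u}) [Quasicategory Y] :
    (MorphismProperty.monomorphisms SSet.{u}).rlp (isoPathSrc Y) := by
  rw [rlp_monomorphisms]
  rintro _ _ _ ⟨n⟩
  refine ⟨fun {g u} sq ↦ ?_⟩
  obtain ⟨H, hH, h₀, h₁⟩ := exists_extension_boundary u (isoPathUncurry g) sq.w
    (ptInv_isoPathUncurry g)
  refine ⟨⟨isoPathCurry H hH, ?_, ?_⟩⟩
  · apply isoPathUncurry_injective
    rw [← comp_isoPathUncurry, isoPathUncurry_isoPathCurry, h₁]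
  · rw [← ι₀_isoPathUncurry, isoPathUncurry_isoPathCurry, h₀]

/-- Extension of pointwise invertible natural transformations starting from a given functor. -/
theorem exists_extension {A B Y : SSet.{u}} [Quasicategory Y] (i : A ⟶ B) [Mono i] (f : B ⟶ Y)
    (h : A ⊗ Δ[1] ⟶ Y) (w : ι₀ ≫ h = i ≫ f) (hh : PtInv h) :
    ∃ H : B ⊗ Δ[1] ⟶ Y, PtInv H ∧ ι₀ ≫ H = f ∧ i ▷ _ ≫ H = h := by
  have := rlp_isoPathSrc Y i ‹_›
  have sq : CommSq (isoPathCurry h hh) i (isoPathSrc Y) f := ⟨by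
    rw [← ι₀_isoPathUncurry, isoPathUncurry_isoPathCurry, w]⟩
  refine ⟨isoPathUncurry sq.lift, ptInv_isoPathUncurry _, ?_, ?_⟩
  · rw [ι₀_isoPathUncurry, sq.fac_right]
  · rw [comp_isoPathUncurry, sq.fac_left, isoPathUncurry_isoPathCurry]

end Extension

end InftyCat

namespace InftyCat

open SSet Opposite

/-! ### Functor quasi-categories -/

section Fun

variable {K L Y Z : SSet.{u}}

lemma funObj_eq_app (f : K ⟶ Y) {P : SSet.{u}} (x : P _⦋0⦌) (g : K ⊗ P ⟶ Y)
    (h : K ◁ SSet.const x ≫ g = CartesianMonoidalCategory.fst K Δ[0] ≫ f) :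
    (MonoidalClosed.curry g).app _ x = funObj f := by
  have h₁ : K ◁ CartesianMonoidalCategory.toUnit Δ[0] ≫ (ρ_ K).hom ≫ f =
      K ◁ SSet.const x ≫ g := by
    rw [h]
    rfl
  have h₂ := congr(SSet.yonedaEquiv (MonoidalClosed.curry $h₁))
  rw [MonoidalClosed.curry_natural_left, MonoidalClosed.curry_natural_left,
    SSet.yonedaEquiv_comp, SSet.yonedaEquiv_comp, SSet.yonedaEquiv_const] at h₂
  exact h₂.symm

lemma exists_funObj (x : ((ihom K).obj Y) _⦋0⦌) : ∃ f : K ⟶ Y, x = funObj f := by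
  refine ⟨(ρ_ K).inv ≫ MonoidalClosed.uncurry ((unitHomEquiv _).symm x), ?_⟩
  rw [funObj, MonoidalClosed.curry', Iso.hom_inv_id_assoc, MonoidalClosed.curry_uncurry,
    Equiv.apply_symm_apply]

lemma funObj_injective {f g : K ⟶ Y} (h : funObj f = funObj g) : f = g := by
  have := (unitHomEquiv _).injective h
  rw [MonoidalClosed.curry', MonoidalClosed.curry'] at this
  have := MonoidalClosed.curry_injective this
  rwa [cancel_epi] at this

/-- The edge of `Fun(K, Y)` given by a natural transformation. -/
noncomputable def natSimplex (h : K ⊗ Δ[1] ⟶ Y) : ((ihom K).obj Y) _⦋1⦌ :=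
  SSet.yonedaEquiv (MonoidalClosed.curry h)

lemma natSimplex_injective {h h' : K ⊗ Δ[1] ⟶ Y} (e : natSimplex h = natSimplex h') : h = h' :=
  MonoidalClosed.curry_injective (SSet.yonedaEquiv.injective e)

lemma exists_natSimplex (x : ((ihom K).obj Y) _⦋1⦌) : ∃ h : K ⊗ Δ[1] ⟶ Y, x = natSimplex h := by
  refine ⟨MonoidalClosed.uncurry (SSet.yonedaEquiv.symm x), ?_⟩
  rw [natSimplex, MonoidalClosed.curry_uncurry, Equiv.apply_symm_apply]

lemma δ_one_natSimplex (h : K ⊗ Δ[1] ⟶ Y) :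
    SimplicialObject.δ ((ihom K).obj Y) 1 (natSimplex h) = funObj (ι₀ ≫ h) := by
  rw [natSimplex, ← yonedaEquiv_δ_comp, stdSimplex.δ_one_eq_const, SSet.yonedaEquiv_comp,
    SSet.yonedaEquiv_const]
  exact funObj_eq_app _ _ _ rfl

lemma δ_zero_natSimplex (h : K ⊗ Δ[1] ⟶ Y) :
    SimplicialObject.δ ((ihom K).obj Y) 0 (natSimplex h) = funObj (ι₁ ≫ h) := by
  rw [natSimplex, ← yonedaEquiv_δ_comp, stdSimplex.δ_zero_eq_const, SSet.yonedaEquiv_comp,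
    SSet.yonedaEquiv_const]
  exact funObj_eq_app _ _ _ rfl

/-- A natural transformation as an edge of `Fun(K, Y)`. -/
noncomputable def natEdge {f g : K ⟶ Y} (h : K ⊗ Δ[1] ⟶ Y) (h₀ : ι₀ ≫ h = f) (h₁ : ι₁ ≫ h = g) :
    ((ihom K).obj Y).Edge (funObj f) (funObj g) :=
  Edge.mk (natSimplex h) (by rw [δ_one_natSimplex, h₀]) (by rw [δ_zero_natSimplex, h₁])

lemma exists_natEdge {f g : K ⟶ Y} (e : ((ihom K).obj Y).Edge (funObj f) (funObj g)) :
    ∃ (h : K ⊗ Δ[1] ⟶ Y) (h₀ : ι₀ ≫ h = f) (h₁ : ι₁ ≫ h = g), e = natEdge h h₀ h₁ := by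
  obtain ⟨h, hh⟩ := exists_natSimplex e.edge
  have h₀ := e.src_eq
  have h₁ := e.tgt_eq
  rw [hh] at h₀ h₁
  rw [δ_one_natSimplex] at h₀
  rw [δ_zero_natSimplex] at h₁
  exact ⟨h, funObj_injective h₀, funObj_injective h₁, Edge.ext hh⟩

lemma σ_funObj (f : K ⟶ Y) :
    SimplicialObject.σ ((ihom K).obj Y) 0 (funObj f) =
      natSimplex (CartesianMonoidalCategory.fst K Δ[1] ≫ f) := by
  have h₁ := funObj_eq_app f (stdSimplex.objEquiv.symm (𝟙 _))
    (CartesianMonoidalCategory.fst K Δ[0] ≫ f) rfl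
  have h₂ : CartesianMonoidalCategory.fst K Δ[1] ≫ f =
    K ◁ stdSimplex.σ 0 ≫ CartesianMonoidalCategory.fst K Δ[0] ≫ f := rfl
  rw [← h₁, ← app_σ, natSimplex, h₂, MonoidalClosed.curry_natural_left]
  rfl

lemma ι₀_fst_comp (f : K ⟶ Y) : ι₀ ≫ CartesianMonoidalCategory.fst K Δ[1] ≫ f = f := rfl

lemma ι₁_fst_comp (f : K ⟶ Y) : ι₁ ≫ CartesianMonoidalCategory.fst K Δ[1] ≫ f = f := rfl

lemma natEdge_id (f : K ⟶ Y) :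
    natEdge (CartesianMonoidalCategory.fst K Δ[1] ≫ f) (ι₀_fst_comp f) (ι₁_fst_comp f) =
      Edge.id (funObj f) :=
  Edge.ext (σ_funObj f).symm

@[simp]
lemma ihom_map_funObj (f : K ⟶ Y) (p : Y ⟶ Z) :
    ((ihom K).map p).app _ (funObj f) = funObj (f ≫ p) := by
  rw [funObj, funObj, MonoidalClosed.curry', MonoidalClosed.curry', ← Category.assoc,
    MonoidalClosed.curry_natural_right]
  rfl

lemma curry_pre (g : K ⟶ L) {P : SSet.{u}} (f : L ⊗ P ⟶ Y) :
    MonoidalClosed.curry f ≫ (MonoidalClosed.pre g).app Y = MonoidalClosed.curry (g ▷ P ≫ f) := by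
  apply MonoidalClosed.uncurry_injective
  rw [MonoidalClosed.uncurry_curry, MonoidalClosed.uncurry_natural_left, MonoidalClosed.uncurry_pre,
    whisker_exchange_assoc, ← MonoidalClosed.uncurry_eq, MonoidalClosed.uncurry_curry]

@[simp]
lemma pre_app_funObj (g : K ⟶ L) (f : L ⟶ Y) :
    ((MonoidalClosed.pre g).app Y).app _ (funObj f) = funObj (g ≫ f) := by
  have := app_congr (curry_pre g ((ρ_ L).hom ≫ f)) (op ⦋0⦌) PUnit.unit
  refine this.trans ?_
  rw [funObj, MonoidalClosed.curry', ← rightUnitor_naturality_assoc]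
  rfl

@[simp]
lemma pre_app_natSimplex (g : K ⟶ L) (h : L ⊗ Δ[1] ⟶ Y) :
    ((MonoidalClosed.pre g).app Y).app _ (natSimplex h) = natSimplex (g ▷ Δ[1] ≫ h) := by
  rw [natSimplex, ← SSet.yonedaEquiv_comp, curry_pre]
  rfl

/-- The evaluation of functors at an object. -/
noncomputable def evalAt (x : K _⦋0⦌) : (ihom K).obj Y ⟶ Y :=
  CartesianMonoidalCategory.lift (SSet.const x) (𝟙 _) ≫ (ihom.ev K).app Y

lemma curry_evalAt (x : K _⦋0⦌) {P : SSet.{u}} (f : K ⊗ P ⟶ Y) :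
    MonoidalClosed.curry f ≫ evalAt x =
      CartesianMonoidalCategory.lift (SSet.const x) (𝟙 _) ≫ f := by
  have : CartesianMonoidalCategory.lift (SSet.const x) (𝟙 _) ≫ K ◁ MonoidalClosed.curry f =
    MonoidalClosed.curry f ≫ CartesianMonoidalCategory.lift (SSet.const x) (𝟙 _) := rfl
  rw [evalAt, ← Category.assoc, ← this, Category.assoc, ← MonoidalClosed.uncurry_eq,
    MonoidalClosed.uncurry_curry]

lemma evalAt_natSimplex (x : K _⦋0⦌) (h : K ⊗ Δ[1] ⟶ Y) :
    (evalAt x).app _ (natSimplex h) = h.app _ (vEdge x) := by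
  rw [natSimplex, ← SSet.yonedaEquiv_comp, curry_evalAt]
  refine congrArg (h.app _) (Prod.ext ?_ rfl)
  have : SimplexCategory.const ⦋1⦌ ⦋0⦌ 0 = SimplexCategory.σ 0 := by
    ext i : 3
    exact Subsingleton.elim (α := Fin 1) _ _
  exact congr(K.map ($this).op x)

lemma evalAt_funObj (x : K _⦋0⦌) (f : K ⟶ Y) :
    (evalAt x).app _ (funObj f) = f.app _ x := by
  have := app_congr (curry_evalAt x ((ρ_ K).hom ≫ f)) (op ⦋0⦌) PUnit.unit
  refine this.trans (congrArg (f.app _) ?_)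
  have : SimplexCategory.const ⦋0⦌ ⦋0⦌ 0 = 𝟙 _ := by
    ext i : 3
    exact Subsingleton.elim (α := Fin 1) _ _
  refine (congr(K.map ($this).op x) : _ = K.map (𝟙 _) x).trans ?_
  rw [K.map_id]
  rfl

end Fun

end InftyCat

namespace InftyCat

open SSet Opposite

/-! ### Squares and cubes of natural transformations; pointwise invertibility implies invertibility.
-/

section Box

/-- A map from the square `Δ[1] ⊗ Δ[1]` gives a commutative square in the homotopy category. -/
lemma square_fac {Z : SSet.{u}} [Quasicategory Z] (S : (Δ[1] ⊗ Δ[1] : SSet.{u}) ⟶ Z)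
    {x₀₀ x₀₁ x₁₀ x₁₁ : Z _⦋0⦌} (l : Z.Edge x₀₀ x₀₁) (b : Z.Edge x₀₁ x₁₁) (t : Z.Edge x₀₀ x₁₀)
    (r : Z.Edge x₁₀ x₁₁)
    (hl : S.app _ (prodMk (stdSimplex.objMk₁ 2) (stdSimplex.objMk₁ 1)) = l.edge)
    (hb : S.app _ (prodMk (stdSimplex.objMk₁ 1) (stdSimplex.objMk₁ 0)) = b.edge)
    (ht : S.app _ (prodMk (stdSimplex.objMk₁ 1) (stdSimplex.objMk₁ 2)) = t.edge)
    (hr : S.app _ (prodMk (stdSimplex.objMk₁ 0) (stdSimplex.objMk₁ 1)) = r.edge) :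
    hoHom l ≫ hoHom b = hoHom t ≫ hoHom r := by
  let c : Z _⦋1⦌ := S.app _ (prodMk (stdSimplex.objMk₁ 1) (stdSimplex.objMk₁ 1))
  let z₁ : Z _⦋2⦌ := S.app _ (prodMk (stdSimplex.objMk₁ 2) (stdSimplex.objMk₁ 1))
  let z₂ : Z _⦋2⦌ := S.app _ (prodMk (stdSimplex.objMk₁ 1) (stdSimplex.objMk₁ 2))
  have key (j : Fin 3) (a a' : (Δ[1] : SSet.{u}) _⦋2⦌) (b b' : (Δ[1] : SSet.{u}) _⦋1⦌)
      (h : Δ[1].δ j a = b) (h' : Δ[1].δ j a' = b') :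
      Z.δ j (S.app _ (prodMk a a')) = S.app _ (prodMk b b') := by
    rw [← h, ← h', ← app_δ]
    rfl
  have h₁₂ : Z.δ 2 z₁ = l.edge := (key 2 _ _ _ _ (by decide) (by decide)).trans hl
  have h₁₀ : Z.δ 0 z₁ = b.edge := (key 0 _ _ _ _ (by decide) (by decide)).trans hb
  have h₁₁ : Z.δ 1 z₁ = c := key 1 _ _ _ _ (by decide) (by decide)
  have h₂₂ : Z.δ 2 z₂ = t.edge := (key 2 _ _ _ _ (by decide) (by decide)).trans ht
  have h₂₀ : Z.δ 0 z₂ = r.edge := (key 0 _ _ _ _ (by decide) (by decide)).trans hr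
  have h₂₁ : Z.δ 1 z₂ = c := key 1 _ _ _ _ (by decide) (by decide)
  let e : Z.Edge x₀₀ x₁₁ := Edge.mk c
    (by
      rw [← h₁₁, ← l.src_eq, ← h₁₂]
      exact (ConcreteCategory.congr_hom (Z.δ_comp_δ (i := 1) (j := 1) le_rfl) z₁).symm)
    (by
      rw [← h₁₁, ← b.tgt_eq, ← h₁₀]
      exact ConcreteCategory.congr_hom (Z.δ_comp_δ (i := 0) (j := 0) le_rfl) z₁)
  rw [compStruct_fac (Edge.CompStruct.mk z₁ h₁₂ h₁₀ h₁₁ : Edge.CompStruct l b e),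
    compStruct_fac (Edge.CompStruct.mk z₂ h₂₂ h₂₀ h₂₁ : Edge.CompStruct t r e)]

lemma natEdge_square_fac {K Y : SSet.{u}} [Quasicategory Y] (H : (K ⊗ Δ[1]) ⊗ Δ[1] ⟶ Y)
    {f₀₀ f₀₁ f₁₀ f₁₁ : K ⟶ Y} {l b t r : K ⊗ Δ[1] ⟶ Y}
    (hl : ι₀ ▷ Δ[1] ≫ H = l) (hb : ι₁ ≫ H = b) (ht : ι₀ ≫ H = t) (hr : ι₁ ▷ Δ[1] ≫ H = r)
    (hl₀ : ι₀ ≫ l = f₀₀) (hl₁ : ι₁ ≫ l = f₀₁) (hb₀ : ι₀ ≫ b = f₀₁) (hb₁ : ι₁ ≫ b = f₁₁)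
    (ht₀ : ι₀ ≫ t = f₀₀) (ht₁ : ι₁ ≫ t = f₁₀) (hr₀ : ι₀ ≫ r = f₁₀) (hr₁ : ι₁ ≫ r = f₁₁) :
    hoHom (natEdge l hl₀ hl₁) ≫ hoHom (natEdge b hb₀ hb₁) =
      hoHom (natEdge t ht₀ ht₁) ≫ hoHom (natEdge r hr₀ hr₁) := by
  let S : (Δ[1] ⊗ Δ[1] : SSet.{u}) ⟶ (ihom K).obj Y :=
    MonoidalClosed.curry ((α_ K Δ[1] Δ[1]).inv ≫ H)
  have key (a a' : (Δ[1] : SSet.{u}) _⦋1⦌) :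
      S.app _ (prodMk a a') = natSimplex (K ◁ CartesianMonoidalCategory.lift
        (SSet.yonedaEquiv.symm a) (SSet.yonedaEquiv.symm a') ≫ (α_ K Δ[1] Δ[1]).inv ≫ H) := by
    rw [natSimplex, MonoidalClosed.curry_natural_left, SSet.yonedaEquiv_comp]
    refine congrArg (S.app _) (Prod.ext ?_ ?_)
    · exact ((SSet.yonedaEquiv (X := Δ[1]) (n := ⦋1⦌)).apply_symm_apply a).symm
    · exact ((SSet.yonedaEquiv (X := Δ[1]) (n := ⦋1⦌)).apply_symm_apply a').symm
  have h₂ : SSet.yonedaEquiv.symm (stdSimplex.objMk₁ 2 : (Δ[1] : SSet.{u}) _⦋1⦌) =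
      SSet.const (stdSimplex.obj₀Equiv.symm 0) := by
    apply SSet.yonedaEquiv.injective; rw [Equiv.apply_symm_apply]; decide
  have h₁ : SSet.yonedaEquiv.symm (stdSimplex.objMk₁ 1 : (Δ[1] : SSet.{u}) _⦋1⦌) = 𝟙 _ := by
    apply SSet.yonedaEquiv.injective; rw [Equiv.apply_symm_apply]; decide
  have h₀ : SSet.yonedaEquiv.symm (stdSimplex.objMk₁ 0 : (Δ[1] : SSet.{u}) _⦋1⦌) =
      SSet.const (stdSimplex.obj₀Equiv.symm 1) := by
    apply SSet.yonedaEquiv.injective; rw [Equiv.apply_symm_apply]; decide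
  apply square_fac S
  · rw [key, h₁, h₂]; exact congrArg natSimplex hl
  · rw [key, h₁, h₀]; exact congrArg natSimplex hb
  · rw [key, h₁, h₂]; exact congrArg natSimplex ht
  · rw [key, h₁, h₀]; exact congrArg natSimplex hr

section Glue

variable {B : SSet.{u}} (A : B.Subcomplex)

/-- The subcomplex `A ⊗ Δ[1] ∪ B ⊗ {0, 1}` of `B ⊗ Δ[1]`. -/
abbrev openBox : (B ⊗ Δ[1] : SSet.{u}).Subcomplex := A.unionProd ∂Δ[1]

/-- The inclusion of `B ⊗ {ε}`. -/
noncomputable def endι (ε : Fin 2) {X : SSet.{u}} : X ⟶ X ⊗ Δ[1] :=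
  CartesianMonoidalCategory.lift (𝟙 X) (SSet.const (stdSimplex.obj₀Equiv.symm ε))

lemma endι_zero {X : SSet.{u}} : endι 0 = (ι₀ : X ⟶ X ⊗ Δ[1]) := rfl

lemma endι_one {X : SSet.{u}} : endι 1 = (ι₁ : X ⟶ X ⊗ Δ[1]) := rfl

/-- The inclusion of the side `A ⊗ Δ[1]` of the open box. -/
noncomputable def openBoxSide : (A : SSet) ⊗ Δ[1] ⟶ openBox A := Subcomplex.unionProd.ι₂ _ _

/-- The inclusion of the ends of the open box. -/
noncomputable def openBoxEnd (ε : Fin 2) : B ⟶ openBox A :=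
  Subcomplex.lift (endι ε) (by
    rintro d _ ⟨x, rfl⟩
    refine Or.inl ⟨Set.mem_univ _, fun h ↦ ?_⟩
    obtain ⟨i, hi⟩ := h (1 - ε)
    have : ε = 1 - ε := hi
    fin_cases ε <;> simp at this)

lemma openBoxEnd_ι (ε : Fin 2) : openBoxEnd A ε ≫ (openBox A).ι = endι ε := rfl

lemma openBox_cases {d : SimplexCategoryᵒᵖ} (x : (openBox A).obj d) :
    (∃ ε b, x = (openBoxEnd A ε).app d b) ∨ ∃ a, x = (openBoxSide A).app d a := by
  obtain ⟨⟨b, z⟩, h⟩ := x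
  rcases h with ⟨-, h⟩ | ⟨h, -⟩
  · left
    rw [show (z ∈ ∂Δ[1].obj d) ↔ ¬ Function.Surjective (stdSimplex.asOrderHom z) from Iff.rfl,
      Function.Surjective] at h
    push Not at h
    obtain ⟨v, hv⟩ := h
    refine ⟨1 - v, b, Subtype.ext (Prod.ext rfl (asOrderHom_ext fun i ↦ ?_))⟩
    have h₁ := hv i
    show stdSimplex.asOrderHom z i = 1 - v
    revert h₁
    generalize stdSimplex.asOrderHom z i = w
    clear hv
    revert v w
    decide
  · right
    exact ⟨(⟨b, h⟩, z), rfl⟩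

variable {A} in
lemma openBox_hom_ext {L Y : SSet.{u}} {g g' : (openBox A : SSet) ⊗ L ⟶ Y}
    (h : ∀ ε, openBoxEnd A ε ▷ L ≫ g = openBoxEnd A ε ▷ L ≫ g')
    (h' : openBoxSide A ▷ L ≫ g = openBoxSide A ▷ L ≫ g') : g = g' := by
  ext d ⟨x, k⟩
  obtain ⟨ε, b, rfl⟩ | ⟨a, rfl⟩ := openBox_cases A x
  · exact app_congr (h ε) d (b, k)
  · exact app_congr h' d (a, k)

-- The box is covered by its two disjoint ends and its side, and `w` is the agreement on the
-- overlap. The factor `L` allows homotopies and squares of homotopies to be glued as well.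
open Classical in
lemma exists_openBox_desc {L Y : SSet.{u}} (h : ((A : SSet) ⊗ Δ[1]) ⊗ L ⟶ Y)
    (s : Fin 2 → (B ⊗ L ⟶ Y)) (w : ∀ ε, endι ε ▷ L ≫ h = A.ι ▷ L ≫ s ε) :
    ∃ g : (openBox A : SSet) ⊗ L ⟶ Y, (∀ ε, openBoxEnd A ε ▷ L ≫ g = s ε) ∧
      openBoxSide A ▷ L ≫ g = h := by
  let P {d : SimplexCategoryᵒᵖ} (x : (openBox A).obj d) (ε : Fin 2) : Prop :=
    ∀ i, stdSimplex.asOrderHom x.1.2 i = ε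
  have hP {d : SimplexCategoryᵒᵖ} (x : (openBox A).obj d) (h₀ : ¬ ∃ ε, P x ε) :
      x.1.1 ∈ A.obj d := by
    obtain ⟨ε, b, rfl⟩ | ⟨a, rfl⟩ := openBox_cases A x
    · exact (h₀ ⟨ε, fun _ ↦ rfl⟩).elim
    · exact a.1.2
  let G (d : SimplexCategoryᵒᵖ) (x : ((openBox A : SSet) ⊗ L : SSet).obj d) : Y.obj d :=
    if h₀ : ∃ ε, P x.1 ε then (s h₀.choose).app d (prodMk x.1.1.1 x.2) else
      h.app d (prodMk (prodMk ⟨x.1.1.1, hP x.1 h₀⟩ x.1.1.2) x.2)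
  have hG₁ (d) (ε) (x : ((openBox A : SSet) ⊗ L : SSet).obj d) (hx : P x.1 ε) :
      G d x = (s ε).app d (prodMk x.1.1.1 x.2) := by
    have h₀ : ∃ ε, P x.1 ε := ⟨ε, hx⟩
    have : h₀.choose = ε := (h₀.choose_spec 0).symm.trans (hx 0)
    simp only [G]
    rw [dif_pos h₀, this]
  have hG₂ (d) (x : ((openBox A : SSet) ⊗ L : SSet).obj d) (hx : x.1.1.1 ∈ A.obj d) :
      G d x = h.app d (prodMk (prodMk ⟨x.1.1.1, hx⟩ x.1.1.2) x.2) := by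
    by_cases h₀ : ∃ ε, P x.1 ε
    · obtain ⟨ε, hε⟩ := h₀
      rw [hG₁ d ε x hε]
      refine (app_congr (w ε) d (prodMk ⟨x.1.1.1, hx⟩ x.2)).symm.trans ?_
      refine congrArg (h.app d) (Prod.ext (Prod.ext rfl (asOrderHom_ext fun i ↦ ?_)) rfl)
      exact (hε i).symm
    · simp only [G]
      rw [dif_neg h₀]
  refine ⟨{ app := fun d ↦ ↾(G d), naturality := fun d d' f ↦ ?_ }, fun ε ↦ ?_, ?_⟩
  · apply ConcreteCategory.hom_ext
    intro x
    show G d' _ = Y.map f (G d x)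
    by_cases h₀ : ∃ ε, P x.1 ε
    · obtain ⟨ε, hε⟩ := h₀
      rw [hG₁ d ε x hε, hG₁ d' ε _ (fun i ↦ hε (f.unop.toOrderHom i)), ← app_map]
      rfl
    · rw [hG₂ d x (hP _ h₀), ← app_map]
      exact hG₂ d' (((openBox A : SSet) ⊗ L : SSet).map f x) (A.map f (hP _ h₀))
  · apply NatTrans.ext
    funext d
    apply ConcreteCategory.hom_ext
    intro x
    exact hG₁ d ε _ (fun _ ↦ rfl)
  · apply NatTrans.ext
    funext d
    apply ConcreteCategory.hom_ext
    intro x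
    exact hG₂ d _ x.1.1.2

end Glue

/-- The property that pointwise invertible natural transformations from or to (depending on `ε`) a
given functor may be extended. -/
def HasExtension (ε : Fin 2) (Y : SSet.{u}) : Prop :=
  ∀ ⦃B : SSet.{u}⦄ (A : B.Subcomplex) (f : B ⟶ Y) (h : (A : SSet) ⊗ Δ[1] ⟶ Y),
    endι ε ≫ h = A.ι ≫ f → PtInv h →
      ∃ H : B ⊗ Δ[1] ⟶ Y, PtInv H ∧ endι ε ≫ H = f ∧ A.ι ▷ Δ[1] ≫ H = h

lemma hasExtension_zero (Y : SSet.{u}) [Quasicategory Y] : HasExtension 0 Y :=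
  fun _ A f h w hh ↦ exists_extension A.ι f h w hh

/-- This is the extension property for the inclusion of the open box A ⊗ Δ[1] ∪ B ⊗ {0,1} in B ⊗
Δ[1], with h on the side and s₀, s₁ on the ends. -/
lemma HasExtension.exists_box {ε : Fin 2} {Y : SSet.{u}} (hY : HasExtension ε Y) {B : SSet.{u}}
    (A : B.Subcomplex) (f : B ⊗ Δ[1] ⟶ Y) (h : ((A : SSet) ⊗ Δ[1]) ⊗ Δ[1] ⟶ Y)
    (s₀ s₁ : B ⊗ Δ[1] ⟶ Y) (hs₀ : PtInv s₀) (hs₁ : PtInv s₁)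
    (wh₀ : ι₀ ▷ Δ[1] ≫ h = A.ι ▷ Δ[1] ≫ s₀) (wh₁ : ι₁ ▷ Δ[1] ≫ h = A.ι ▷ Δ[1] ≫ s₁)
    (wf₀ : endι ε ≫ s₀ = ι₀ ≫ f) (wf₁ : endι ε ≫ s₁ = ι₁ ≫ f)
    (w₃ : endι ε ≫ h = A.ι ▷ Δ[1] ≫ f) :
    ∃ H : (B ⊗ Δ[1]) ⊗ Δ[1] ⟶ Y, endι ε ≫ H = f ∧ ι₀ ▷ Δ[1] ≫ H = s₀ ∧ ι₁ ▷ Δ[1] ≫ H = s₁ ∧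
      (A.ι ▷ Δ[1]) ▷ Δ[1] ≫ H = h := by
  let s : Fin 2 → (B ⊗ Δ[1] ⟶ Y) := ![s₀, s₁]
  have hs : ∀ η, PtInv (s η) := Fin.forall_fin_two.2 ⟨hs₀, hs₁⟩
  have w₁ : ∀ η, endι η ▷ Δ[1] ≫ h = A.ι ▷ Δ[1] ≫ s η := Fin.forall_fin_two.2 ⟨wh₀, wh₁⟩
  have w₂ : ∀ η, endι ε ≫ s η = endι η ≫ f := Fin.forall_fin_two.2 ⟨wf₀, wf₁⟩
  suffices h' : ∃ H : (B ⊗ Δ[1]) ⊗ Δ[1] ⟶ Y, endι ε ≫ H = f ∧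
      (∀ η, endι η ▷ Δ[1] ≫ H = s η) ∧ (A.ι ▷ Δ[1]) ▷ Δ[1] ≫ H = h by
    obtain ⟨H, h₁, h₂, h₃⟩ := h'
    exact ⟨H, h₁, h₂ 0, h₂ 1, h₃⟩
  obtain ⟨g, hg₁, hg₂⟩ := exists_openBox_desc A h s w₁
  obtain ⟨H, -, hH₁, hH₂⟩ := hY (openBox A) f g (by
      ext d x
      obtain ⟨η, b, rfl⟩ | ⟨a, rfl⟩ := openBox_cases A x
      · exact (app_congr (hg₁ η) d ((endι ε).app d b)).trans (app_congr (w₂ η) d b)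
      · exact (app_congr hg₂ d ((endι ε).app d a)).trans (app_congr w₃ d a)) (fun x ↦ by
    -- Pointwise invertibility is tested on vertices, and every vertex of the open box lies on an
    -- end. This is why no invertibility of h is assumed.
    have : ∃ ε b, x = (openBoxEnd A ε).app _ b := by
      obtain ⟨⟨b, z⟩, h⟩ := x
      refine ⟨stdSimplex.asOrderHom z 0, b, Subtype.ext (Prod.ext rfl (asOrderHom_ext fun i ↦ ?_))⟩
      obtain rfl : i = 0 := Subsingleton.elim (α := Fin 1) _ _
      rfl
    obtain ⟨η, b, rfl⟩ := this
    have h₁ := hs η b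
    rw [← hg₁ η] at h₁
    exact h₁)
  refine ⟨H, hH₁, fun η ↦ ?_, ?_⟩
  · rw [← hg₁, ← hH₂]
    rfl
  · rw [← hg₂, ← hH₂]
    rfl

/-- Maps from the empty subcomplex. -/
def fromBot (B Y : SSet.{u}) : (((⊥ : B.Subcomplex) : SSet) ⊗ Δ[1]) ⊗ Δ[1] ⟶ Y where
  app _ := ↾fun x ↦ x.1.1.2.elim
  naturality _ _ _ := by
    apply ConcreteCategory.hom_ext
    intro x
    exact x.1.1.2.elim

lemma fromBot_ext {B L Y : SSet.{u}} {g g' : ((⊥ : B.Subcomplex) : SSet) ⊗ L ⟶ Y} : g = g' := by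
  ext d x
  exact x.1.2.elim

lemma HasExtension.exists_square {ε : Fin 2} {Y : SSet.{u}} (hY : HasExtension ε Y) {B : SSet.{u}}
    (f s₀ s₁ : B ⊗ Δ[1] ⟶ Y) (hs₀ : PtInv s₀) (hs₁ : PtInv s₁)
    (w₀ : endι ε ≫ s₀ = ι₀ ≫ f) (w₁ : endι ε ≫ s₁ = ι₁ ≫ f) :
    ∃ H : (B ⊗ Δ[1]) ⊗ Δ[1] ⟶ Y, endι ε ≫ H = f ∧ ι₀ ▷ Δ[1] ≫ H = s₀ ∧ ι₁ ▷ Δ[1] ≫ H = s₁ := by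
  obtain ⟨H, h₁, h₂, h₃, -⟩ := hY.exists_box ⊥ f (fromBot B Y) s₀ s₁ hs₀ hs₁ fromBot_ext
    fromBot_ext w₀ w₁ fromBot_ext
  exact ⟨H, h₁, h₂, h₃⟩

variable {K Y : SSet.{u}}

lemma ι₀_ι₁_comp (H : (K ⊗ Δ[1]) ⊗ Δ[1] ⟶ Y) : ι₀ ≫ ι₁ ≫ H = ι₁ ≫ ι₀ ▷ Δ[1] ≫ H :=
  (ι₁_comp_assoc _ _).symm

lemma ι₁_ι₁_comp (H : (K ⊗ Δ[1]) ⊗ Δ[1] ⟶ Y) : ι₁ ≫ ι₁ ≫ H = ι₁ ≫ ι₁ ▷ Δ[1] ≫ H :=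
  (ι₁_comp_assoc _ _).symm

lemma ptInv_fst_comp (f : K ⟶ Y) : PtInv (CartesianMonoidalCategory.fst K Δ[1] ≫ f) := fun x ↦
  (isEquivalence_id (f.app _ x)).ofEq (app_σ f 0 x).symm

variable [Quasicategory Y]

omit [Quasicategory Y] in
lemma isInv_of_isInv_natSimplex {h : K ⊗ Δ[1] ⟶ Y} (hh : IsInv (natSimplex h)) : PtInv h :=
  fun x ↦ by
    have := hh.map (evalAt x)
    rwa [evalAt_natSimplex] at this

/-- The component of a natural transformation. -/
noncomputable def component {f g : K ⟶ Y} (h : K ⊗ Δ[1] ⟶ Y) (h₀ : ι₀ ≫ h = f) (h₁ : ι₁ ≫ h = g)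
    (x : K _⦋0⦌) : Y.Edge (f.app _ x) (g.app _ x) :=
  Edge.mk (h.app _ (vEdge x))
    (by
      rw [← h₀, ← app_δ]
      refine congrArg (h.app _) (Prod.ext ?_ ?_)
      · exact ConcreteCategory.congr_hom (K.δ_comp_σ_succ (i := (0 : Fin 1))) x
      · refine asOrderHom_ext fun i ↦ ?_
        obtain rfl : i = 0 := Subsingleton.elim (α := Fin 1) _ _
        rfl)
    (by
      rw [← h₁, ← app_δ]
      refine congrArg (h.app _) (Prod.ext ?_ ?_)
      · exact ConcreteCategory.congr_hom (K.δ_comp_σ_self (i := (0 : Fin 1))) x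
      · refine asOrderHom_ext fun i ↦ ?_
        obtain rfl : i = 0 := Subsingleton.elim (α := Fin 1) _ _
        rfl)

lemma component_fac_of_natEdge_fac {f₀ f₁ f₂ : K ⟶ Y} {h h' h'' : K ⊗ Δ[1] ⟶ Y} {h₀ : ι₀ ≫ h = f₀}
    {h₁ : ι₁ ≫ h = f₁} {h₀' : ι₀ ≫ h' = f₁} {h₁' : ι₁ ≫ h' = f₂} {h₀'' : ι₀ ≫ h'' = f₀}
    {h₁'' : ι₁ ≫ h'' = f₂}
    (w : hoHom (natEdge h h₀ h₁) ≫ hoHom (natEdge h' h₀' h₁') = hoHom (natEdge h'' h₀'' h₁''))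
    (x : K _⦋0⦌) :
    hoHom (component h h₀ h₁ x) ≫ hoHom (component h' h₀' h₁' x) =
      hoHom (component h'' h₀'' h₁'' x) := by
  obtain ⟨z⟩ := nonempty_compStruct_iff.2 w
  have z' := z.map (evalAt x)
  exact compStruct_fac (Edge.CompStruct.mk z'.simplex
    (z'.d₂.trans (evalAt_natSimplex x h)) (z'.d₀.trans (evalAt_natSimplex x h'))
    (z'.d₁.trans (evalAt_natSimplex x h'')))

omit [Quasicategory Y] in
lemma component_fst_comp (f : K ⟶ Y) (x : K _⦋0⦌) :
    component (CartesianMonoidalCategory.fst K Δ[1] ≫ f) (ι₀_fst_comp f) (ι₁_fst_comp f) x =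
      Edge.id (f.app _ x) :=
  Edge.ext (app_σ f 0 x)

omit [Quasicategory Y] in
lemma isEquivalence_component {f g : K ⟶ Y} {h : K ⊗ Δ[1] ⟶ Y} {h₀ : ι₀ ≫ h = f} {h₁ : ι₁ ≫ h = g}
    (hh : PtInv h) (x : K _⦋0⦌) : IsEquivalence (component h h₀ h₁ x) :=
  (hh x).ofEq rfl

lemma natEdge_square_fac_of_right (H : (K ⊗ Δ[1]) ⊗ Δ[1] ⟶ Y) {f g : K ⟶ Y}
    {h : K ⊗ Δ[1] ⟶ Y} (hl : ι₀ ▷ Δ[1] ≫ H = h)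
    (ht : ι₀ ≫ H = CartesianMonoidalCategory.fst _ _ ≫ f)
    (hr : ι₁ ▷ Δ[1] ≫ H = CartesianMonoidalCategory.fst _ _ ≫ f)
    (h₀ : ι₀ ≫ h = f) (h₁ : ι₁ ≫ h = g) (w₀ : ι₀ ≫ ι₁ ≫ H = g) (w₁ : ι₁ ≫ ι₁ ≫ H = f) :
    hoHom (natEdge h h₀ h₁) ≫ hoHom (natEdge (ι₁ ≫ H) w₀ w₁) = 𝟙 (hoObj (funObj f)) := by
  have e : hoHom (natEdge (CartesianMonoidalCategory.fst K Δ[1] ≫ f) (ι₀_fst_comp f)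
      (ι₁_fst_comp f)) = 𝟙 (hoObj (funObj f)) :=
    (congrArg hoHom (natEdge_id f)).trans (hoHom_id _)
  have := natEdge_square_fac H hl rfl ht hr h₀ h₁ w₀ w₁ (ι₀_fst_comp f) (ι₁_fst_comp f)
    (ι₀_fst_comp f) (ι₁_fst_comp f)
  rw [e, Category.id_comp] at this
  exact this

lemma ptInv_of_fac {f g : K ⟶ Y} {h h' : K ⊗ Δ[1] ⟶ Y} {h₀ : ι₀ ≫ h = f}
    {h₁ : ι₁ ≫ h = g} {h₀' : ι₀ ≫ h' = g} {h₁' : ι₁ ≫ h' = f} (hh : PtInv h)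
    (w : hoHom (natEdge h h₀ h₁) ≫ hoHom (natEdge h' h₀' h₁') = 𝟙 _) : PtInv h' := by
  intro x
  rw [← hoHom_id, ← natEdge_id] at w
  have h₁ := (component_fac_of_natEdge_fac w x).trans
    ((congrArg hoHom (component_fst_comp f x)).trans (hoHom_id _))
  have := (isEquivalence_iff_isIso _).1 (isEquivalence_component (h₀ := h₀) (h₁ := ‹_›) hh x)
  have h₂ := (isEquivalence_iff_isIso (component h' h₀' h₁' x)).2 (by
    rw [IsIso.eq_inv_of_hom_inv_id h₁]
    infer_instance)
  exact h₂.ofEq rfl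

/-- Extend over K ⊗ Δ[1] from the constant transformation at f, with h above one end and the
constant transformation above the other. The edge of the square opposite to the initial constant one
goes from g back to f. -/
lemma exists_right_inverse {f g : K ⟶ Y} (h : K ⊗ Δ[1] ⟶ Y) (h₀ : ι₀ ≫ h = f) (h₁ : ι₁ ≫ h = g)
    (hh : PtInv h) : ∃ (h' : K ⊗ Δ[1] ⟶ Y) (h₀' : ι₀ ≫ h' = g) (h₁' : ι₁ ≫ h' = f), PtInv h' ∧
      hoHom (natEdge h h₀ h₁) ≫ hoHom (natEdge h' h₀' h₁') = 𝟙 _ := by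
  obtain ⟨H, hH, hH₀, hH₁⟩ := (hasExtension_zero Y).exists_square
    (CartesianMonoidalCategory.fst _ _ ≫ f) h (CartesianMonoidalCategory.fst _ _ ≫ f) hh
    (ptInv_fst_comp _) h₀ (ι₀_fst_comp f)
  have w₀ : ι₀ ≫ ι₁ ≫ H = g := by
    rw [ι₀_ι₁_comp, hH₀, h₁]
  have w₁ : ι₁ ≫ ι₁ ≫ H = f := by
    rw [ι₁_ι₁_comp, hH₁, ι₁_fst_comp]
  have w : hoHom (natEdge h h₀ h₁) ≫ hoHom (natEdge (ι₁ ≫ H) w₀ w₁) = 𝟙 _ :=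
    natEdge_square_fac_of_right H hH₀ hH hH₁ h₀ h₁ w₀ w₁
  exact ⟨ι₁ ≫ H, w₀, w₁, ptInv_of_fac hh w, w⟩

/-- A natural transformation is invertible if and only if it is pointwise invertible. -/
theorem isInv_natSimplex_iff {h : K ⊗ Δ[1] ⟶ Y} : IsInv (natSimplex h) ↔ PtInv h := by
  refine ⟨isInv_of_isInv_natSimplex, fun hh ↦ ?_⟩
  obtain ⟨h', h₀', h₁', hh', w⟩ := exists_right_inverse h rfl rfl hh
  -- The right inverse h' is again pointwise invertible, so it has a right inverse h'', which must
  -- be the class of h.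
  obtain ⟨h'', h₀'', h₁'', hh'', w'⟩ := exists_right_inverse h' h₀' h₁' hh'
  have : IsEquivalence (natEdge h rfl rfl) := by
    rw [isEquivalence_iff_isIso]
    refine ⟨_, w, ?_⟩
    have : hoHom (natEdge h'' h₀'' h₁'') = hoHom (natEdge h rfl rfl) := by
      rw [← Category.id_comp (hoHom (natEdge h'' h₀'' h₁'')), ← w, Category.assoc, w',
        Category.comp_id]
    rw [← this, w']
  exact this.ofEq rfl

lemma isEquivalence_natEdge_iff {f g : K ⟶ Y} {h : K ⊗ Δ[1] ⟶ Y} {h₀ : ι₀ ≫ h = f}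
    {h₁ : ι₁ ≫ h = g} : IsEquivalence (natEdge h h₀ h₁) ↔ PtInv h := by
  rw [isEquivalence_iff_isInv]
  exact isInv_natSimplex_iff

lemma equivalent_funObj_iff {f g : K ⟶ Y} :
    Equivalent (funObj f) (funObj g) ↔ ∃ h : K ⊗ Δ[1] ⟶ Y, PtInv h ∧ ι₀ ≫ h = f ∧ ι₁ ≫ h = g := by
  constructor
  · rintro ⟨e, he⟩
    obtain ⟨h, h₀, h₁, rfl⟩ := exists_natEdge e
    exact ⟨h, isEquivalence_natEdge_iff.1 he, h₀, h₁⟩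
  · rintro ⟨h, hh, h₀, h₁⟩
    exact ⟨natEdge h h₀ h₁, isEquivalence_natEdge_iff.2 hh⟩

/-- The map `Δ[1] ⊗ Δ[1] ⟶ Δ[2]` which sends `(0, s)` to `s` and `(1, s)` to `2`. -/
def squareToTriangle : (Δ[1] ⊗ Δ[1] : SSet.{u}) ⟶ Δ[2] where
  app d := ↾fun x ↦ stdSimplex.objMk
    { toFun i := if stdSimplex.asOrderHom x.1 i = 0 then (stdSimplex.asOrderHom x.2 i).castSucc
        else 2
      monotone' i j hij := by
        have h₁ := (stdSimplex.asOrderHom x.1).monotone hij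
        have h₂ := (stdSimplex.asOrderHom x.2).monotone hij
        revert h₁ h₂
        dsimp only
        generalize stdSimplex.asOrderHom x.1 i = a
        generalize stdSimplex.asOrderHom x.1 j = b
        generalize stdSimplex.asOrderHom x.2 i = c
        generalize stdSimplex.asOrderHom x.2 j = e
        revert a b c e
        decide }
  naturality _ _ _ := rfl

omit [Quasicategory Y] in
lemma endι_whiskerRight_associator {ε : Fin 2} {L : SSet.{u}} (S : Δ[1] ⊗ Δ[1] ⟶ L)
    (U : K ⊗ L ⟶ Y) : endι ε ▷ Δ[1] ≫ (α_ K Δ[1] Δ[1]).hom ≫ K ◁ S ≫ U =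
      K ◁ (CartesianMonoidalCategory.lift (SSet.const (stdSimplex.obj₀Equiv.symm ε)) (𝟙 _) ≫ S) ≫
        U := by
  apply NatTrans.ext
  funext d
  apply ConcreteCategory.hom_ext
  intro x
  rfl

omit [Quasicategory Y] in
lemma endι_associator {ε : Fin 2} {L : SSet.{u}} (S : Δ[1] ⊗ Δ[1] ⟶ L)
    (U : K ⊗ L ⟶ Y) : endι ε ≫ (α_ K Δ[1] Δ[1]).hom ≫ K ◁ S ≫ U =
      K ◁ (CartesianMonoidalCategory.lift (𝟙 _) (SSet.const (stdSimplex.obj₀Equiv.symm ε)) ≫ S) ≫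
        U := by
  apply NatTrans.ext
  funext d
  apply ConcreteCategory.hom_ext
  intro x
  rfl

omit [Quasicategory Y] in
lemma whiskerLeft_const_comp {ε : Fin 2} {L : SSet.{u}} (S : Δ[1] ⟶ L) (U : K ⊗ L ⟶ Y) :
    K ◁ (SSet.const (X := Δ[1]) (stdSimplex.obj₀Equiv.symm ε) ≫ S) ≫ U =
      CartesianMonoidalCategory.fst _ _ ≫ endι ε ≫ K ◁ S ≫ U := by
  apply NatTrans.ext
  funext d
  apply ConcreteCategory.hom_ext
  intro x
  rfl

omit [Quasicategory Y] in
lemma whiskerRight_fst_assoc {K' : SSet.{u}} (i : K' ⟶ K) (f : K ⟶ Y) :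
    i ▷ Δ[1] ≫ CartesianMonoidalCategory.fst _ _ ≫ f =
      CartesianMonoidalCategory.fst _ _ ≫ i ≫ f := by
  apply NatTrans.ext
  funext d
  apply ConcreteCategory.hom_ext
  intro x
  rfl

lemma lift_zero_squareToTriangle :
    CartesianMonoidalCategory.lift (SSet.const (stdSimplex.obj₀Equiv.symm 0)) (𝟙 _) ≫
      squareToTriangle.{u} = stdSimplex.δ 2 := by
  apply SSet.yonedaEquiv.injective
  decide

lemma lift_one_squareToTriangle :
    CartesianMonoidalCategory.lift (SSet.const (stdSimplex.obj₀Equiv.symm 1)) (𝟙 _) ≫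
      squareToTriangle.{u} = SSet.const (stdSimplex.obj₀Equiv.symm 1) ≫ stdSimplex.δ 0 := by
  apply SSet.yonedaEquiv.injective
  decide

lemma lift_squareToTriangle_zero :
    CartesianMonoidalCategory.lift (𝟙 _) (SSet.const (stdSimplex.obj₀Equiv.symm 0)) ≫
      squareToTriangle.{u} = stdSimplex.δ 1 := by
  apply SSet.yonedaEquiv.injective
  decide

lemma lift_squareToTriangle_one :
    CartesianMonoidalCategory.lift (𝟙 _) (SSet.const (stdSimplex.obj₀Equiv.symm 1)) ≫
      squareToTriangle.{u} = stdSimplex.δ 0 := by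
  apply SSet.yonedaEquiv.injective
  decide

/-- The triangle which exhibits a left inverse of a natural transformation. -/
lemma exists_triangle {h : K ⊗ Δ[1] ⟶ Y} (hh : PtInv h) :
    ∃ U : K ⊗ Δ[2] ⟶ Y, PtInv (K ◁ stdSimplex.δ 2 ≫ U) ∧ K ◁ stdSimplex.δ 0 ≫ U = h ∧
      K ◁ stdSimplex.δ 1 ≫ U = CartesianMonoidalCategory.fst _ _ ≫ ι₁ ≫ h := by
  obtain ⟨i⟩ := (isEquivalence_natEdge_iff (h₀ := rfl) (h₁ := rfl)).2 hh
  let U : K ⊗ Δ[2] ⟶ Y := MonoidalClosed.uncurry (SSet.yonedaEquiv.symm i.invHomId.simplex)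
  have hU (j : Fin 3) : natSimplex (K ◁ stdSimplex.δ j ≫ U) =
      SimplicialObject.δ ((ihom K).obj Y) j i.invHomId.simplex := by
    rw [natSimplex, MonoidalClosed.curry_natural_left, MonoidalClosed.curry_uncurry,
      yonedaEquiv_δ_comp, Equiv.apply_symm_apply]
  refine ⟨U, ?_, natSimplex_injective ((hU 0).trans i.invHomId.d₀),
    natSimplex_injective ((hU 1).trans (i.invHomId.d₁.trans (σ_funObj _)))⟩
  rw [← isInv_natSimplex_iff, hU 2, i.invHomId.d₂, ← isEquivalence_iff_isInv]
  exact ⟨i.invStructInv⟩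

omit [Quasicategory Y] in
lemma exists_square_of_triangle (U : K ⊗ Δ[2] ⟶ Y) {f : K ⟶ Y}
    (h₁ : K ◁ stdSimplex.δ 1 ≫ U = CartesianMonoidalCategory.fst _ _ ≫ f)
    (hf : ι₁ ≫ K ◁ stdSimplex.δ 0 ≫ U = f) :
    ∃ H : (K ⊗ Δ[1]) ⊗ Δ[1] ⟶ Y, ι₀ ▷ Δ[1] ≫ H = K ◁ stdSimplex.δ 2 ≫ U ∧
      ι₁ ▷ Δ[1] ≫ H = CartesianMonoidalCategory.fst _ _ ≫ f ∧
      ι₀ ≫ H = CartesianMonoidalCategory.fst _ _ ≫ f ∧ ι₁ ≫ H = K ◁ stdSimplex.δ 0 ≫ U := by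
  refine ⟨(α_ _ _ _).hom ≫ K ◁ squareToTriangle ≫ U, ?_, ?_, ?_, ?_⟩
  · exact (endι_whiskerRight_associator (ε := 0) squareToTriangle U).trans
      congr(K ◁ $lift_zero_squareToTriangle ≫ U)
  · exact (endι_whiskerRight_associator (ε := 1) squareToTriangle U).trans
      (congr(K ◁ $lift_one_squareToTriangle ≫ U).trans
        ((whiskerLeft_const_comp (ε := 1) (stdSimplex.δ 0) U).trans
          congr(CartesianMonoidalCategory.fst _ _ ≫ $hf)))
  · exact (endι_associator (ε := 0) squareToTriangle U).trans
      (congr(K ◁ $lift_squareToTriangle_zero ≫ U).trans h₁)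
  · exact (endι_associator (ε := 1) squareToTriangle U).trans
      congr(K ◁ $lift_squareToTriangle_one ≫ U)

/-- The case of a prescribed target is reduced to that of a prescribed source. Above A, choose an
inverse of h with a triangle witnessing it. The inverse starts at f, so it extends over B to some K.
Extend the square made from the triangle over B, with sides K and the constant transformation. Its
far edge ends at f and restricts to h. -/
theorem hasExtension_one (Y : SSet.{u}) [Quasicategory Y] : HasExtension 1 Y := by
  intro B A f h w hh
  obtain ⟨U, hU₂, hU₀, hU₁⟩ := exists_triangle hh
  have w' : ι₁ ≫ (A : SSet) ◁ stdSimplex.δ 0 ≫ U = A.ι ≫ f := by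
    rw [← w, hU₀, endι_one]
  obtain ⟨hA, hA₀, hA₁, hA₂, hA₃⟩ := exists_square_of_triangle U (f := A.ι ≫ f)
    (by rw [hU₁, ← w, endι_one]) w'
  have k₀ : endι 0 ≫ (A : SSet) ◁ stdSimplex.δ 2 ≫ U = A.ι ≫ f := by
    rw [← hA₀, endι_zero, ι₀_comp_assoc, hA₂]
    exact ι₀_fst_comp _
  obtain ⟨K, hK₁, hK₂, hK₃⟩ := hasExtension_zero Y A f _ k₀ hU₂
  obtain ⟨H, hH, hH₀, hH₁, hH₃⟩ := (hasExtension_zero Y).exists_box A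
    (CartesianMonoidalCategory.fst _ _ ≫ f) hA K (CartesianMonoidalCategory.fst _ _ ≫ f) hK₁
    (ptInv_fst_comp _) (hA₀.trans hK₃.symm) (hA₁.trans (whiskerRight_fst_assoc _ _).symm)
    (hK₂.trans (ι₀_fst_comp f).symm) ((ι₀_fst_comp f).trans (ι₁_fst_comp f).symm)
    (hA₂.trans (whiskerRight_fst_assoc _ _).symm)
  have w₀ : ι₀ ≫ ι₁ ≫ H = ι₁ ≫ K := by
    rw [ι₀_ι₁_comp, hH₀]
  have w₁ : ι₁ ≫ ι₁ ≫ H = f := by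
    rw [ι₁_ι₁_comp, hH₁, ι₁_fst_comp]
  refine ⟨ι₁ ≫ H, ptInv_of_fac hK₁ (natEdge_square_fac_of_right H hH₀ hH hH₁ hK₂ rfl w₀ w₁),
    w₁, ?_⟩
  rw [← hU₀, ← hA₃, ← hH₃, ι₁_comp_assoc]

end Box

end InftyCat

namespace InftyCat

open SSet Opposite

/-! ### Homotopies in mapping spaces and transport along equivalences. -/

section MapSpace

variable {X : SSet.{u}} {x y : X _⦋0⦌} {B : SSet.{u}}

/-- A map to a mapping space, seen as a natural transformation. -/
def mapSpaceUncurry (f : B ⟶ mapSpace X x y) : B ⊗ Δ[1] ⟶ X :=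
  uncurryFamily (fun _ b ↦ (f.app _ b).1)
    (fun _ _ g b ↦ congrArg Subtype.val (ConcreteCategory.congr_hom (f.naturality g.op) b))

lemma whiskerRight_mapSpaceUncurry (f : B ⟶ mapSpace X x y) {n : SimplexCategory}
    (b : B.obj (op n)) :
    SSet.yonedaEquiv.symm b ▷ Δ[1] ≫ mapSpaceUncurry f = (f.app _ b).1 :=
  whiskerRight_uncurryFamily _ _ _

lemma comp_mapSpaceUncurry {B' : SSet.{u}} (g : B' ⟶ B) (f : B ⟶ mapSpace X x y) :
    g ▷ Δ[1] ≫ mapSpaceUncurry f = mapSpaceUncurry (g ≫ f) := rfl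

lemma ι₀_mapSpaceUncurry (f : B ⟶ mapSpace X x y) :
    ι₀ ≫ mapSpaceUncurry f = SSet.const x := by
  apply NatTrans.ext
  funext d
  apply ConcreteCategory.hom_ext
  intro b
  exact app_congr (f.app d b).2.1 d (stdSimplex.objEquiv.symm (𝟙 _))

lemma ι₁_mapSpaceUncurry (f : B ⟶ mapSpace X x y) :
    ι₁ ≫ mapSpaceUncurry f = SSet.const y := by
  apply NatTrans.ext
  funext d
  apply ConcreteCategory.hom_ext
  intro b
  exact app_congr (f.app d b).2.2 d (stdSimplex.objEquiv.symm (𝟙 _))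

/-- The inverse of `mapSpaceUncurry`. -/
def mapSpaceCurry (h : B ⊗ Δ[1] ⟶ X) (h₀ : ι₀ ≫ h = SSet.const x) (h₁ : ι₁ ≫ h = SSet.const y) :
    B ⟶ mapSpace X x y where
  app d := ↾fun b ↦ ⟨(SSet.yonedaEquiv (n := d.unop)).symm b ▷ Δ[1] ≫ h, by
    rw [ι₀_comp_assoc, h₀, comp_const], by rw [ι₁_comp_assoc, h₁, comp_const]⟩
  naturality d d' f := by
    apply ConcreteCategory.hom_ext
    intro b
    apply Subtype.ext
    have := yonedaEquiv_symm_naturality_left f.unop b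
    show (SSet.yonedaEquiv (n := d'.unop)).symm (B.map f b) ▷ Δ[1] ≫ h =
      SSet.stdSimplex.map f.unop ▷ Δ[1] ≫ (SSet.yonedaEquiv (n := d.unop)).symm b ▷ Δ[1] ≫ h
    erw [← comp_whiskerRight_assoc, this]
    rfl

lemma mapSpaceUncurry_mapSpaceCurry (h : B ⊗ Δ[1] ⟶ X) (h₀ : ι₀ ≫ h = SSet.const x)
    (h₁ : ι₁ ≫ h = SSet.const y) : mapSpaceUncurry (mapSpaceCurry h h₀ h₁) = h := by
  apply tensor_hom_ext
  intro n b
  rw [whiskerRight_mapSpaceUncurry]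
  rfl

lemma mapSpaceUncurry_injective {f g : B ⟶ mapSpace X x y}
    (h : mapSpaceUncurry f = mapSpaceUncurry g) : f = g := by
  apply NatTrans.ext
  funext d
  apply ConcreteCategory.hom_ext
  intro b
  apply Subtype.ext
  have h₁ := whiskerRight_mapSpaceUncurry f (n := d.unop) b
  rw [h] at h₁
  exact h₁.symm.trans (whiskerRight_mapSpaceUncurry g (n := d.unop) b)

lemma mapSpaceUncurry_comp_mapSpaceMap {Y : SSet.{u}} (F : X ⟶ Y) (f : B ⟶ mapSpace X x y) :
    mapSpaceUncurry (f ≫ mapSpaceMap F x y) = mapSpaceUncurry f ≫ F := by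
  apply NatTrans.ext
  funext d
  apply ConcreteCategory.hom_ext
  intro b
  rfl

/-- The map `Δ[1] ⟶ X` given by an edge. -/
noncomputable def edgeHom (e : X.Edge x y) : Δ[1] ⟶ X := SSet.yonedaEquiv.symm e.edge

lemma edgeHom_app_id (e : X.Edge x y) :
    (edgeHom e).app _ (stdSimplex.objEquiv.symm (𝟙 (⦋1⦌ : SimplexCategory))) = e.edge :=
  ConcreteCategory.congr_hom (X.map_id _) e.edge

lemma const_comp_edgeHom_zero (e : X.Edge x y) :
    (SSet.const (stdSimplex.obj₀Equiv.symm 0) : B ⟶ _) ≫ edgeHom e = SSet.const x := by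
  refine (const_comp _ _).trans (congrArg SSet.const (Eq.trans ?_ e.src_eq))
  rw [← edgeHom_app_id, ← app_δ]
  refine congrArg ((edgeHom e).app _) ?_
  apply asOrderHom_ext
  intro i
  obtain rfl : i = 0 := Subsingleton.elim (α := Fin 1) _ _
  rfl

lemma const_comp_edgeHom_one (e : X.Edge x y) :
    (SSet.const (stdSimplex.obj₀Equiv.symm 1) : B ⟶ _) ≫ edgeHom e = SSet.const y := by
  refine (const_comp _ _).trans (congrArg SSet.const (Eq.trans ?_ e.tgt_eq))
  rw [← edgeHom_app_id, ← app_δ]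
  refine congrArg ((edgeHom e).app _) ?_
  apply asOrderHom_ext
  intro i
  obtain rfl : i = 0 := Subsingleton.elim (α := Fin 1) _ _
  rfl

/-- The constant natural transformation given by an edge. -/
noncomputable def constEdge (B : SSet.{u}) (e : X.Edge x y) : B ⊗ Δ[1] ⟶ X :=
  CartesianMonoidalCategory.snd B Δ[1] ≫ edgeHom e

lemma ι₀_constEdge (e : X.Edge x y) : ι₀ ≫ constEdge B e = SSet.const x :=
  const_comp_edgeHom_zero e

lemma ι₁_constEdge (e : X.Edge x y) : ι₁ ≫ constEdge B e = SSet.const y :=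
  const_comp_edgeHom_one e

lemma whiskerRight_constEdge {B' : SSet.{u}} (f : B' ⟶ B) (e : X.Edge x y) :
    f ▷ Δ[1] ≫ constEdge B e = constEdge B' e := by
  apply NatTrans.ext
  funext d
  apply ConcreteCategory.hom_ext
  intro b
  rfl

lemma ptInv_constEdge {e : X.Edge x y} (he : IsEquivalence e) : PtInv (constEdge B e) := fun b ↦ by
  rw [isEquivalence_iff_isInv, ← edgeHom_app_id] at he
  exact he

lemma constEdge_comp {Y : SSet.{u}} (e : X.Edge x y) (F : X ⟶ Y) :
    constEdge B e ≫ F = constEdge B (e.map F) := by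
  apply NatTrans.ext
  funext d
  apply ConcreteCategory.hom_ext
  intro b
  exact (app_map F _ e.edge)

lemma constEdge_id (x : X _⦋0⦌) : constEdge B (Edge.id x) = SSet.const x := by
  apply NatTrans.ext
  funext d
  apply ConcreteCategory.hom_ext
  intro b
  refine (ConcreteCategory.congr_hom (X.map_comp _ _) x).symm.trans
    (congrArg (fun f ↦ X.map f x) (Quiver.Hom.unop_inj ?_))
  ext i : 3
  exact Subsingleton.elim (α := Fin 1) _ _

/-- A natural transformation between paths, whose ends are given by edges. -/
structure IsBox {x' y' : X _⦋0⦌} (e : X.Edge x x') (e' : X.Edge y y')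
    (P : (B ⊗ Δ[1]) ⊗ Δ[1] ⟶ X) : Prop where
  left : ι₀ ▷ Δ[1] ≫ P = constEdge B e
  right : ι₁ ▷ Δ[1] ≫ P = constEdge B e'

variable {x' y' : X _⦋0⦌} {e : X.Edge x x'} {e' : X.Edge y y'}

/-- Paths from x' to y' are transported backwards along the equivalences e and e'. -/
lemma exists_isBox_one [Quasicategory X] (he : IsEquivalence e) (he' : IsEquivalence e')
    (u : B ⊗ Δ[1] ⟶ X) (h₀ : ι₀ ≫ u = SSet.const x') (h₁ : ι₁ ≫ u = SSet.const y') :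
    ∃ P, IsBox e e' P ∧ ι₁ ≫ P = u := by
  obtain ⟨P, hP, hP₀, hP₁⟩ := (hasExtension_one X).exists_square u (constEdge B e)
    (constEdge B e') (ptInv_constEdge he) (ptInv_constEdge he') ((ι₁_constEdge e).trans h₀.symm)
    ((ι₁_constEdge e').trans h₁.symm)
  exact ⟨P, ⟨hP₀, hP₁⟩, hP⟩

lemma IsBox.whiskerRight {P : (B ⊗ Δ[1]) ⊗ Δ[1] ⟶ X} (hP : IsBox e e' P) {B' : SSet.{u}}
    (f : B' ⟶ B) : IsBox e e' ((f ▷ Δ[1]) ▷ Δ[1] ≫ P) where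
  left := by
    rw [← whiskerRight_constEdge f, ← hP.left]
    exact (comp_whiskerRight_assoc _ _ _ _).symm.trans (comp_whiskerRight_assoc f ι₀ Δ[1] P)
  right := by
    rw [← whiskerRight_constEdge f, ← hP.right]
    exact (comp_whiskerRight_assoc _ _ _ _).symm.trans (comp_whiskerRight_assoc f ι₁ Δ[1] P)

/-- Two maps to a mapping space are homotopic. -/
def MapHomotopic (x y : X _⦋0⦌) (u v : B ⊗ Δ[1] ⟶ X) : Prop :=
  ∃ P, IsBox (Edge.id x) (Edge.id y) P ∧ ι₀ ≫ P = u ∧ ι₁ ≫ P = v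

lemma isBox_fst (u : B ⊗ Δ[1] ⟶ X) (h₀ : ι₀ ≫ u = SSet.const x) (h₁ : ι₁ ≫ u = SSet.const y) :
    IsBox (Edge.id x) (Edge.id y) (CartesianMonoidalCategory.fst _ _ ≫ u) where
  left := by rw [constEdge_id, whiskerRight_fst_assoc, h₀, comp_const]
  right := by rw [constEdge_id, whiskerRight_fst_assoc, h₁, comp_const]

/-- The exchange of the two copies of the interval. -/
noncomputable def boxSwap (B : SSet.{u}) : (B ⊗ Δ[1]) ⊗ Δ[1] ⟶ (B ⊗ Δ[1]) ⊗ Δ[1] :=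
  CartesianMonoidalCategory.lift (CartesianMonoidalCategory.lift
    (CartesianMonoidalCategory.fst _ _ ≫ CartesianMonoidalCategory.fst _ _)
    (CartesianMonoidalCategory.snd _ _))
    (CartesianMonoidalCategory.fst _ _ ≫ CartesianMonoidalCategory.snd _ _)

lemma endι_boxSwap (ε : Fin 2) (P : (B ⊗ Δ[1]) ⊗ Δ[1] ⟶ X) :
    endι ε ≫ boxSwap B ≫ P = endι ε ▷ Δ[1] ≫ P := by
  apply NatTrans.ext
  funext d
  apply ConcreteCategory.hom_ext
  intro b
  rfl

lemma endι_whiskerRight_boxSwap (ε : Fin 2) (P : (B ⊗ Δ[1]) ⊗ Δ[1] ⟶ X) :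
    endι ε ▷ Δ[1] ≫ boxSwap B ≫ P = endι ε ≫ P := by
  apply NatTrans.ext
  funext d
  apply ConcreteCategory.hom_ext
  intro b
  rfl

lemma mapHomotopic_of_swap {u v : B ⊗ Δ[1] ⟶ X} (Q : (B ⊗ Δ[1]) ⊗ Δ[1] ⟶ X)
    (h₀ : ι₀ ▷ Δ[1] ≫ Q = u) (h₁ : ι₁ ▷ Δ[1] ≫ Q = v) (hx : ι₀ ≫ Q = SSet.const x)
    (hy : ι₁ ≫ Q = SSet.const y) : MapHomotopic x y u v :=
  ⟨boxSwap B ≫ Q, ⟨(endι_whiskerRight_boxSwap 0 Q).trans (hx.trans (constEdge_id x).symm),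
    (endι_whiskerRight_boxSwap 1 Q).trans (hy.trans (constEdge_id y).symm)⟩,
    (endι_boxSwap 0 Q).trans h₀, (endι_boxSwap 1 Q).trans h₁⟩

lemma mapHomotopic_iff {f g : B ⟶ mapSpace X x y} :
    MapHomotopic x y (mapSpaceUncurry f) (mapSpaceUncurry g) ↔ Nonempty (Homotopy f g) := by
  constructor
  · rintro ⟨P, hP, h₀, h₁⟩
    refine ⟨⟨mapSpaceCurry (boxSwap B ≫ P) ((endι_boxSwap 0 P).trans (hP.left.trans ?_))
      ((endι_boxSwap 1 P).trans (hP.right.trans ?_)), ?_, ?_, fromBot_ext⟩⟩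
    · exact constEdge_id x
    · exact constEdge_id y
    · apply mapSpaceUncurry_injective
      rw [← comp_mapSpaceUncurry]
      exact (congrArg (endι 0 ▷ Δ[1] ≫ ·) (mapSpaceUncurry_mapSpaceCurry _ _ _)).trans
        ((endι_whiskerRight_boxSwap 0 P).trans h₀)
    · apply mapSpaceUncurry_injective
      rw [← comp_mapSpaceUncurry]
      exact (congrArg (endι 1 ▷ Δ[1] ≫ ·) (mapSpaceUncurry_mapSpaceCurry _ _ _)).trans
        ((endι_whiskerRight_boxSwap 1 P).trans h₁)
  · rintro ⟨H⟩
    exact mapHomotopic_of_swap (mapSpaceUncurry H.h)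
      (by rw [comp_mapSpaceUncurry]; exact congrArg mapSpaceUncurry H.h₀)
      (by rw [comp_mapSpaceUncurry]; exact congrArg mapSpaceUncurry H.h₁)
      (ι₀_mapSpaceUncurry _) (ι₁_mapSpaceUncurry _)

lemma endι_comp_assoc (ε : Fin 2) {B' : SSet.{u}} (f : B' ⟶ B) (P : B ⊗ Δ[1] ⟶ X) :
    endι ε ≫ f ▷ Δ[1] ≫ P = f ≫ endι ε ≫ P := by
  apply NatTrans.ext
  funext d
  apply ConcreteCategory.hom_ext
  intro b
  rfl

lemma fromBot_ext' {L L' : SSet.{u}} {g g' : (((⊥ : B.Subcomplex) : SSet) ⊗ L) ⊗ L' ⟶ X} :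
    g = g' := by
  ext d x
  exact x.1.1.2.elim

/-- The boundary of a cube without the interiors of two opposite faces, glued from two boxes. -/
lemma exists_box_of_isBox {ε : Fin 2} (hX : HasExtension ε X) (he : IsEquivalence e)
    (he' : IsEquivalence e') {P P' : (B ⊗ Δ[1]) ⊗ Δ[1] ⟶ X} (hP : IsBox e e' P)
    (hP' : IsBox e e' P') (h : endι ε ≫ P = endι ε ≫ P') (η : Fin 2) :
    ∃ Q : (B ⊗ Δ[1]) ⊗ Δ[1] ⟶ X, ι₀ ▷ Δ[1] ≫ Q = endι η ≫ P ∧ ι₁ ▷ Δ[1] ≫ Q = endι η ≫ P' ∧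
      ι₀ ≫ Q = endι η ≫ constEdge _ e ∧ ι₁ ≫ Q = endι η ≫ constEdge _ e' := by
  let s : Fin 2 → ((B ⊗ Δ[1]) ⊗ Δ[1] ⟶ X) := ![P, P']
  have hs : ∀ i, IsBox e e' (s i) := Fin.forall_fin_two.2 ⟨hP, hP'⟩
  have hs' : ∀ i, endι ε ≫ s i = endι ε ≫ P := Fin.forall_fin_two.2 ⟨rfl, h.symm⟩
  -- The new interval interpolates between P and P'. Only its ends are glued, as A is empty, and L
  -- is the square on which P and P' live.
  obtain ⟨g, hg, -⟩ := exists_openBox_desc (⊥ : B.Subcomplex) (L := Δ[1] ⊗ Δ[1])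
    ((α_ _ _ _).inv ≫ CartesianMonoidalCategory.fst _ _ ≫
      fromBot B X) (fun i ↦ (α_ _ _ _).inv ≫ s i) (fun _ ↦ fromBot_ext)
  let A : (B ⊗ Δ[1] : SSet.{u}).Subcomplex := openBox ⊥
  let h : ((A : SSet) ⊗ Δ[1]) ⊗ Δ[1] ⟶ X := (α_ _ _ _).hom ≫ g
  have hh (i : Fin 2) : (openBoxEnd ⊥ i ▷ Δ[1]) ▷ Δ[1] ≫ h = s i := by
    rw [← cancel_epi (α_ _ _ _).inv]
    exact hg i
  have w₀ : ι₀ ▷ Δ[1] ≫ h = A.ι ▷ Δ[1] ≫ constEdge _ e := by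
    refine openBox_hom_ext (fun i ↦ ?_) fromBot_ext'
    rw [← comp_whiskerRight_assoc, ← comp_whiskerRight_assoc, ← ι₀_comp, comp_whiskerRight_assoc,
      hh, (hs i).left, whiskerRight_constEdge]
  have w₁ : ι₁ ▷ Δ[1] ≫ h = A.ι ▷ Δ[1] ≫ constEdge _ e' := by
    refine openBox_hom_ext (fun i ↦ ?_) fromBot_ext'
    rw [← comp_whiskerRight_assoc, ← comp_whiskerRight_assoc, ← ι₁_comp, comp_whiskerRight_assoc,
      hh, (hs i).right, whiskerRight_constEdge]
  -- On the face where P and P' agree, the interpolation is taken constant.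
  let f : (B ⊗ Δ[1]) ⊗ Δ[1] ⟶ X := CartesianMonoidalCategory.fst _ _ ▷ Δ[1] ≫ endι ε ≫ P
  have w₂ : endι ε ≫ h = A.ι ▷ Δ[1] ≫ f := by
    refine openBox_hom_ext (fun i ↦ ?_) fromBot_ext'
    refine (endι_comp_assoc _ _ _).symm.trans ((congrArg (endι ε ≫ ·) (hh i)).trans
      ((hs' i).trans ?_))
    apply NatTrans.ext
    funext d
    apply ConcreteCategory.hom_ext
    intro b
    rfl
  have wf₀ : endι ε ≫ constEdge _ e = ι₀ ≫ f := by
    refine Eq.trans ?_ congr(CartesianMonoidalCategory.fst B Δ[1] ≫ endι ε ≫ $hP.left.symm)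
    apply NatTrans.ext
    funext d
    apply ConcreteCategory.hom_ext
    intro b
    rfl
  have wf₁ : endι ε ≫ constEdge _ e' = ι₁ ≫ f := by
    refine Eq.trans ?_ congr(CartesianMonoidalCategory.fst B Δ[1] ≫ endι ε ≫ $hP.right.symm)
    apply NatTrans.ext
    funext d
    apply ConcreteCategory.hom_ext
    intro b
    rfl
  obtain ⟨H, hH, hH₀, hH₁, hH₂⟩ := hX.exists_box A f h (constEdge _ e) (constEdge _ e')
    (ptInv_constEdge he) (ptInv_constEdge he') w₀ w₁ wf₀ wf₁ w₂
  have hH' (i : Fin 2) : (endι i ▷ Δ[1]) ▷ Δ[1] ≫ H = s i := by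
    rw [← hh, ← hH₂, ← comp_whiskerRight_assoc, ← comp_whiskerRight, openBoxEnd_ι]
  exact ⟨endι η ≫ H,
    (endι_comp_assoc _ _ _).symm.trans (congrArg (endι η ≫ ·) (hH' 0)),
    (endι_comp_assoc _ _ _).symm.trans (congrArg (endι η ≫ ·) (hH' 1)),
    (endι_comp_assoc _ _ _).symm.trans (congrArg (endι η ≫ ·) hH₀),
    (endι_comp_assoc _ _ _).symm.trans (congrArg (endι η ≫ ·) hH₁)⟩

/-- Uniqueness of transport: two boxes along equivalences with the same initial path have homotopic
final paths. The interpolating cube exists because e and e' are invertible. -/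
lemma mapHomotopic_of_ι₀_eq [Quasicategory X] (he : IsEquivalence e) (he' : IsEquivalence e')
    {P P' : (B ⊗ Δ[1]) ⊗ Δ[1] ⟶ X} (hP : IsBox e e' P) (hP' : IsBox e e' P')
    (h : ι₀ ≫ P = ι₀ ≫ P') : MapHomotopic x' y' (ι₁ ≫ P) (ι₁ ≫ P') := by
  obtain ⟨Q, h₀, h₁, hx, hy⟩ := exists_box_of_isBox (ε := 0) (hasExtension_zero X) he he' hP hP' h 1
  exact mapHomotopic_of_swap Q h₀ h₁ (hx.trans (ι₁_constEdge e)) (hy.trans (ι₁_constEdge e'))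

lemma mapHomotopic_of_ι₁_eq [Quasicategory X] (he : IsEquivalence e) (he' : IsEquivalence e')
    {P P' : (B ⊗ Δ[1]) ⊗ Δ[1] ⟶ X} (hP : IsBox e e' P) (hP' : IsBox e e' P')
    (h : ι₁ ≫ P = ι₁ ≫ P') : MapHomotopic x y (ι₀ ≫ P) (ι₀ ≫ P') := by
  obtain ⟨Q, h₀, h₁, hx, hy⟩ := exists_box_of_isBox (ε := 1) (hasExtension_one X) he he' hP hP' h 0
  exact mapHomotopic_of_swap Q h₀ h₁ (hx.trans (ι₀_constEdge e)) (hy.trans (ι₀_constEdge e'))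

lemma mapHomotopic_refl (u : B ⊗ Δ[1] ⟶ X) (h₀ : ι₀ ≫ u = SSet.const x)
    (h₁ : ι₁ ≫ u = SSet.const y) : MapHomotopic x y u u :=
  ⟨_, isBox_fst u h₀ h₁, ι₀_fst_comp u, ι₁_fst_comp u⟩

/-- A homotopy is a box along identities, so this is uniqueness of transport along identities. With
reflexivity it makes homotopy an equivalence relation without any composition of homotopies. -/
lemma MapHomotopic.euclidean [Quasicategory X] {u v w : B ⊗ Δ[1] ⟶ X} (h : MapHomotopic x y u v)
    (h' : MapHomotopic x y u w) : MapHomotopic x y v w := by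
  obtain ⟨P, hP, h₀, rfl⟩ := h
  obtain ⟨P', hP', h₀', rfl⟩ := h'
  exact mapHomotopic_of_ι₀_eq (isEquivalence_id x) (isEquivalence_id y) hP hP' (h₀.trans h₀'.symm)

/-- The homotopy relation between maps to a mapping space. -/
def Htpc (f g : B ⟶ mapSpace X x y) : Prop := Nonempty (Homotopy f g)

lemma Htpc.refl (f : B ⟶ mapSpace X x y) : Htpc f f :=
  mapHomotopic_iff.1 (mapHomotopic_refl _ (ι₀_mapSpaceUncurry f) (ι₁_mapSpaceUncurry f))

lemma Htpc.symm [Quasicategory X] {f g : B ⟶ mapSpace X x y} (h : Htpc f g) : Htpc g f :=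
  mapHomotopic_iff.1 ((mapHomotopic_iff.2 h).euclidean (mapHomotopic_iff.2 (Htpc.refl f)))

lemma Htpc.trans [Quasicategory X] {f g h : B ⟶ mapSpace X x y} (h₁ : Htpc f g)
    (h₂ : Htpc g h) : Htpc f h :=
  mapHomotopic_iff.1 ((mapHomotopic_iff.2 h₁.symm).euclidean (mapHomotopic_iff.2 h₂))

lemma Htpc.whiskerLeft {f g : B ⟶ mapSpace X x y} (h : Htpc f g) {B' : SSet.{u}} (p : B' ⟶ B) :
    Htpc (p ≫ f) (p ≫ g) := by
  obtain ⟨H⟩ := h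
  refine ⟨⟨p ▷ Δ[1] ≫ H.h, ?_, ?_, fromBot_ext⟩⟩
  · exact (ι₀_comp_assoc _ _).trans (congrArg (p ≫ ·) H.h₀)
  · exact (ι₁_comp_assoc _ _).trans (congrArg (p ≫ ·) H.h₁)

lemma Htpc.whiskerRight {f g : B ⟶ mapSpace X x y} (h : Htpc f g) {Z : SSet.{u}} {z z' : Z _⦋0⦌}
    (p : mapSpace X x y ⟶ mapSpace Z z z') : Htpc (f ≫ p) (g ≫ p) := by
  obtain ⟨H⟩ := h
  refine ⟨⟨H.h ≫ p, ?_, ?_, fromBot_ext⟩⟩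
  · exact (Category.assoc _ _ _).symm.trans (congrArg (· ≫ p) H.h₀)
  · exact (Category.assoc _ _ _).symm.trans (congrArg (· ≫ p) H.h₁)

/-- A case of the two-out-of-six property of homotopy equivalences. -/
lemma isHomotopyEquiv_of_two_out_of_six {X₁ X₂ X₃ X₄ : SSet.{u}} [Quasicategory X₁]
    [Quasicategory X₂] [Quasicategory X₃] [Quasicategory X₄]
    {x₁ y₁ : X₁ _⦋0⦌} {x₂ y₂ : X₂ _⦋0⦌} {x₃ y₃ : X₃ _⦋0⦌} {x₄ y₄ : X₄ _⦋0⦌}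
    (f : mapSpace X₁ x₁ y₁ ⟶ mapSpace X₂ x₂ y₂) (g : mapSpace X₂ x₂ y₂ ⟶ mapSpace X₃ x₃ y₃)
    (h : mapSpace X₃ x₃ y₃ ⟶ mapSpace X₄ x₄ y₄) (hfg : IsHomotopyEquiv (f ≫ g))
    (hgh : IsHomotopyEquiv (g ≫ h)) : IsHomotopyEquiv f := by
  obtain ⟨p, hp₁, hp₂⟩ := hfg
  obtain ⟨q, hq₁, hq₂⟩ := hgh
  rw [Category.assoc] at hp₁ hq₁
  have h₁ : Htpc (f ≫ g ≫ p) (𝟙 _) := hp₁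
  have h₂ : Htpc (p ≫ f ≫ g) (𝟙 _) := hp₂
  have h₃ : Htpc (g ≫ h ≫ q) (𝟙 _) := hq₁
  refine ⟨g ≫ p, h₁, ?_⟩
  -- The chain is gpf ∼ gpf(ghq) = g(pfg)hq ∼ ghq ∼ 1, written in diagrammatic order.
  have h₄ := (h₂.whiskerRight (h ≫ q)).whiskerLeft g
  have h₅ := h₃.whiskerLeft (g ≫ p ≫ f)
  simp only [Category.assoc, Category.id_comp, Category.comp_id] at h₄ h₅ ⊢
  exact h₅.symm.trans (h₄.trans h₃)

lemma const_whiskerRight_comp {Y : SSet.{u}} {f g : X ⟶ Y} (H : X ⊗ Δ[1] ⟶ Y) (H₀ : ι₀ ≫ H = f)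
    (H₁ : ι₁ ≫ H = g) (x : X _⦋0⦌) :
    (SSet.const x : B ⟶ _) ▷ Δ[1] ≫ H = constEdge B (component H H₀ H₁ x) := by
  apply NatTrans.ext
  funext d
  apply ConcreteCategory.hom_ext
  intro b
  refine Eq.trans ?_ (app_map H (stdSimplex.objEquiv b.2).op (vEdge x))
  refine congrArg (H.app d) (Prod.ext ?_ ?_)
  · refine Eq.trans (congrArg (fun f ↦ X.map f x) (Quiver.Hom.unop_inj ?_))
      (ConcreteCategory.congr_hom (X.map_comp _ _) x)
    ext i : 3
    exact Subsingleton.elim (α := Fin 1) _ _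
  · exact (congrArg stdSimplex.objEquiv.symm (Category.comp_id (stdSimplex.objEquiv b.2))).symm

/-- If `g` is related to the identity by a natural transformation which is invertible at two
objects, then it induces an equivalence between mapping spaces. -/
theorem isHomotopyEquiv_mapSpaceMap [Quasicategory X] {g : X ⟶ X} (H : X ⊗ Δ[1] ⟶ X)
    (H₀ : ι₀ ≫ H = 𝟙 X) (H₁ : ι₁ ≫ H = g) (x y : X _⦋0⦌) (hx : IsInv (H.app _ (vEdge x)))
    (hy : IsInv (H.app _ (vEdge y))) : IsHomotopyEquiv (mapSpaceMap g x y) := by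
  let e : X.Edge x (g.app _ x) := component H H₀ H₁ x
  let e' : X.Edge y (g.app _ y) := component H H₀ H₁ y
  have he : IsEquivalence e := (isEquivalence_iff_isInv _).2 hx
  have he' : IsEquivalence e' := (isEquivalence_iff_isInv _).2 hy
  have he₁ {B : SSet.{u}} : (SSet.const x : B ⟶ _) ▷ Δ[1] ≫ H = constEdge B e :=
    const_whiskerRight_comp H H₀ H₁ x
  have he₁' {B : SSet.{u}} : (SSet.const y : B ⟶ _) ▷ Δ[1] ≫ H = constEdge B e' :=
    const_whiskerRight_comp H H₀ H₁ y
  have hbox {B : SSet.{u}} (u : B ⊗ Δ[1] ⟶ X) (h₀ : ι₀ ≫ u = SSet.const x)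
      (h₁ : ι₁ ≫ u = SSet.const y) : IsBox e e' (u ▷ Δ[1] ≫ H) := by
    constructor
    · rw [← he₁, ← h₀, comp_whiskerRight, Category.assoc]
    · rw [← he₁', ← h₁, comp_whiskerRight, Category.assoc]
  have hbox₀ {B : SSet.{u}} (u : B ⊗ Δ[1] ⟶ X) : ι₀ ≫ u ▷ Δ[1] ≫ H = u := by
    rw [ι₀_comp_assoc, H₀, Category.comp_id]
  have hbox₁ {B : SSet.{u}} (u : B ⊗ Δ[1] ⟶ X) : ι₁ ≫ u ▷ Δ[1] ≫ H = u ≫ g := by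
    rw [ι₁_comp_assoc, H₁]
  -- The universal path from g(x) to g(y). Transporting it back along the components of H defines
  -- the homotopy inverse c in one step; both homotopies then come from uniqueness of transport.
  let m := mapSpaceUncurry (𝟙 (mapSpace X (g.app _ x) (g.app _ y)))
  obtain ⟨P, hP, hP₁⟩ := exists_isBox_one he he' m (ι₀_mapSpaceUncurry _) (ι₁_mapSpaceUncurry _)
  have hc₀ : ι₀ ≫ ι₀ ≫ P = SSet.const x := by
    rw [← ι₀_constEdge e, ← hP.left, ι₀_comp_assoc]
  have hc₁ : ι₁ ≫ ι₀ ≫ P = SSet.const y := by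
    rw [← ι₀_constEdge e', ← hP.right, ι₀_comp_assoc]
  let c : mapSpace X (g.app _ x) (g.app _ y) ⟶ mapSpace X x y := mapSpaceCurry (ι₀ ≫ P) hc₀ hc₁
  have hc : mapSpaceUncurry c = ι₀ ≫ P := mapSpaceUncurry_mapSpaceCurry _ _ _
  refine ⟨c, mapHomotopic_iff.1 ?_, mapHomotopic_iff.1 ?_⟩
  · let n := mapSpaceUncurry (𝟙 (mapSpace X x y))
    have := mapHomotopic_of_ι₁_eq he he' (hP.whiskerRight (mapSpaceMap g x y))
      (hbox n (ι₀_mapSpaceUncurry _) (ι₁_mapSpaceUncurry _)) (by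
        rw [hbox₁, ι₁_comp_assoc, hP₁, comp_mapSpaceUncurry, Category.comp_id,
          ← mapSpaceUncurry_comp_mapSpaceMap, Category.id_comp])
    rwa [hbox₀, ι₀_comp_assoc, ← hc, comp_mapSpaceUncurry] at this
  · have := mapHomotopic_of_ι₀_eq he he' (hbox _ hc₀ hc₁) hP (hbox₀ _)
    rwa [hbox₁, hP₁, ← hc, ← mapSpaceUncurry_comp_mapSpaceMap] at this

end MapSpace

end InftyCat

namespace InftyCat

open SSet Opposite

/-! ### Fully faithful functors and localizations -/

section FullyFaithful

variable {X : SSet.{u}} {x y z : X _⦋0⦌}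

lemma const_app_zero (x : X _⦋0⦌) {B : SSet.{u}} (b : B _⦋0⦌) :
    (SSet.const x : B ⟶ X).app _ b = x := by
  refine Eq.trans (congrArg (fun f ↦ X.map f x) (Quiver.Hom.unop_inj ?_))
    (ConcreteCategory.congr_hom (X.map_id _) x)
  ext i : 3
  exact Subsingleton.elim (α := Fin 1) _ _

lemma eq_const_of_Δ₀ {d : SimplexCategoryᵒᵖ} (p q : (Δ[0] : SSet.{u}).obj d) : p = q :=
  asOrderHom_ext fun _ ↦ Subsingleton.elim (α := Fin 1) _ _

/-- The vertex of a mapping space given by an edge. -/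
noncomputable def edgeVertex (e : X.Edge x y) : Δ[0] ⟶ mapSpace X x y :=
  mapSpaceCurry (constEdge Δ[0] e) (ι₀_constEdge e) (ι₁_constEdge e)

lemma mapSpaceUncurry_edgeVertex (e : X.Edge x y) :
    mapSpaceUncurry (edgeVertex e) = constEdge Δ[0] e :=
  mapSpaceUncurry_mapSpaceCurry _ _ _

lemma exists_edge (v : Δ[0] ⟶ mapSpace X x y) : ∃ e : X.Edge x y, v = edgeVertex e := by
  let u := mapSpaceUncurry v
  let pt : (Δ[0] : SSet.{u}) _⦋0⦌ := stdSimplex.objEquiv.symm (𝟙 _)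
  let c := component u (ι₀_mapSpaceUncurry v) (ι₁_mapSpaceUncurry v) pt
  refine ⟨Edge.mk c.edge (c.src_eq.trans (const_app_zero x pt))
    (c.tgt_eq.trans (const_app_zero y pt)), ?_⟩
  apply mapSpaceUncurry_injective
  rw [mapSpaceUncurry_edgeVertex]
  apply NatTrans.ext
  funext d
  apply ConcreteCategory.hom_ext
  intro b
  refine Eq.trans ?_ (app_map u (stdSimplex.objEquiv b.2).op (vEdge pt))
  refine congrArg (u.app d) (Prod.ext (eq_const_of_Δ₀ _ _) ?_)
  exact (congrArg stdSimplex.objEquiv.symm (Category.comp_id (stdSimplex.objEquiv b.2))).symm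

/-- A triangle with an identity as its first edge is collapsed from a square, which gives the
homotopy. -/
lemma mapHomotopic_constEdge_of_hoHom_eq [Quasicategory X] {e e' : X.Edge x y}
    (h : hoHom e = hoHom e') : MapHomotopic x y (constEdge Δ[0] e) (constEdge Δ[0] e') := by
  obtain ⟨s⟩ := nonempty_compStruct_iff.2
    (show hoHom (Edge.id x) ≫ hoHom e' = hoHom e by rw [h, hoHom_id, Category.id_comp])
  let S : Δ[2] ⟶ X := SSet.yonedaEquiv.symm s.simplex
  have hS₀ : stdSimplex.δ 0 ≫ S = edgeHom e' :=
    (stdSimplex_δ_comp_yonedaEquiv_symm _ _).trans (congrArg SSet.yonedaEquiv.symm s.d₀)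
  have hS₁ : stdSimplex.δ 1 ≫ S = edgeHom e :=
    (stdSimplex_δ_comp_yonedaEquiv_symm _ _).trans (congrArg SSet.yonedaEquiv.symm s.d₁)
  have hS₂ : stdSimplex.δ 2 ≫ S = edgeHom (Edge.id x) :=
    (stdSimplex_δ_comp_yonedaEquiv_symm _ _).trans (congrArg SSet.yonedaEquiv.symm s.d₂)
  let p : (Δ[0] ⊗ Δ[1]) ⊗ Δ[1] ⟶ (Δ[1] ⊗ Δ[1] : SSet.{u}) := CartesianMonoidalCategory.lift
    (CartesianMonoidalCategory.snd _ _)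
    (CartesianMonoidalCategory.fst _ _ ≫ CartesianMonoidalCategory.snd _ _)
  refine mapHomotopic_of_swap (p ≫ squareToTriangle ≫ S) ?_ ?_ ?_ ?_
  · rw [constEdge, ← hS₁, ← lift_squareToTriangle_zero]
    apply NatTrans.ext
    funext d
    apply ConcreteCategory.hom_ext
    intro b
    rfl
  · rw [constEdge, ← hS₀, ← lift_squareToTriangle_one]
    apply NatTrans.ext
    funext d
    apply ConcreteCategory.hom_ext
    intro b
    rfl
  · rw [← constEdge_id, constEdge, ← hS₂, ← lift_zero_squareToTriangle]
    apply NatTrans.ext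
    funext d
    apply ConcreteCategory.hom_ext
    intro b
    rfl
  · rw [← const_comp_edgeHom_one e', ← hS₀]
    have := lift_one_squareToTriangle.{u}
    apply NatTrans.ext
    funext d
    apply ConcreteCategory.hom_ext
    intro b
    exact congrArg (S.app d) (app_congr this d b.2)

lemma constEdge_app (B : SSet.{u}) (e : X.Edge x y) (b : B _⦋1⦌) :
    (constEdge B e).app _ (prodMk b (stdSimplex.objMk₁ 1)) = e.edge := by
  have : (stdSimplex.objMk₁ 1 : (Δ[1] : SSet.{u}) _⦋1⦌) = stdSimplex.objEquiv.symm (𝟙 _) := by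
    decide
  rw [this]
  exact edgeHom_app_id e

lemma hoHom_eq_of_mapHomotopic_constEdge [Quasicategory X] {e e' : X.Edge x y}
    (h : MapHomotopic x y (constEdge Δ[0] e) (constEdge Δ[0] e')) : hoHom e = hoHom e' := by
  obtain ⟨P, hP, h₀, h₁⟩ := h
  let p : (Δ[1] ⊗ Δ[1] : SSet.{u}) ⟶ (Δ[0] ⊗ Δ[1]) ⊗ Δ[1] := CartesianMonoidalCategory.lift
    (CartesianMonoidalCategory.lift (SSet.const (stdSimplex.obj₀Equiv.symm 0))
      (CartesianMonoidalCategory.fst _ _)) (CartesianMonoidalCategory.snd _ _)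
  let pt : (Δ[0] : SSet.{u}) _⦋1⦌ := stdSimplex.const 0 0 _
  have h₂ : (stdSimplex.objMk₁ 2 : (Δ[1] : SSet.{u}) _⦋1⦌) = stdSimplex.const _ 0 _ := by decide
  have h₃ : (stdSimplex.objMk₁ 0 : (Δ[1] : SSet.{u}) _⦋1⦌) = stdSimplex.const _ 1 _ := by decide
  have h₀₀ : p.app _ (prodMk (stdSimplex.objMk₁ 2) (stdSimplex.objMk₁ 1)) =
      (ι₀ ▷ Δ[1]).app _ (prodMk pt (stdSimplex.objMk₁ 1)) :=
    Prod.ext (Prod.ext (eq_const_of_Δ₀ _ _) h₂) rfl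
  have h₀₁ : p.app _ (prodMk (stdSimplex.objMk₁ 1) (stdSimplex.objMk₁ 0)) =
      ι₁.app _ (prodMk pt (stdSimplex.objMk₁ 1)) :=
    Prod.ext (Prod.ext (eq_const_of_Δ₀ _ _) rfl) h₃
  have h₁₀ : p.app _ (prodMk (stdSimplex.objMk₁ 1) (stdSimplex.objMk₁ 2)) =
      ι₀.app _ (prodMk pt (stdSimplex.objMk₁ 1)) :=
    Prod.ext (Prod.ext (eq_const_of_Δ₀ _ _) rfl) h₂
  have h₁₁ : p.app _ (prodMk (stdSimplex.objMk₁ 0) (stdSimplex.objMk₁ 1)) =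
      (ι₁ ▷ Δ[1]).app _ (prodMk pt (stdSimplex.objMk₁ 1)) :=
    Prod.ext (Prod.ext (eq_const_of_Δ₀ _ _) h₃) rfl
  have := square_fac (p ≫ P) (Edge.id x) e' e (Edge.id y)
    ((congrArg (P.app _) h₀₀).trans ((app_congr hP.left _ _).trans (constEdge_app _ _ _)))
    ((congrArg (P.app _) h₀₁).trans ((app_congr h₁ _ _).trans (constEdge_app _ _ _)))
    ((congrArg (P.app _) h₁₀).trans ((app_congr h₀ _ _).trans (constEdge_app _ _ _)))
    ((congrArg (P.app _) h₁₁).trans ((app_congr hP.right _ _).trans (constEdge_app _ _ _)))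
  rw [hoHom_id, hoHom_id, Category.id_comp, Category.comp_id] at this
  exact this.symm

/-- The components of the mapping space are the morphisms of the homotopy category. Hence a fully
faithful functor is fully faithful on homotopy categories, which is all that is used of it below. -/
lemma htpc_edgeVertex_iff [Quasicategory X] {e e' : X.Edge x y} :
    Htpc (edgeVertex e) (edgeVertex e') ↔ hoHom e = hoHom e' := by
  rw [Htpc, ← mapHomotopic_iff, mapSpaceUncurry_edgeVertex, mapSpaceUncurry_edgeVertex]
  exact ⟨hoHom_eq_of_mapHomotopic_constEdge, mapHomotopic_constEdge_of_hoHom_eq⟩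

lemma edgeVertex_comp_mapSpaceMap {Y : SSet.{u}} (F : X ⟶ Y) (e : X.Edge x y) :
    edgeVertex e ≫ mapSpaceMap F x y = edgeVertex (e.map F) := by
  apply mapSpaceUncurry_injective
  rw [mapSpaceUncurry_comp_mapSpaceMap, mapSpaceUncurry_edgeVertex, mapSpaceUncurry_edgeVertex,
    constEdge_comp]

variable {Y : SSet.{u}} [Quasicategory X] [Quasicategory Y] {F : X ⟶ Y}

omit [Quasicategory X] in
lemma IsFullyFaithful.exists_edge (hF : IsFullyFaithful F) (e' : Y.Edge (F.app _ x) (F.app _ y)) :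
    ∃ e : X.Edge x y, hoHom (e.map F) = hoHom e' := by
  obtain ⟨g, -, h⟩ := hF x y
  obtain ⟨e, he⟩ := InftyCat.exists_edge (edgeVertex e' ≫ g)
  refine ⟨e, ?_⟩
  rw [← htpc_edgeVertex_iff, ← edgeVertex_comp_mapSpaceMap, ← he, Category.assoc]
  have h' : Htpc (g ≫ mapSpaceMap F x y) (𝟙 _) := h
  simpa using h'.whiskerLeft (edgeVertex e')

lemma IsFullyFaithful.hoHom_eq (hF : IsFullyFaithful F) {e e' : X.Edge x y}
    (h : hoHom (e.map F) = hoHom (e'.map F)) : hoHom e = hoHom e' := by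
  obtain ⟨g, h', -⟩ := hF x y
  have h' : Htpc (mapSpaceMap F x y ≫ g) (𝟙 _) := h'
  rw [← htpc_edgeVertex_iff, ← edgeVertex_comp_mapSpaceMap, ← edgeVertex_comp_mapSpaceMap] at h
  have h₁ := h'.whiskerLeft (edgeVertex e)
  have h₂ := h'.whiskerLeft (edgeVertex e')
  have h₃ := h.whiskerRight g
  rw [Category.comp_id] at h₁ h₂
  rw [Category.assoc, Category.assoc] at h₃
  exact htpc_edgeVertex_iff.1 (h₁.symm.trans (h₃.trans h₂))

lemma IsFullyFaithful.hoHom_fac (hF : IsFullyFaithful F) {e : X.Edge x y} {e' : X.Edge y z}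
    {e'' : X.Edge x z} (h : hoHom (e.map F) ≫ hoHom (e'.map F) = hoHom (e''.map F)) :
    hoHom e ≫ hoHom e' = hoHom e'' := by
  obtain ⟨c, hc⟩ := hoHom_surjective (hoHom e ≫ hoHom e')
  obtain ⟨s⟩ := nonempty_compStruct_iff.2 hc.symm
  rw [← hc]
  exact hF.hoHom_eq ((compStruct_fac (s.map F)).symm.trans h)

lemma IsFullyFaithful.isEquivalence (hF : IsFullyFaithful F) {e : X.Edge x y}
    (h : IsEquivalence (e.map F)) : IsEquivalence e := by
  rw [isEquivalence_iff_isIso] at h ⊢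
  obtain ⟨i, hi⟩ := hoHom_surjective (inv (hoHom (e.map F)))
  obtain ⟨e', he'⟩ := hF.exists_edge i
  refine ⟨hoHom e', ?_, ?_⟩
  · rw [← hoHom_id]
    apply hF.hoHom_fac
    rw [he', hi, IsIso.hom_inv_id, Edge.map_id, hoHom_id]
  · rw [← hoHom_id]
    apply hF.hoHom_fac
    rw [he', hi, IsIso.inv_hom_id, Edge.map_id, hoHom_id]

lemma IsFullyFaithful.equivalent (hF : IsFullyFaithful F)
    (h : Equivalent (F.app _ x) (F.app _ y)) : Equivalent x y := by
  obtain ⟨e', he'⟩ := h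
  obtain ⟨e, he⟩ := hF.exists_edge e'
  refine ⟨e, hF.isEquivalence ?_⟩
  rw [isEquivalence_iff_isIso] at he' ⊢
  rwa [he]

end FullyFaithful

/-! ### Full subcategories of quasi-categories. -/

section FullSub

variable {D : SSet.{u}} (P : D _⦋0⦌ → Prop)

/-- The full subcomplex on the vertices which satisfy a property. -/
def fullSub : D.Subcomplex where
  obj d := {x | ∀ f : ⦋0⦌ ⟶ d.unop, P (D.map f.op x)}
  map {d d'} g x hx f := by
    have := hx (f ≫ g.unop)
    rw [show (f ≫ g.unop).op = g ≫ f.op from rfl, D.map_comp] at this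
    exact this

variable {P}

lemma of_mem_fullSub_zero {x : D _⦋0⦌} (hx : x ∈ (fullSub P).obj (op ⦋0⦌)) : P x := by
  have := ConcreteCategory.congr_hom (D.map_id (op ⦋0⦌)) x
  exact (show D.map (𝟙 (op ⦋0⦌)) x = x from this) ▸ hx (𝟙 _)

/-- Each vertex of a simplex lies on some face different from the possibly omitted face `i`. When a
face is omitted there must be at least three faces, hence the condition on n = 0. -/
lemma mem_fullSub_of_δ {n : ℕ} {x : D _⦋n + 1⦌} {i : Option (Fin (n + 2))} (hi : n = 0 → i = none)
    (hx : ∀ j, i ≠ some j → D.δ j x ∈ (fullSub P).obj (op ⦋n⦌)) :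
    x ∈ (fullSub P).obj (op ⦋n + 1⦌) := fun f ↦ by
  obtain ⟨j, hj, hj'⟩ : ∃ j, i ≠ some j ∧ j ≠ f.toOrderHom 0 := by
    obtain _ | i := i
    · exact (exists_ne (f.toOrderHom 0)).imp fun j hj ↦ ⟨by simp, hj⟩
    · obtain ⟨j, hj⟩ := Finset.exists_mem_notMem_of_card_lt_card
        (s := {i, f.toOrderHom 0}) (t := (Finset.univ : Finset (Fin (n + 2)))) (by
          refine (Finset.card_le_two).trans_lt ?_
          rw [Finset.card_univ, Fintype.card_fin]
          have : n ≠ 0 := fun h ↦ by simpa using hi h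
          lia)
      simp only [Finset.mem_insert, Finset.mem_singleton, not_or] at hj
      exact ⟨j, by simpa using Ne.symm hj.2.1, hj.2.2⟩
  obtain ⟨f', rfl⟩ := SimplexCategory.eq_comp_δ_of_not_surjective' f j (fun k ↦ by
    obtain rfl : k = 0 := Subsingleton.elim (α := Fin 1) _ _
    exact hj'.symm)
  have := hx j hj f'
  rw [op_comp, D.map_comp]
  exact this

instance quasicategory_fullSub [Quasicategory D] : Quasicategory (fullSub P : SSet) := by
  apply quasicategory_of_filler
  intro n i σ₀ h₀ hn
  obtain ⟨σ, hσ⟩ := Quasicategory.hornFilling h₀ hn (σ₀ ≫ (fullSub P).ι)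
  have h (j) (hj : j ≠ i) : D.δ j (SSet.yonedaEquiv σ) = (σ₀.app _ (horn.face i j hj)).1 := by
    rw [← yonedaEquiv_δ_comp, ← horn.ι_ι i j hj, Category.assoc, ← hσ]
    rfl
  refine ⟨⟨SSet.yonedaEquiv σ, mem_fullSub_of_δ (i := some i) (by simp) fun j hj ↦ ?_⟩,
    fun j hj ↦ Subtype.ext (h j hj)⟩
  rw [h j (fun h ↦ hj (congrArg some h.symm))]
  exact (σ₀.app _ _).2

lemma isEquivalence_fullSub {x y : (fullSub P : SSet) _⦋0⦌} {e : (fullSub P : SSet).Edge x y}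
    (h : IsEquivalence (e.map (fullSub P).ι)) : IsEquivalence e := by
  obtain ⟨i⟩ := h
  have h₁ : i.inv.edge ∈ (fullSub P).obj (op ⦋1⦌) := by
    refine mem_fullSub_of_δ (i := none) (by simp) fun j _ ↦ ?_
    fin_cases j
    · exact i.inv.tgt_eq.symm ▸ x.2
    · exact i.inv.src_eq.symm ▸ y.2
  have h₂ : i.homInvId.simplex ∈ (fullSub P).obj (op ⦋2⦌) := by
    refine mem_fullSub_of_δ (i := none) (by simp) fun j _ ↦ ?_
    fin_cases j
    · exact i.homInvId.d₀.symm ▸ h₁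
    · exact i.homInvId.d₁.symm ▸ (Edge.id x).edge.2
    · exact i.homInvId.d₂.symm ▸ e.edge.2
  have h₃ : i.invHomId.simplex ∈ (fullSub P).obj (op ⦋2⦌) := by
    refine mem_fullSub_of_δ (i := none) (by simp) fun j _ ↦ ?_
    fin_cases j
    · exact i.invHomId.d₀.symm ▸ e.edge.2
    · exact i.invHomId.d₁.symm ▸ (Edge.id y).edge.2
    · exact i.invHomId.d₂.symm ▸ h₁
  exact ⟨⟨Edge.mk ⟨_, h₁⟩ (Subtype.ext i.inv.src_eq) (Subtype.ext i.inv.tgt_eq),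
    Edge.CompStruct.mk ⟨_, h₂⟩ (Subtype.ext i.homInvId.d₂) (Subtype.ext i.homInvId.d₀)
      (Subtype.ext i.homInvId.d₁),
    Edge.CompStruct.mk ⟨_, h₃⟩ (Subtype.ext i.invHomId.d₂) (Subtype.ext i.invHomId.d₀)
      (Subtype.ext i.invHomId.d₁)⟩⟩

end FullSub

/-! ### Essential surjectivity of localizations. -/

section Localization

variable {C : Type u} [Category.{v} C] {W : MorphismProperty C} {D : SSet.{max u v}}
  {γ : nerve C ⟶ D}

/-- A localization is essentially surjective. -/
theorem IsLocalizationAt.exists_equivalent_objOf (hγ : IsLocalizationAt W γ) (d : D _⦋0⦌) :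
    ∃ X : C, Equivalent (objOf γ X) d := by
  have := hγ.quasicategory
  let P (d : D _⦋0⦌) : Prop := ∃ X : C, Equivalent (objOf γ X) d
  let D' : SSet.{max u v} := (fullSub P : SSet)
  have hP (x : (nerve C) _⦋0⦌) : P (γ.app _ x) := by
    obtain ⟨c, rfl⟩ := nerveEquiv.symm.surjective x
    exact ⟨c, Equivalent.refl _⟩
  -- The universal property is applied to γ viewed with values in its essential image; it gives r :
  -- D → D' which extends γ up to equivalence.
  let γ' : nerve C ⟶ D' := Subcomplex.lift γ (by
    rintro d _ ⟨x, rfl⟩ f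
    rw [← app_map]
    exact hP _)
  have hγ' : Inverts W γ' := fun X Y w hw ↦ isEquivalence_fullSub
    ((hγ.inEssImage_iff D γ).1 ⟨funObj (𝟙 D), by
      rw [pre_app_funObj, Category.comp_id]
      exact Equivalent.refl _⟩ w hw)
  obtain ⟨x, hx⟩ := (hγ.inEssImage_iff D' γ').2 hγ'
  obtain ⟨r, rfl⟩ := exists_funObj x
  rw [pre_app_funObj] at hx
  have hx' := hx.map ((ihom (nerve C)).map (fullSub P).ι)
  rw [ihom_map_funObj, ihom_map_funObj] at hx'
  -- Both functors restrict to γ up to equivalence, and precomposition with γ reflects equivalence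
  -- of functors. So every object d is equivalent to r(d), which lies in the essential image.
  have h : Equivalent (funObj (r ≫ (fullSub P).ι)) (funObj (𝟙 D)) := by
    apply (hγ.fullyFaithful D).equivalent
    rw [pre_app_funObj, pre_app_funObj]
    exact hx'
  have h' := h.map (evalAt d)
  rw [evalAt_funObj, evalAt_funObj] at h'
  obtain ⟨X, hX⟩ : P ((r ≫ (fullSub P).ι).app _ d) := of_mem_fullSub_zero (r.app _ d).2
  exact ⟨X, hX.trans h'⟩

end Localization

end InftyCat

namespace InftyCat

open SSet Opposite

/-! ### Natural transformations and localizations of categories -/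

section NerveHomotopy

variable {C D : Type u} [Category.{v} C] [Category.{v} D]

/-- The map of simplicial sets given by a natural transformation. -/
def nerveHomotopy {F G : C ⥤ D} (τ : F ⟶ G) : nerve C ⊗ Δ[1] ⟶ nerve D where
  app _ := ↾fun x ↦ Functor.prod' (stdSimplex.asOrderHom x.2).monotone.functor x.1 ⋙
    Functor.uncurry.obj (ComposableArrows.mk₁ τ)
  naturality _ _ _ := rfl

lemma ι₀_nerveHomotopy {F G : C ⥤ D} (τ : F ⟶ G) : ι₀ ≫ nerveHomotopy τ = nerveMap F := by
  apply NatTrans.ext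
  funext d
  apply ConcreteCategory.hom_ext
  intro x
  refine CategoryTheory.Functor.ext (fun _ ↦ rfl) fun i j f ↦ ?_
  refine Eq.trans ?_ ((Category.id_comp _).trans (Category.comp_id _)).symm
  exact Category.id_comp _

lemma ι₁_nerveHomotopy {F G : C ⥤ D} (τ : F ⟶ G) : ι₁ ≫ nerveHomotopy τ = nerveMap G := by
  apply NatTrans.ext
  funext d
  apply ConcreteCategory.hom_ext
  intro x
  refine CategoryTheory.Functor.ext (fun _ ↦ rfl) fun i j f ↦ ?_
  refine Eq.trans ?_ ((Category.id_comp _).trans (Category.comp_id _)).symm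
  exact Category.id_comp _

lemma nerveHomotopy_app_vEdge {F G : C ⥤ D} (τ : F ⟶ G) (X : C) :
    (nerveHomotopy τ).app _ (vEdge (nerveEquiv.symm X)) = ComposableArrows.mk₁ (τ.app X) := by
  refine ComposableArrows.ext₁ rfl rfl ?_
  show τ.app X ≫ G.map (𝟙 X) = 𝟙 _ ≫ τ.app X ≫ 𝟙 _
  rw [G.map_id, Category.id_comp]

lemma edgeMk_map_edge {F : C ⥤ D} {X Y : C} (f : X ⟶ Y) :
    ((nerve.edgeMk f).map (nerveMap F)).edge = (nerve.edgeMk (F.map f)).edge :=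
  nerveMap_app_mk₁ F f

lemma isIso_of_isEquivalence_edgeMk {X Y : C} {f : X ⟶ Y} (h : IsEquivalence (nerve.edgeMk f)) :
    IsIso f := by
  obtain ⟨i⟩ := h
  obtain ⟨g, hg⟩ := nerve.edgeMk_surjective i.inv
  have h₁ := i.homInvId
  have h₂ := i.invHomId
  rw [← hg, ← nerve.edgeMk_id] at h₁ h₂
  exact ⟨g, (nerve.nonempty_compStruct_iff _ _ _).1 ⟨h₁⟩,
    (nerve.nonempty_compStruct_iff _ _ _).1 ⟨h₂⟩⟩

lemma isEquivalence_edgeMk {X Y : C} (f : X ⟶ Y) [IsIso f] : IsEquivalence (nerve.edgeMk f) := by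
  refine ⟨⟨nerve.edgeMk (inv f), ?_, ?_⟩⟩
  · rw [← nerve.edgeMk_id]
    exact ((nerve.nonempty_compStruct_iff _ _ _).2 (IsIso.hom_inv_id f)).some
  · rw [← nerve.edgeMk_id]
    exact ((nerve.nonempty_compStruct_iff _ _ _).2 (IsIso.inv_hom_id f)).some

end NerveHomotopy

/-! ### Naturality squares in the homotopy category. -/

section Naturality

variable {K Y : SSet.{u}} [Quasicategory Y] {f g : K ⟶ Y} {h : K ⊗ Δ[1] ⟶ Y}

lemma component_naturality (h₀ : ι₀ ≫ h = f) (h₁ : ι₁ ≫ h = g) {x y : K _⦋0⦌} (e : K.Edge x y) :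
    hoHom (component h h₀ h₁ x) ≫ hoHom (e.map g) =
      hoHom (e.map f) ≫ hoHom (component h h₀ h₁ y) := by
  have h₂ : (stdSimplex.objMk₁ 1 : (Δ[1] : SSet.{u}) _⦋1⦌) = stdSimplex.objEquiv.symm (𝟙 _) := by
    decide
  have h₃ : (stdSimplex.objMk₁ 2 : (Δ[1] : SSet.{u}) _⦋1⦌) = stdSimplex.const _ 0 _ := by decide
  have h₄ : (stdSimplex.objMk₁ 0 : (Δ[1] : SSet.{u}) _⦋1⦌) = stdSimplex.const _ 1 _ := by decide
  have e₁ : (edgeHom e).app _ (stdSimplex.objMk₁ 1) = e.edge := by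
    rw [h₂]
    exact edgeHom_app_id e
  have e₀ : (edgeHom e).app _ (stdSimplex.objMk₁ 2) = K.σ 0 x := by
    refine (congrArg ((edgeHom e).app _) h₃).trans
      ((app_congr (const_comp_edgeHom_zero (B := Δ[0]) e) (op ⦋1⦌)
        (stdSimplex.const _ 0 _)).trans ?_)
    exact (app_congr (constEdge_id (B := Δ[0]) x) (op ⦋1⦌)
      (prodMk (stdSimplex.const _ 0 _) (stdSimplex.objEquiv.symm (𝟙 _)))).symm.trans
      (edgeHom_app_id _)
  have e₂ : (edgeHom e).app _ (stdSimplex.objMk₁ 0) = K.σ 0 y := by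
    refine (congrArg ((edgeHom e).app _) h₄).trans
      ((app_congr (const_comp_edgeHom_one (B := Δ[0]) e) (op ⦋1⦌)
        (stdSimplex.const _ 0 _)).trans ?_)
    exact (app_congr (constEdge_id (B := Δ[0]) y) (op ⦋1⦌)
      (prodMk (stdSimplex.const _ 0 _) (stdSimplex.objEquiv.symm (𝟙 _)))).symm.trans
      (edgeHom_app_id _)
  refine square_fac (edgeHom e ▷ Δ[1] ≫ h) _ _ _ _ ?_ ?_ ?_ ?_
  · exact congrArg (h.app _) (Prod.ext e₀ h₂)
  · exact (congrArg (h.app _) (Prod.ext e₁ h₄)).trans (app_congr h₁ _ e.edge)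
  · exact (congrArg (h.app _) (Prod.ext e₁ h₃)).trans (app_congr h₀ _ e.edge)
  · exact congrArg (h.app _) (Prod.ext e₂ h₂)

/-- The components of a natural transformation at equivalent objects. -/
lemma isInv_app_vEdge_iff (h : K ⊗ Δ[1] ⟶ Y) {x y : K _⦋0⦌} (hxy : Equivalent x y) :
    IsInv (h.app _ (vEdge x)) ↔ IsInv (h.app _ (vEdge y)) := by
  obtain ⟨e, he⟩ := hxy
  have := component_naturality (h := h) rfl rfl e
  have h₁ := (isEquivalence_iff_isIso _).1 (he.map (ι₀ ≫ h))
  have h₂ := (isEquivalence_iff_isIso _).1 (he.map (ι₁ ≫ h))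
  have e₁ := isEquivalence_iff_isInv (component h rfl rfl x)
  have e₂ := isEquivalence_iff_isInv (component h rfl rfl y)
  refine e₁.symm.trans (Iff.trans ?_ e₂)
  rw [isEquivalence_iff_isIso, isEquivalence_iff_isIso]
  constructor
  · intro _
    have : IsIso (hoHom (e.map (ι₀ ≫ h)) ≫ hoHom (component h rfl rfl y)) := by
      rw [← this]
      infer_instance
    exact IsIso.of_isIso_comp_left (hoHom (e.map (ι₀ ≫ h))) _
  · intro _
    have : IsIso (hoHom (component h rfl rfl x) ≫ hoHom (e.map (ι₁ ≫ h))) := by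
      rw [this]
      infer_instance
    exact IsIso.of_isIso_comp_right _ (hoHom (e.map (ι₁ ≫ h)))

lemma isEquivalence_map_iff_of_equivalent (hfg : Equivalent (funObj f) (funObj g)) {x y : K _⦋0⦌}
    (e : K.Edge x y) : IsEquivalence (e.map f) ↔ IsEquivalence (e.map g) := by
  obtain ⟨h, hh, h₀, h₁⟩ := equivalent_funObj_iff.1 hfg
  have := component_naturality h₀ h₁ e
  have h₂ := (isEquivalence_iff_isIso _).1 (isEquivalence_component (h₀ := h₀) (h₁ := h₁) hh x)
  have h₃ := (isEquivalence_iff_isIso _).1 (isEquivalence_component (h₀ := h₀) (h₁ := h₁) hh y)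
  rw [isEquivalence_iff_isIso, isEquivalence_iff_isIso]
  constructor
  · intro _
    have : IsIso (hoHom (component h h₀ h₁ x) ≫ hoHom (e.map g)) := by
      rw [this]
      infer_instance
    exact IsIso.of_isIso_comp_left (hoHom (component h h₀ h₁ x)) _
  · intro _
    have : IsIso (hoHom (e.map f) ≫ hoHom (component h h₀ h₁ y)) := by
      rw [← this]
      infer_instance
    exact IsIso.of_isIso_comp_right _ (hoHom (component h h₀ h₁ y))

end Naturality

/-! ### Functors and transformations induced on localizations. -/

section Localization

variable {C C' : Type u} [Category.{v} C] [Category.{v} C'] {W : MorphismProperty C}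
  {W' : MorphismProperty C'} {M N : SSet.{max u v}} {γ : nerve C ⟶ M} {γ' : nerve C' ⟶ N}

lemma IsLocalizationAt.inverts (hγ : IsLocalizationAt W γ) : Inverts W γ :=
  have := hγ.quasicategory
  (hγ.inEssImage_iff M γ).1 ⟨funObj (𝟙 M), by
    rw [pre_app_funObj, Category.comp_id]
    exact Equivalent.refl _⟩

/-- The universal property of a localization. -/
lemma IsLocalizationAt.exists_lift (hγ : IsLocalizationAt W γ) [Quasicategory N] {f : nerve C ⟶ N}
    (hf : Inverts W f) : ∃ r : M ⟶ N, Equivalent (funObj (γ ≫ r)) (funObj f) := by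
  obtain ⟨x, hx⟩ := (hγ.inEssImage_iff N f).2 hf
  obtain ⟨r, rfl⟩ := exists_funObj x
  rw [pre_app_funObj] at hx
  exact ⟨r, hx⟩

lemma IsLocalizationAt.exists_isInducedBy (hγ : IsLocalizationAt W γ) (hγ' : IsLocalizationAt W' γ')
    (F : C ⥤ C') (hF : ∀ ⦃X Y : C⦄ (f : X ⟶ Y), W f → W' (F.map f)) :
    ∃ T, IsInducedBy γ γ' F T := by
  have := hγ'.quasicategory
  refine hγ.exists_lift (f := nerveMap F ≫ γ') fun X Y w hw ↦ ?_
  refine (hγ'.inverts _ (hF w hw)).ofEq ?_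
  exact congrArg (γ'.app _) (edgeMk_map_edge w).symm

/-- A morphism which becomes invertible in the localization is sent to an isomorphism by all
functors which invert `W`. -/
lemma IsLocalizationAt.isIso_map (hγ : IsLocalizationAt W γ) {A : Type u} [Category.{v} A]
    (L : C ⥤ A) (hL : ∀ ⦃X Y : C⦄ (f : X ⟶ Y), W f → IsIso (L.map f)) {X Y : C} {w : X ⟶ Y}
    (hw : IsEquivalence ((nerve.edgeMk w).map γ)) : IsIso (L.map w) := by
  obtain ⟨r, hr⟩ := hγ.exists_lift (f := nerveMap L) fun X Y w hw ↦ by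
    have := hL w hw
    exact (isEquivalence_edgeMk (L.map w)).ofEq (edgeMk_map_edge w).symm
  have h₁ : IsEquivalence ((nerve.edgeMk w).map (γ ≫ r)) := (hw.map r).ofEq rfl
  have h₂ := (isEquivalence_map_iff_of_equivalent hr (nerve.edgeMk w)).1 h₁
  exact isIso_of_isEquivalence_edgeMk (h₂.ofEq (edgeMk_map_edge w))

lemma equivalent_comp {K L L' : SSet.{u}} {f g : K ⟶ L} (h : Equivalent (funObj f) (funObj g))
    (p : L ⟶ L') : Equivalent (funObj (f ≫ p)) (funObj (g ≫ p)) := by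
  have := h.map ((ihom K).map p)
  rwa [ihom_map_funObj, ihom_map_funObj] at this

lemma comp_equivalent {K K' L : SSet.{u}} {f g : K ⟶ L} (h : Equivalent (funObj f) (funObj g))
    (p : K' ⟶ K) : Equivalent (funObj (p ≫ f)) (funObj (p ≫ g)) := by
  have := h.map ((MonoidalClosed.pre p).app L)
  rwa [pre_app_funObj, pre_app_funObj] at this

lemma equivalent_app {K L : SSet.{u}} {f g : K ⟶ L} (h : Equivalent (funObj f) (funObj g))
    (x : K _⦋0⦌) : Equivalent (f.app _ x) (g.app _ x) := by
  have := h.map (evalAt x)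
  rwa [evalAt_funObj, evalAt_funObj] at this

lemma nerveHomotopy_comp_ends {F G : C ⥤ C'} (τ : F ⟶ G) :
    ι₀ ≫ nerveHomotopy τ ≫ γ' = nerveMap F ≫ γ' ∧ ι₁ ≫ nerveHomotopy τ ≫ γ' = nerveMap G ≫ γ' := by
  rw [← ι₀_nerveHomotopy τ, ← ι₁_nerveHomotopy τ, Category.assoc, Category.assoc]
  exact ⟨rfl, rfl⟩

lemma isInv_nerveHomotopy_comp_iff {F G : C ⥤ C'} (τ : F ⟶ G) (X : C) :
    IsInv ((nerveHomotopy τ ≫ γ').app _ (vEdge (nerveEquiv.symm X))) ↔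
      IsEquivalence ((nerve.edgeMk (τ.app X)).map γ') := by
  rw [isEquivalence_iff_isInv]
  exact iff_of_eq (congrArg (fun e ↦ IsInv (γ'.app _ e)) (nerveHomotopy_app_vEdge τ X))

lemma IsLocalizationAt.equivalent_of_natTrans (hγ' : IsLocalizationAt W' γ') {F G : C ⥤ C'}
    (τ : F ⟶ G) (hτ : ∀ X, W' (τ.app X)) :
    Equivalent (funObj (nerveMap F ≫ γ')) (funObj (nerveMap G ≫ γ')) := by
  have := hγ'.quasicategory
  refine equivalent_funObj_iff.2 ⟨nerveHomotopy τ ≫ γ', fun x ↦ ?_, (nerveHomotopy_comp_ends τ).1,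
    (nerveHomotopy_comp_ends τ).2⟩
  obtain ⟨X, rfl⟩ := nerveEquiv.symm.surjective x
  exact (isInv_nerveHomotopy_comp_iff τ X).2 (hγ'.inverts _ (hτ X))

end Localization

end InftyCat

namespace InftyCat

open SSet Opposite

/-! ### A criterion for an induced functor to be fully faithful -/

section Criterion

variable {C C' : Type u} [Category.{v} C] [Category.{v} C'] {W : MorphismProperty C}
  {W' : MorphismProperty C'} {M N : SSet.{max u v}} {γ : nerve C ⟶ M} {γ' : nerve C' ⟶ N}
  {t : C ⥤ C'} {g : C' ⥤ C} {T : M ⟶ N} {S : N ⟶ M}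

lemma nerveMap_id_comp {K : SSet.{max u v}} (f : nerve C ⟶ K) : nerveMap (𝟭 C) ≫ f = f := by
  have : nerveMap (𝟭 C) = 𝟙 (nerve C) := by
    apply NatTrans.ext
    funext d
    apply ConcreteCategory.hom_ext
    intro x
    rfl
  rw [this, Category.id_comp]

lemma nerveMap_comp_comp {K : SSet.{max u v}} {C'' : Type u} [Category.{v} C''] (F : C ⥤ C')
    (G : C' ⥤ C'') (f : nerve C'' ⟶ K) : nerveMap (F ⋙ G) ≫ f = nerveMap F ≫ nerveMap G ≫ f := by
  have : nerveMap (F ⋙ G) = nerveMap F ≫ nerveMap G := by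
    apply NatTrans.ext
    funext d
    apply ConcreteCategory.hom_ext
    intro x
    rfl
  rw [this, Category.assoc]

/-- After precomposition with γ, the functors id and S ∘ T become γ and γ ∘ g ∘ t, which the
transformation s identifies. Full faithfulness of precomposition with γ removes γ. -/
lemma exists_isInducedBy_unit (hγ : IsLocalizationAt W γ) (hγ' : IsLocalizationAt W' γ')
    (hT : IsInducedBy γ γ' t T) (hS : IsInducedBy γ' γ g S) (s : 𝟭 C ⟶ t ⋙ g)
    (hs : ∀ X, W (s.app X)) :
    ∃ h : M ⊗ Δ[1] ⟶ M, PtInv h ∧ ι₀ ≫ h = 𝟙 M ∧ ι₁ ≫ h = T ≫ S := by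
  have := hγ.quasicategory
  have := hγ'.quasicategory
  rw [← equivalent_funObj_iff]
  apply (hγ.fullyFaithful M).equivalent
  rw [pre_app_funObj, pre_app_funObj]
  have h₁ : Equivalent (funObj (γ ≫ T ≫ S)) (funObj (nerveMap t ≫ γ' ≫ S)) := by
    have := equivalent_comp hT S
    rwa [Category.assoc, Category.assoc] at this
  have h₂ : Equivalent (funObj (nerveMap t ≫ γ' ≫ S)) (funObj (nerveMap t ≫ nerveMap g ≫ γ)) :=
    comp_equivalent hS (nerveMap t)
  have h₃ : Equivalent (funObj (γ ≫ 𝟙 M)) (funObj (nerveMap t ≫ nerveMap g ≫ γ)) :=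
by
    have := hγ.equivalent_of_natTrans s hs
    rwa [nerveMap_id_comp, nerveMap_comp_comp, ← Category.comp_id γ] at this
  exact h₃.trans (h₁.trans h₂).symm

lemma exists_edge_of_natTrans {R : C' ⥤ C'} (a : 𝟭 C' ⟶ R) :
    ∃ e : ((ihom (nerve C')).obj N).Edge (funObj γ') (funObj (nerveMap R ≫ γ')),
      ∀ X, IsEquivalence (e.map (evalAt (nerveEquiv.symm X))) ↔
        IsEquivalence ((nerve.edgeMk (a.app X)).map γ') := by
  have h₀ : ι₀ ≫ nerveHomotopy a ≫ γ' = γ' :=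
    (nerveHomotopy_comp_ends a).1.trans (nerveMap_id_comp γ')
  refine ⟨natEdge (nerveHomotopy a ≫ γ') h₀ (nerveHomotopy_comp_ends a).2, fun X ↦ ?_⟩
  rw [isEquivalence_iff_isInv, ← isInv_nerveHomotopy_comp_iff]
  exact iff_of_eq (congrArg IsInv (evalAt_natSimplex _ _))

/-- Composing with an equivalence of functors does not change the set of objects at which a
transformation is invertible. -/
lemma exists_edge_comp {K L : SSet.{u}} [Quasicategory L] {x y z : ((ihom K).obj L) _⦋0⦌}
    (e : ((ihom K).obj L).Edge x y) {q : ((ihom K).obj L).Edge y z} (hq : IsEquivalence q) :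
    ∃ k : ((ihom K).obj L).Edge x z,
      ∀ p, IsEquivalence (k.map (evalAt p)) ↔ IsEquivalence (e.map (evalAt p)) := by
  obtain ⟨k, hk⟩ := hoHom_surjective (hoHom e ≫ hoHom q)
  refine ⟨k, fun p ↦ ?_⟩
  obtain ⟨c⟩ := nonempty_compStruct_iff.2 hk.symm
  have h := compStruct_fac (c.map (evalAt p))
  have hq' := (isEquivalence_iff_isIso _).1 (hq.map (evalAt p))
  rw [isEquivalence_iff_isIso, ← h, isIso_comp_right_iff, ← isEquivalence_iff_isIso]

lemma isInv_app_vEdge_iff_natEdge {K L L' : SSet.{u}} (p : K ⟶ L) (h : L ⊗ Δ[1] ⟶ L')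
    (x : K _⦋0⦌) : IsInv (h.app _ (vEdge (p.app _ x))) ↔
      IsInv ((evalAt x).app _ (((MonoidalClosed.pre p).app L').app _ (natSimplex h))) := by
  refine iff_of_eq (congrArg IsInv ?_)
  refine Eq.trans ?_ (congrArg ((evalAt x).app _) (pre_app_natSimplex p h)).symm
  refine Eq.trans ?_ (evalAt_natSimplex x (p ▷ Δ[1] ≫ h)).symm
  exact congrArg (h.app _) (Prod.ext (app_σ p 0 _).symm rfl)

/-- The map a gives a transformation γ' → γ' ∘ R, and b identifies γ' ∘ R with γ' ∘ t ∘ g, hence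
with T ∘ S ∘ γ'. The composite descends to N because precomposition with γ' is full on homotopy
categories. Since `W'` is exactly the class of maps inverted by γ', invertibility at an object of C'
is read on a. -/
lemma exists_isInducedBy_counit (hγ : IsLocalizationAt W γ) (hγ' : IsLocalizationAt W' γ')
    (hsat : ∀ ⦃X Y : C'⦄ (w : X ⟶ Y), IsEquivalence ((nerve.edgeMk w).map γ') → W' w)
    (hT : IsInducedBy γ γ' t T) (hS : IsInducedBy γ' γ g S) {R : C' ⥤ C'} (a : 𝟭 C' ⟶ R)
    (b : g ⋙ t ⟶ R) (hb : ∀ X, W' (b.app X)) :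
    ∃ h : N ⊗ Δ[1] ⟶ N, ι₀ ≫ h = 𝟙 N ∧ ι₁ ≫ h = S ≫ T ∧
      ∀ X, IsInv (h.app _ (vEdge (objOf γ' X))) ↔ W' (a.app X) := by
  have := hγ.quasicategory
  have := hγ'.quasicategory
  have h₁ : Equivalent (funObj (γ' ≫ S ≫ T)) (funObj (nerveMap g ≫ γ ≫ T)) := by
    have := equivalent_comp hS T
    rwa [Category.assoc, Category.assoc] at this
  have h₂ : Equivalent (funObj (nerveMap g ≫ γ ≫ T)) (funObj (nerveMap g ≫ nerveMap t ≫ γ')) :=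
    comp_equivalent hT (nerveMap g)
  have h₃ : Equivalent (funObj (nerveMap g ≫ nerveMap t ≫ γ')) (funObj (nerveMap R ≫ γ')) :=
by
    have := hγ'.equivalent_of_natTrans b hb
    rwa [nerveMap_comp_comp] at this
  obtain ⟨q, hq⟩ := (h₁.trans (h₂.trans h₃)).symm
  obtain ⟨e, he⟩ := exists_edge_of_natTrans (γ' := γ') a
  obtain ⟨k, hk⟩ := exists_edge_comp e hq
  -- The end points are rewritten as values of the precomposition functor, which is the form
  -- required for descending the edge.
  have hk' : ∃ k : ((ihom (nerve C')).obj N).Edge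
      (((MonoidalClosed.pre γ').app N).app _ (funObj (𝟙 N)))
      (((MonoidalClosed.pre γ').app N).app _ (funObj (S ≫ T))),
      ∀ x, IsEquivalence (k.map (evalAt x)) ↔ IsEquivalence (e.map (evalAt x)) := by
    rw [pre_app_funObj, pre_app_funObj, Category.comp_id]
    exact ⟨k, hk⟩
  obtain ⟨k, hk⟩ := hk'
  obtain ⟨η, hη⟩ := (hγ'.fullyFaithful N).exists_edge k
  obtain ⟨h, h₀, h₁, rfl⟩ := exists_natEdge η
  refine ⟨h, h₀, h₁, fun X ↦ ?_⟩
  have h₂ := hoHom_map_congr (evalAt (nerveEquiv.symm X)) hη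
  have h₃ : IsInv (h.app _ (vEdge (objOf γ' X))) ↔
      IsEquivalence (k.map (evalAt (nerveEquiv.symm X))) := by
    rw [isEquivalence_iff_isIso, ← h₂, ← isEquivalence_iff_isIso, isEquivalence_iff_isInv]
    exact isInv_app_vEdge_iff_natEdge γ' h (nerveEquiv.symm X)
  exact h₃.trans ((hk _).trans ((he X).trans ⟨fun h ↦ hsat _ h, fun h ↦ hγ'.inverts _ h⟩))

/-- A functor induces a fully faithful functor between localizations if it has a homotopy inverse
on one side, and is such that the other composition is related to the identity. The essential image
consists of the objects on which this relation is an equivalence. -/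
theorem isFullyFaithful_of_isInducedBy (hγ : IsLocalizationAt W γ) (hγ' : IsLocalizationAt W' γ')
    (hsat : ∀ ⦃X Y : C'⦄ (w : X ⟶ Y), IsEquivalence ((nerve.edgeMk w).map γ') → W' w)
    (hg : ∀ ⦃X Y : C'⦄ (f : X ⟶ Y), W' f → W (g.map f))
    (hT : IsInducedBy γ γ' t T) (s : 𝟭 C ⟶ t ⋙ g)
    (hs : ∀ X, W (s.app X)) {R : C' ⥤ C'} (a : 𝟭 C' ⟶ R)
    (b : g ⋙ t ⟶ R) (hb : ∀ X, W' (b.app X)) (ha : ∀ X, W' (a.app (t.obj X))) :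
    IsFullyFaithful T ∧
    (∀ y : N _⦋0⦌, InEssImage T y ↔ ∃ X, W' (a.app X) ∧ Equivalent (objOf γ' X) y) ∧
    ∀ X, InEssImage T (objOf γ' X) ↔ W' (a.app X) := by
  have := hγ.quasicategory
  have := hγ'.quasicategory
  obtain ⟨S, hS⟩ := hγ'.exists_isInducedBy hγ g hg
  obtain ⟨h, hh, h₀, h₁⟩ := exists_isInducedBy_unit hγ hγ' hT hS s hs
  obtain ⟨h', h₀', h₁', hh'⟩ := exists_isInducedBy_counit hγ hγ' hsat hT hS a b hb
  have hTx (x : M _⦋0⦌) : ∃ X : C, Equivalent (T.app _ x) (objOf γ' (t.obj X)) := by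
    obtain ⟨X, hX⟩ := hγ.exists_equivalent_objOf x
    refine ⟨X, (hX.map T).symm.trans ?_⟩
    have h₁ := equivalent_app hT (nerveEquiv.symm X)
    have h₂ : (nerveMap t ≫ γ').app (op ⦋0⦌) (nerveEquiv.symm X) =
        objOf γ' (t.obj X) := congrArg (γ'.app _) (nerveMap_app_mk₀ t X)
    rw [h₂] at h₁
    exact h₁
  have hTx' (x : M _⦋0⦌) : IsInv (h'.app _ (vEdge (T.app _ x))) := by
    obtain ⟨X, hX⟩ := hTx x
    rw [isInv_app_vEdge_iff h' hX, hh']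
    exact ha X
  have hX (X : C') : InEssImage T (objOf γ' X) ↔ W' (a.app X) := by
    rw [← hh']
    constructor
    · rintro ⟨x, hx⟩
      rw [← isInv_app_vEdge_iff h' hx]
      exact hTx' x
    · intro hX
      refine ⟨S.app _ (objOf γ' X), Equivalent.symm ?_⟩
      -- Where the transformation id → TS is invertible, its component exhibits the object as T
      -- applied to its image under S.
      let e := component h' h₀' h₁' (objOf γ' X)
      exact ⟨e, (isEquivalence_iff_isInv e).2 hX⟩
  refine ⟨fun x y ↦ ?_, fun y ↦ ⟨?_, ?_⟩, hX⟩
  -- For the maps induced by T, S, T in succession, both consecutive composites are equivalences: ST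
  -- is equivalent to the identity everywhere, and id → TS is invertible at T(x) and T(y).
  · refine isHomotopyEquiv_of_two_out_of_six (mapSpaceMap T x y)
      (mapSpaceMap S (T.app _ x) (T.app _ y))
      (mapSpaceMap T (S.app _ (T.app _ x)) (S.app _ (T.app _ y))) ?_ ?_
    · exact isHomotopyEquiv_mapSpaceMap h h₀ h₁ x y (hh x) (hh y)
    · exact isHomotopyEquiv_mapSpaceMap h' h₀' h₁' _ _ (hTx' x) (hTx' y)
  · rintro ⟨x, hx⟩
    obtain ⟨X, hX⟩ := hTx x
    exact ⟨_, ha X, hX.symm.trans hx⟩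
  · rintro ⟨X, hX', hy⟩
    obtain ⟨x, hx⟩ := (hX X).2 hX'
    exact ⟨x, hx.trans hy⟩

end Criterion

end InftyCat

/-! ### Quasi-isomorphisms of complexes of vector spaces in terms of elements -/

namespace CochainComplex

variable {k : Type u} [Field k]

lemma exists_iCycles_eq (K : CochainComplex (ModuleCat.{u} k) ℤ) {m n : ℤ} (h : m + 1 = n)
    (x : K.X m) (hx : (K.d m n).hom x = 0) : ∃ c : K.cycles m, (K.iCycles m).hom c = x := by
  have hn : (ComplexShape.up ℤ).next m = n := by simp [h]
  have := ShortComplex.exact_of_f_is_kernel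
    (ShortComplex.mk (K.iCycles m) (K.d m n) (by simp)) (K.cyclesIsKernel m n hn)
  exact (ShortComplex.moduleCat_exact_iff _).1 this x hx

lemma homologyπ_eq_zero_iff (K : CochainComplex (ModuleCat.{u} k) ℤ) {m n : ℤ} (h : m + 1 = n)
    (c : K.cycles n) : (K.homologyπ n).hom c = 0 ↔
      ∃ y : K.X m, (K.d m n).hom y = (K.iCycles n).hom c := by
  have hm : (ComplexShape.up ℤ).prev n = m := by simp [← h]
  have hex := ShortComplex.exact_of_g_is_cokernel
    (ShortComplex.mk (K.toCycles m n) (K.homologyπ n) (by simp)) (K.homologyIsCokernel m n hm)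
  have hi : Function.Injective (K.iCycles n).hom := (ModuleCat.mono_iff_injective _).1 inferInstance
  constructor
  · intro hc
    obtain ⟨y, hy⟩ := (ShortComplex.moduleCat_exact_iff _).1 hex c hc
    refine ⟨y, ?_⟩
    rw [← hy]
    exact congr($(K.toCycles_i m n).hom y).symm
  · rintro ⟨y, hy⟩
    have : (K.toCycles m n).hom y = c :=
      hi ((congr($(K.toCycles_i m n).hom y)).trans hy)
    rw [← this]
    exact congr($(K.toCycles_comp_homologyπ m n).hom y)

/-- A morphism is a quasi-isomorphism if and only if the (shifted) cocycles of its cone are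
coboundaries. -/
lemma quasiIso_iff_elements {X Y : CochainComplex (ModuleCat.{u} k) ℤ} (f : X ⟶ Y) :
    QuasiIso f ↔ ∀ (l m n o : ℤ) (_ : l + 1 = m) (_ : m + 1 = n) (_ : n + 1 = o)
      (x : X.X n) (y : Y.X m), (X.d n o).hom x = 0 → (f.f n).hom x = (Y.d m n).hom y →
      ∃ (x' : X.X m) (y' : Y.X l), (X.d m n).hom x' = x ∧
        (f.f m).hom x' + (Y.d l m).hom y' = y := by
  have hinj (m n : ℤ) (h : m + 1 = n) : Mono (HomologicalComplex.homologyMap f n) ↔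
      ∀ (x : X.X n) (y : Y.X m), (X.d n (n + 1)).hom x = 0 → (f.f n).hom x = (Y.d m n).hom y →
        ∃ x' : X.X m, (X.d m n).hom x' = x := by
    rw [ModuleCat.mono_iff_injective]
    constructor
    · intro H x y hx hxy
      obtain ⟨c, rfl⟩ := exists_iCycles_eq X rfl x hx
      refine (homologyπ_eq_zero_iff X h c).1 (H ?_)
      rw [map_zero]
      have e := congr($(HomologicalComplex.homologyπ_naturality f n).hom c)
      refine e.trans ((homologyπ_eq_zero_iff Y h _).2 ⟨y, ?_⟩)
      rw [← hxy]
      exact congr($(HomologicalComplex.cyclesMap_i f n).hom c).symm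
    · intro H
      rw [injective_iff_map_eq_zero]
      intro z hz
      obtain ⟨c, rfl⟩ := (ModuleCat.epi_iff_surjective (X.homologyπ n)).1 inferInstance z
      have e := congr($(HomologicalComplex.homologyπ_naturality f n).hom c)
      obtain ⟨y, hy⟩ := (homologyπ_eq_zero_iff Y h _).1 (e.symm.trans hz)
      have e' := congr($(HomologicalComplex.cyclesMap_i f n).hom c)
      exact (homologyπ_eq_zero_iff X h c).2 (H _ y
        congr($(X.iCycles_d n (n + 1)).hom c) (e'.symm.trans hy.symm))
  have hsurj (l m n : ℤ) (h : l + 1 = m) (h' : m + 1 = n) :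
      Epi (HomologicalComplex.homologyMap f m) ↔
      ∀ (y : Y.X m), (Y.d m n).hom y = 0 → ∃ (x' : X.X m) (y' : Y.X l), (X.d m n).hom x' = 0 ∧
        (f.f m).hom x' + (Y.d l m).hom y' = y := by
    rw [ModuleCat.epi_iff_surjective]
    constructor
    · intro H y hy
      obtain ⟨c, rfl⟩ := exists_iCycles_eq Y h' y hy
      obtain ⟨z, hz⟩ := H ((Y.homologyπ m).hom c)
      obtain ⟨b, rfl⟩ := (ModuleCat.epi_iff_surjective (X.homologyπ m)).1 inferInstance z
      have e := congr($(HomologicalComplex.homologyπ_naturality f m).hom b)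
      have e₁ : (Y.homologyπ m).hom (c - (HomologicalComplex.cyclesMap f m).hom b) = 0 := by
        rw [map_sub, sub_eq_zero]
        exact hz.symm.trans e
      obtain ⟨y', hy'⟩ := (homologyπ_eq_zero_iff Y h _).1 e₁
      refine ⟨(X.iCycles m).hom b, y', congr($(X.iCycles_d m n).hom b), ?_⟩
      have e' : (Y.iCycles m).hom ((HomologicalComplex.cyclesMap f m).hom b) = _ :=
        congr($(HomologicalComplex.cyclesMap_i f m).hom b)
      rw [hy', map_sub, e']
      exact add_sub_cancel _ _
    · intro H z
      obtain ⟨c, rfl⟩ := (ModuleCat.epi_iff_surjective (Y.homologyπ m)).1 inferInstance z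
      obtain ⟨x', y', hx', hxy⟩ := H ((Y.iCycles m).hom c) congr($(Y.iCycles_d m n).hom c)
      obtain ⟨b, rfl⟩ := exists_iCycles_eq X h' x' hx'
      refine ⟨(X.homologyπ m).hom b, ?_⟩
      have e := congr($(HomologicalComplex.homologyπ_naturality f m).hom b)
      refine e.trans ?_
      have e₁ : (Y.homologyπ m).hom (c - (HomologicalComplex.cyclesMap f m).hom b) = 0 := by
        refine (homologyπ_eq_zero_iff Y h _).2 ⟨y', ?_⟩
        have e' : (Y.iCycles m).hom ((HomologicalComplex.cyclesMap f m).hom b) = _ :=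
          congr($(HomologicalComplex.cyclesMap_i f m).hom b)
        rw [map_sub, e', ← hxy]
        exact (add_sub_cancel_left _ _).symm
      rw [map_sub, sub_eq_zero] at e₁
      exact e₁.symm
  rw [quasiIso_iff]
  simp only [quasiIsoAt_iff_isIso_homologyMap]
  constructor
  · rintro H l m n _ h₁ h₂ rfl x y hx hxy
    obtain ⟨a, rfl⟩ := (hinj m n h₂).1 inferInstance x y hx hxy
    obtain ⟨b, y', hb, hy⟩ := (hsurj l m n h₁ h₂).1 inferInstance (y - (f.f m).hom a) (by
      rw [map_sub, ← hxy, sub_eq_zero]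
      exact congr($(f.comm m n).hom a).symm)
    refine ⟨a + b, y', by rw [map_add, hb, add_zero], ?_⟩
    rw [map_add, add_assoc, hy, add_sub_cancel]
  · intro H i
    have := (hinj (i - 1) i (by lia)).2 (fun x y hx hxy ↦ by
      obtain ⟨x', y', h, -⟩ := H (i - 2) (i - 1) i (i + 1) (by lia) (by lia) rfl x y hx hxy
      exact ⟨x', h⟩)
    -- Surjectivity on homology is the case x = 0 of the condition on the cone.
    have := (hsurj (i - 1) i (i + 1) (by lia) rfl).2 (fun y hy ↦ by
      obtain ⟨x', y', h⟩ := H (i - 1) i (i + 1) (i + 1 + 1) (by lia) (by lia) rfl 0 y (by simp)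
        (by rw [hy, map_zero])
      exact ⟨x', y', h⟩)
    exact isIso_of_mono_of_epi _

end CochainComplex

/-! ### Transition maps on elements -/

namespace FilteredComplex

variable {k : Type u} [Field k]

open Classical in
/-- The transition map `F^i ⟶ F^j` in degree `a = b`, extended by zero to all indices. -/
noncomputable def tr (F : FilteredComplex k) (i j a b : ℤ) : (F.obj i).X a →ₗ[k] (F.obj j).X b :=
  if h : i ≤ j ∧ a = b then
    ((F.map (homOfLE h.1)).f a ≫ eqToHom (congrArg (F.obj j).X h.2)).hom else 0

variable (F : FilteredComplex k) {F' : FilteredComplex k}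

lemma tr_eq_map {i j : ℤ} (h : i ≤ j) (a : ℤ) :
    F.tr i j a a = ((F.map (homOfLE h)).f a).hom := by
  rw [tr, dif_pos ⟨h, rfl⟩, eqToHom_refl, Category.comp_id]

@[simp]
lemma tr_self (i a : ℤ) (x : (F.obj i).X a) : F.tr i i a a x = x := by
  rw [tr_eq_map F le_rfl]
  have : homOfLE (le_refl i) = 𝟙 i := rfl
  rw [this, F.map_id]
  rfl

lemma tr_eq_zero {i j a b : ℤ} (h : ¬ (i ≤ j ∧ a = b)) (x : (F.obj i).X a) :
    F.tr i j a b x = 0 := by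
  rw [tr, dif_neg h, LinearMap.zero_apply]

lemma tr_tr {i j l a b c : ℤ} (h : i ≤ j) (h' : j ≤ l) (hab : a = b) (x : (F.obj i).X a) :
    F.tr j l b c (F.tr i j a b x) = F.tr i l a c x := by
  subst hab
  by_cases hc : a = c
  · subst hc
    rw [tr_eq_map F h, tr_eq_map F h', tr_eq_map F (h.trans h')]
    have : homOfLE (h.trans h') = homOfLE h ≫ homOfLE h' := rfl
    rw [this, F.map_comp]
    rfl
  · rw [tr_eq_zero F (by tauto), tr_eq_zero F (by tauto)]

/-- The hypothesis only says that both differentials have the same degree. Outside the range where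
the transition map is defined, both sides vanish; thus index bookkeeping is left to arithmetic. -/
lemma d_tr {i j a b a' b' : ℤ} (h : a' - a = b' - b) (x : (F.obj i).X a) :
    ((F.obj j).d b b').hom (F.tr i j a b x) = F.tr i j a' b' (((F.obj i).d a a').hom x) := by
  by_cases hc : i ≤ j ∧ a = b
  · obtain ⟨hij, rfl⟩ := hc
    obtain rfl : a' = b' := by lia
    rw [tr_eq_map F hij, tr_eq_map F hij]
    exact congr($((F.map (homOfLE hij)).comm a a').hom x)
  · rw [tr_eq_zero F hc, tr_eq_zero F (by lia), map_zero]

lemma app_tr (φ : F ⟶ F') (i j a b : ℤ) (x : (F.obj i).X a) :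
    ((φ.app j).f b).hom (F.tr i j a b x) = F'.tr i j a b (((φ.app i).f a).hom x) := by
  by_cases hc : i ≤ j ∧ a = b
  · obtain ⟨hij, rfl⟩ := hc
    rw [tr_eq_map F hij, tr_eq_map F' hij]
    exact congr($(φ.naturality (homOfLE hij)).f a |>.hom x)
  · rw [tr_eq_zero F hc, tr_eq_zero F' hc, map_zero]

lemma d_d (K : CochainComplex (ModuleCat.{u} k) ℤ) (a b c : ℤ) (x : K.X a) :
    (K.d b c).hom ((K.d a b).hom x) = 0 :=
  congr($(K.d_comp_d a b c).hom x)

lemma d_eq_zero (K : CochainComplex (ModuleCat.{u} k) ℤ) {a b : ℤ} (h : a + 1 ≠ b) (x : K.X a) :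
    (K.d a b).hom x = 0 := by
  rw [K.shape a b h]
  rfl

/-! ### The graded mixed complex attached to a filtered complex -/

variable (k) in
/-- The graded mixed complex attached to a filtered complex `F`: its part of weight `p` is the
shifted cone of `F^{-p-1} ⟶ F^{-p}`, and the mixed structure is the connecting morphism. -/
noncomputable def toMixedObj (F : FilteredComplex k) : GradedMixedComplex k where
  E p :=
    { X n := ModuleCat.of k ((F.obj (-p - 1)).X (n + 2 * p + 1) × (F.obj (-p)).X (n + 2 * p))
      d n n' := ModuleCat.ofHom (LinearMap.prod
        (-((F.obj (-p - 1)).d (n + 2 * p + 1) (n' + 2 * p + 1)).hom ∘ₗ LinearMap.fst _ _ _)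
        (F.tr (-p - 1) (-p) (n + 2 * p + 1) (n' + 2 * p) ∘ₗ LinearMap.fst _ _ _ +
          ((F.obj (-p)).d (n + 2 * p) (n' + 2 * p)).hom ∘ₗ LinearMap.snd _ _ _))
      shape n n' h := by
        have h' : n + 1 ≠ n' := h
        refine ModuleCat.hom_ext (LinearMap.ext fun x ↦ Prod.ext ?_ ?_)
        · show -((F.obj (-p - 1)).d (n + 2 * p + 1) (n' + 2 * p + 1)).hom x.1 = 0
          rw [d_eq_zero _ (by lia), neg_zero]
        · show F.tr (-p - 1) (-p) (n + 2 * p + 1) (n' + 2 * p) x.1 +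
            ((F.obj (-p)).d (n + 2 * p) (n' + 2 * p)).hom x.2 = 0
          rw [d_eq_zero _ (by lia), tr_eq_zero _ (by lia), add_zero]
      d_comp_d' n n' n'' h h' := by
        obtain rfl : n + 1 = n' := h
        obtain rfl : n + 1 + 1 = n'' := h'
        refine ModuleCat.hom_ext (LinearMap.ext fun x ↦ Prod.ext ?_ ?_)
        · show -((F.obj (-p - 1)).d (n + 1 + 2 * p + 1) (n + 1 + 1 + 2 * p + 1)).hom
            (-((F.obj (-p - 1)).d (n + 2 * p + 1) (n + 1 + 2 * p + 1)).hom x.1) = 0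
          rw [map_neg, d_d, neg_zero, neg_zero]
        · show F.tr (-p - 1) (-p) (n + 1 + 2 * p + 1) (n + 1 + 1 + 2 * p)
              (-((F.obj (-p - 1)).d (n + 2 * p + 1) (n + 1 + 2 * p + 1)).hom x.1) +
            ((F.obj (-p)).d (n + 1 + 2 * p) (n + 1 + 1 + 2 * p)).hom
              (F.tr (-p - 1) (-p) (n + 2 * p + 1) (n + 1 + 2 * p) x.1 +
            ((F.obj (-p)).d (n + 2 * p) (n + 1 + 2 * p)).hom x.2) = 0
          rw [map_add, d_d, add_zero, map_neg, d_tr F (a' := n + 1 + 2 * p + 1) (by lia),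
            neg_add_cancel] }
  -- With p' = p + 1 and n' = n - 1, the factor F^{-p-1} in degree n + 2p + 1 is literally the
  -- second factor of weight p'. The value has no first component and only the first component of
  -- the argument is used, so the square is zero. The sign makes it anticommute with the
  -- differentials.
  ε p p' n n' := open Classical in if p + 1 = p' then
    ModuleCat.ofHom (LinearMap.prod 0
      (-F.tr (-p - 1) (-p') (n + 2 * p + 1) (n' + 2 * p') ∘ₗ LinearMap.fst _ _ _)) else 0
  shape p p' n n' h := by
    split_ifs with hp
    · refine ModuleCat.hom_ext (LinearMap.ext fun x ↦ Prod.ext rfl ?_)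
      show -F.tr (-p - 1) (-p') (n + 2 * p + 1) (n' + 2 * p') x.1 = 0
      rw [tr_eq_zero _ (by lia), neg_zero]
    · rfl
  d_ε p p' a b c e hab hea hcb := by
    split_ifs with hp
    · refine ModuleCat.hom_ext (LinearMap.ext fun x ↦ Prod.ext ?_ ?_)
      · show 0 + -((F.obj (-p' - 1)).d (e + 2 * p' + 1) (c + 2 * p' + 1)).hom 0 = 0
        rw [map_zero, neg_zero, add_zero]
      · show -F.tr (-p - 1) (-p') (b + 2 * p + 1) (c + 2 * p')
            (-((F.obj (-p - 1)).d (a + 2 * p + 1) (b + 2 * p + 1)).hom x.1) +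
          (F.tr (-p' - 1) (-p') (e + 2 * p' + 1) (c + 2 * p') 0 +
            ((F.obj (-p')).d (e + 2 * p') (c + 2 * p')).hom
              (-F.tr (-p - 1) (-p') (a + 2 * p + 1) (e + 2 * p') x.1)) = 0
        rw [map_zero, zero_add, map_neg, map_neg, neg_neg,
          d_tr F (a' := b + 2 * p + 1) (by lia), add_neg_cancel]
    · simp
  ε_ε p p' p'' a b c := by
    split_ifs with hp hp'
    · refine ModuleCat.hom_ext (LinearMap.ext fun x ↦ Prod.ext rfl ?_)
      show -F.tr (-p' - 1) (-p'') (b + 2 * p' + 1) (c + 2 * p'') 0 = 0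
      rw [map_zero, neg_zero]
    · simp
    · simp
    · simp

lemma toMixedObj_ε_fst (p p' n n' : ℤ) (x : ((toMixedObj k F).E p).X n) :
    (((toMixedObj k F).ε p p' n n').hom x).1 = 0 := by
  by_cases h : p + 1 = p'
  · simp only [toMixedObj, if_pos h]
    rfl
  · simp only [toMixedObj, if_neg h]
    rfl

lemma toMixedObj_ε_snd {p p' : ℤ} (h : p + 1 = p') (n n' : ℤ) (x : ((toMixedObj k F).E p).X n) :
    (((toMixedObj k F).ε p p' n n').hom x).2 =
      -F.tr (-p - 1) (-p') (n + 2 * p + 1) (n' + 2 * p') x.1 := by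
  simp only [toMixedObj, if_pos h]
  rfl

variable (k) in
/-- The functor attaching a graded mixed complex to a filtered complex. -/
noncomputable def toMixed : FilteredComplex k ⥤ GradedMixedComplex k where
  obj F := toMixedObj k F
  map {F F'} φ :=
    { f p :=
        { f n := ModuleCat.ofHom (LinearMap.prodMap ((φ.app (-p - 1)).f (n + 2 * p + 1)).hom
            ((φ.app (-p)).f (n + 2 * p)).hom)
          comm' n n' _ := by
            ext x
            have h₁ := congr($((φ.app (-p - 1)).comm (n + 2 * p + 1) (n' + 2 * p + 1)).hom x.1)
            have h₂ := congr($((φ.app (-p)).comm (n + 2 * p) (n' + 2 * p)).hom x.2)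
            simp only [ModuleCat.hom_comp, LinearMap.comp_apply] at h₁ h₂
            refine Prod.ext ?_ ?_
            · show -((F'.obj (-p - 1)).d (n + 2 * p + 1) (n' + 2 * p + 1)).hom
                  (((φ.app (-p - 1)).f (n + 2 * p + 1)).hom x.1) =
                ((φ.app (-p - 1)).f (n' + 2 * p + 1)).hom
                  (-((F.obj (-p - 1)).d (n + 2 * p + 1) (n' + 2 * p + 1)).hom x.1)
              rw [h₁, map_neg]
            · show F'.tr (-p - 1) (-p) (n + 2 * p + 1) (n' + 2 * p)
                  (((φ.app (-p - 1)).f (n + 2 * p + 1)).hom x.1) +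
                ((F'.obj (-p)).d (n + 2 * p) (n' + 2 * p)).hom
                  (((φ.app (-p)).f (n + 2 * p)).hom x.2) =
                ((φ.app (-p)).f (n' + 2 * p)).hom
                  (F.tr (-p - 1) (-p) (n + 2 * p + 1) (n' + 2 * p) x.1 +
                    ((F.obj (-p)).d (n + 2 * p) (n' + 2 * p)).hom x.2)
              rw [h₂, map_add, app_tr] }
      comm p p' n n' := by
        by_cases hp : p + 1 = p'
        · refine ModuleCat.hom_ext (LinearMap.ext fun x ↦ Prod.ext ?_ ?_)
          · show ((φ.app (-p' - 1)).f (n' + 2 * p' + 1)).hom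
              (((toMixedObj k F).ε p p' n n').hom x).1 = (((toMixedObj k F').ε p p' n n').hom _).1
            rw [toMixedObj_ε_fst, toMixedObj_ε_fst, map_zero]
          · show ((φ.app (-p')).f (n' + 2 * p')).hom
              (((toMixedObj k F).ε p p' n n').hom x).2 = (((toMixedObj k F').ε p p' n n').hom _).2
            rw [toMixedObj_ε_snd _ hp, toMixedObj_ε_snd _ hp, map_neg, app_tr]
            rfl
        · rw [GradedMixedComplex.shape _ _ _ _ _ (by tauto),
            GradedMixedComplex.shape _ _ _ _ _ (by tauto), zero_comp, comp_zero] }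

/-- The five lemma for cones, in elements: solve for the component in F^{-p-1} first, then correct
the equation in F^{-p} by its image. -/
lemma toMixed_map_quasiIso (φ : F ⟶ F') (hφ : quasiIso k φ) :
    GradedMixedComplex.quasiIso k ((toMixed k).map φ) := by
  intro p
  rw [CochainComplex.quasiIso_iff_elements]
  rintro l m n o rfl rfl rfl x y hx hxy
  have hx₁ := congrArg Prod.fst hx
  have hx₂ := congrArg Prod.snd hx
  have hy₁ := congrArg Prod.fst hxy
  have hy₂ := congrArg Prod.snd hxy
  have e₁ : -((F.obj (-p - 1)).d _ (l + 1 + 1 + 1 + 2 * p + 1)).hom x.1 = 0 := hx₁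
  have e₂ : F.tr (-p - 1) (-p) _ (l + 1 + 1 + 1 + 2 * p) x.1 +
    ((F.obj (-p)).d (l + 1 + 1 + 2 * p) (l + 1 + 1 + 1 + 2 * p)).hom x.2 = 0 := hx₂
  have e₃ : ((φ.app (-p - 1)).f (l + 1 + 1 + 2 * p + 1)).hom x.1 =
    -((F'.obj (-p - 1)).d (l + 1 + 2 * p + 1) (l + 1 + 1 + 2 * p + 1)).hom y.1 := hy₁
  have e₄ : ((φ.app (-p)).f (l + 1 + 1 + 2 * p)).hom x.2 =
    F'.tr (-p - 1) (-p) (l + 1 + 2 * p + 1) (l + 1 + 1 + 2 * p) y.1 +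
      ((F'.obj (-p)).d (l + 1 + 2 * p) (l + 1 + 1 + 2 * p)).hom y.2 := hy₂
  obtain ⟨a, a', ha, ha'⟩ := (CochainComplex.quasiIso_iff_elements _).1 (hφ (-p - 1))
    (l + 2 * p + 1) (l + 1 + 2 * p + 1) (l + 1 + 1 + 2 * p + 1) (l + 1 + 1 + 1 + 2 * p + 1)
    (by lia) (by lia) (by lia) x.1 (-y.1) (by simpa using e₁) (by rw [e₃, map_neg])
  obtain ⟨b, b', hb, hb'⟩ := (CochainComplex.quasiIso_iff_elements _).1 (hφ (-p))
    (l + 2 * p) (l + 1 + 2 * p) (l + 1 + 1 + 2 * p) (l + 1 + 1 + 1 + 2 * p)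
    (by lia) (by lia) (by lia)
    (x.2 + F.tr (-p - 1) (-p) (l + 1 + 2 * p + 1) (l + 1 + 1 + 2 * p) a)
    (y.2 - F'.tr (-p - 1) (-p) (l + 2 * p + 1) (l + 1 + 2 * p) a') (by
      rw [map_add, d_tr F (a' := l + 1 + 1 + 2 * p + 1) (by lia), ha]
      exact (add_comm _ _).trans e₂) (by
      rw [map_add, map_sub, e₄, app_tr, d_tr F' (a' := l + 1 + 2 * p + 1) (by lia),
        eq_sub_of_add_eq ha', map_sub, map_neg]
      abel)
  refine ⟨(-a, b), (a', b'), Prod.ext ?_ ?_, Prod.ext ?_ ?_⟩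
  · show -((F.obj (-p - 1)).d _ _).hom (-a) = x.1
    rw [map_neg, neg_neg, ha]
  · show F.tr (-p - 1) (-p) _ _ (-a) + ((F.obj (-p)).d _ _).hom b = x.2
    rw [map_neg, hb]
    exact (add_comm _ _).trans (add_neg_cancel_right _ _)
  · show ((φ.app (-p - 1)).f _).hom (-a) + -((F'.obj (-p - 1)).d _ _).hom a' = y.1
    rw [map_neg, ← neg_add]
    exact neg_eq_iff_eq_neg.2 ha'
  · show ((φ.app (-p)).f _).hom b + (F'.tr (-p - 1) (-p) _ _ a' +
      ((F'.obj (-p)).d _ _).hom b') = y.2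
    rw [add_left_comm, hb']
    exact add_sub_cancel _ _

end FilteredComplex

/-! ### The comparison of a graded mixed complex with that of its Tate realization -/

namespace GradedMixedComplex

variable {k : Type u} [Field k]

open FilteredComplex

open Classical in
/-- The identity `E(p)^a ⟶ E(q)^b` for `p = q` and `a = b`, extended by zero to all indices. -/
noncomputable def cst (E : GradedMixedComplex k) (p q a b : ℤ) :
    (E.E p).X a →ₗ[k] (E.E q).X b :=
  if h : p = q ∧ a = b then
    (eqToHom (show (E.E p).X a = (E.E q).X b by rw [h.1, h.2])).hom else 0

variable (E : GradedMixedComplex k) {E' : GradedMixedComplex k}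

@[simp]
lemma cst_self (p a : ℤ) (x : (E.E p).X a) : E.cst p p a a x = x := by
  rw [cst, dif_pos ⟨rfl, rfl⟩]
  rfl

lemma cst_eq_zero {p q a b : ℤ} (h : ¬ (p = q ∧ a = b)) (x : (E.E p).X a) :
    E.cst p q a b x = 0 := by
  rw [cst, dif_neg h, LinearMap.zero_apply]

lemma ε_eq_zero {p q a b : ℤ} (h : ¬ (p + 1 = q ∧ b + 1 = a)) (x : (E.E p).X a) :
    (E.ε p q a b).hom x = 0 := by
  rw [E.shape _ _ _ _ h]
  rfl

lemma cst_cst {p q r a b c : ℤ} (h : p = q ∧ a = b) (x : (E.E p).X a) :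
    E.cst q r b c (E.cst p q a b x) = E.cst p r a c x := by
  obtain ⟨rfl, rfl⟩ := h
  rw [cst_self]

lemma d_cst {p q a b a' b' : ℤ} (h : a' - a = b' - b) (x : (E.E p).X a) :
    ((E.E q).d b b').hom (E.cst p q a b x) = E.cst p q a' b' (((E.E p).d a a').hom x) := by
  by_cases hc : p = q ∧ a = b
  · obtain ⟨rfl, rfl⟩ := hc
    obtain rfl : a' = b' := by lia
    rw [cst_self, cst_self]
  · rw [cst_eq_zero _ hc, cst_eq_zero _ (by lia), map_zero]

lemma ε_cst {p q r a b c : ℤ} (h : p = q ∧ a = b) (x : (E.E p).X a) :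
    (E.ε q r b c).hom (E.cst p q a b x) = (E.ε p r a c).hom x := by
  obtain ⟨rfl, rfl⟩ := h
  rw [cst_self]

lemma cst_ε {p q r a b c : ℤ} (h : q = r ∧ b = c) (x : (E.E p).X a) :
    E.cst q r b c ((E.ε p q a b).hom x) = (E.ε p r a c).hom x := by
  obtain ⟨rfl, rfl⟩ := h
  rw [cst_self]

lemma ε_ε_apply (p q r a b c : ℤ) (x : (E.E p).X a) :
    (E.ε q r b c).hom ((E.ε p q a b).hom x) = 0 :=
  congr($(E.ε_ε p q r a b c).hom x)

lemma d_ε_apply {p q a b c e : ℤ} (hab : a + 1 = b) (hec : e + 1 = c) (x : (E.E p).X a) :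
    ((E.E q).d e c).hom ((E.ε p q a e).hom x) =
      -(E.ε p q b c).hom (((E.E p).d a b).hom x) := by
  by_cases hc : e + 1 = a
  · have := congr($(E.d_ε p q a b c e hab hc (by lia)).hom x)
    exact eq_neg_of_add_eq_zero_right this
  · rw [ε_eq_zero _ (by lia), ε_eq_zero _ (by lia), map_zero, neg_zero]

lemma f_cst (φ : E ⟶ E') (p q a b : ℤ) (x : (E.E p).X a) :
    ((φ.f q).f b).hom (E.cst p q a b x) = E'.cst p q a b (((φ.f p).f a).hom x) := by
  by_cases hc : p = q ∧ a = b
  · obtain ⟨rfl, rfl⟩ := hc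
    rw [cst_self, cst_self]
  · rw [cst_eq_zero _ hc, cst_eq_zero _ hc, map_zero]

lemma f_ε (φ : E ⟶ E') (p q a b : ℤ) (x : (E.E p).X a) :
    ((φ.f q).f b).hom ((E.ε p q a b).hom x) = (E'.ε p q a b).hom (((φ.f p).f a).hom x) :=
  congr($(φ.comm p q a b).hom x)

lemma tateObj_ext {i m : ℤ} {x y : (E.tateObj.obj i).X m} (h : ∀ p, x.1 p = y.1 p) : x = y :=
  Subtype.ext (funext h)

lemma tateObj_tr {i j : ℤ} (hij : i ≤ j) (m m' : ℤ) (x : (E.tateObj.obj i).X m) (p : ℤ) :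
    (E.tateObj.tr i j m m' x).1 p = E.cst p p (m - 2 * p) (m' - 2 * p) (x.1 p) := by
  by_cases hm : m = m'
  · subst hm
    rw [cst_self, tr_eq_map _ hij]
    rfl
  · rw [tr_eq_zero _ (by tauto), cst_eq_zero _ (by lia)]
    rfl

/-- The natural map from `E` to the graded mixed complex attached to its Tate realization, in
weight `p` and degree `n`. -/
noncomputable def toMixedTateApp (p n : ℤ) :
    (E.E p).X n →ₗ[k] ((toMixedObj k E.tateObj).E p).X n where
  -- The element x is placed in position p of F^{-p}, where its total differential is dx + εx. The
  -- first component -εx, placed in position p + 1 of F^{-p-1}, cancels the term εx in the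
  -- differential of the cone.
  toFun x := (⟨fun q ↦ -(E.ε p q n (n + 2 * p + 1 - 2 * q)).hom x, fun q hq ↦ by
      beta_reduce
      rw [ε_eq_zero _ (by lia), neg_zero]⟩,
    ⟨fun q ↦ E.cst p q n (n + 2 * p - 2 * q) x, fun q hq ↦ E.cst_eq_zero (by lia) x⟩)
  map_add' x y := by
    refine Prod.ext (tateObj_ext _ fun q ↦ ?_) (tateObj_ext _ fun q ↦ map_add _ _ _)
    show -(E.ε p q n (n + 2 * p + 1 - 2 * q)).hom (x + y) =
      -(E.ε p q n (n + 2 * p + 1 - 2 * q)).hom x + -(E.ε p q n (n + 2 * p + 1 - 2 * q)).hom y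
    rw [map_add, neg_add]
  map_smul' c x := by
    refine Prod.ext (tateObj_ext _ fun q ↦ ?_) (tateObj_ext _ fun q ↦ map_smul _ _ _)
    show -(E.ε p q n (n + 2 * p + 1 - 2 * q)).hom (c • x) =
      c • -(E.ε p q n (n + 2 * p + 1 - 2 * q)).hom x
    rw [map_smul, smul_neg]

/-- The natural map from `E` to the graded mixed complex attached to its Tate realization. -/
noncomputable def toMixedTate : E ⟶ (toMixed k).obj E.tateObj where
  f p :=
    { f n := ModuleCat.ofHom (E.toMixedTateApp p n)
      comm' n n' h := by
        obtain rfl : n + 1 = n' := h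
        refine ModuleCat.hom_ext (LinearMap.ext fun x ↦
          Prod.ext (tateObj_ext _ fun q ↦ ?_) (tateObj_ext _ fun q ↦ ?_))
        · show -(((E.E q).d (n + 2 * p + 1 - 2 * q) (n + 1 + 2 * p + 1 - 2 * q)).hom
              (-(E.ε p q n (n + 2 * p + 1 - 2 * q)).hom x) +
            (E.ε (q - 1) q (n + 2 * p + 1 - 2 * (q - 1)) (n + 1 + 2 * p + 1 - 2 * q)).hom
              (-(E.ε p (q - 1) n (n + 2 * p + 1 - 2 * (q - 1))).hom x)) =
            -(E.ε p q (n + 1) (n + 1 + 2 * p + 1 - 2 * q)).hom (((E.E p).d n (n + 1)).hom x)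
          rw [map_neg, map_neg, ε_ε_apply, neg_zero, add_zero, d_ε_apply E rfl (by lia), neg_neg]
        · show (E.tateObj.tr (-p - 1) (-p) (n + 2 * p + 1) (n + 1 + 2 * p)
              (E.toMixedTateApp p n x).1).1 q +
            (((E.E q).d (n + 2 * p - 2 * q) (n + 1 + 2 * p - 2 * q)).hom
              (E.cst p q n (n + 2 * p - 2 * q) x) +
            (E.ε (q - 1) q (n + 2 * p - 2 * (q - 1)) (n + 1 + 2 * p - 2 * q)).hom
              (E.cst p (q - 1) n (n + 2 * p - 2 * (q - 1)) x)) =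
            E.cst p q (n + 1) (n + 1 + 2 * p - 2 * q) (((E.E p).d n (n + 1)).hom x)
          rw [tateObj_tr _ (by lia), d_cst E (a' := n + 1) (by lia)]
          show E.cst q q _ _ (-(E.ε p q n (n + 2 * p + 1 - 2 * q)).hom x) + _ = _
          rw [map_neg, cst_ε E (by lia)]
          by_cases hq : p = q - 1
          · rw [ε_cst E (by lia)]
            abel
          · rw [cst_eq_zero E (by lia : ¬ (p = q - 1 ∧ _)), ε_eq_zero E (by lia)]
            simp }
  comm p p' n n' := by
    by_cases h : p + 1 = p' ∧ n' + 1 = n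
    · obtain ⟨rfl, rfl⟩ := h
      refine ModuleCat.hom_ext (LinearMap.ext fun x ↦ Prod.ext ?_ ?_)
      · refine Eq.trans ?_ (toMixedObj_ε_fst E.tateObj p (p + 1) (n' + 1) n'
          (E.toMixedTateApp p (n' + 1) x)).symm
        refine tateObj_ext _ fun q ↦ ?_
        show -(E.ε (p + 1) q n' _).hom ((E.ε p (p + 1) (n' + 1) n').hom x) = 0
        rw [ε_ε_apply, neg_zero]
      · refine Eq.trans ?_ (toMixedObj_ε_snd E.tateObj rfl (n' + 1) n'
          (E.toMixedTateApp p (n' + 1) x)).symm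
        refine tateObj_ext _ fun q ↦ ?_
        show E.cst (p + 1) q n' (n' + 2 * (p + 1) - 2 * q) ((E.ε p (p + 1) (n' + 1) n').hom x) =
          -(E.tateObj.tr (-p - 1) (-(p + 1)) (n' + 1 + 2 * p + 1) (n' + 2 * (p + 1))
            (E.toMixedTateApp p (n' + 1) x).1).1 q
        rw [tateObj_tr _ (by lia)]
        show _ = -E.cst q q _ _ (-(E.ε p q (n' + 1) (n' + 1 + 2 * p + 1 - 2 * q)).hom x)
        rw [map_neg, neg_neg, cst_ε E (q := q) (r := q) (by lia)]
        by_cases hq : p + 1 = q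
        · rw [cst_ε E (by lia)]
        · rw [cst_eq_zero E (by lia), ε_eq_zero E (by lia)]
    · rw [shape _ _ _ _ _ h, shape _ _ _ _ _ h, zero_comp, comp_zero]

/-- The cone of F^{-p-1}|E|^t ⊂ F^{-p}|E|^t is a resolution of the quotient E(p)[-2p], and the map
is a section of this resolution. An element of the cone is thus determined, up to a boundary, by the
position p of its second component. -/
lemma toMixedTate_f_quasiIso : quasiIso k E.toMixedTate := by
  intro p
  rw [CochainComplex.quasiIso_iff_elements]
  rintro l m n o hlm hmn hno x y hx hxy
  let y₁ : (E.tateObj.obj (-p - 1)).X (m + 2 * p + 1) := y.1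
  let y₂ : (E.tateObj.obj (-p)).X (m + 2 * p) := y.2
  have e₂ (q : ℤ) : E.cst p q n (n + 2 * p - 2 * q) x =
      E.cst q q (m + 2 * p + 1 - 2 * q) (n + 2 * p - 2 * q) (y₁.1 q) +
        (((E.E q).d (m + 2 * p - 2 * q) (n + 2 * p - 2 * q)).hom (y₂.1 q) +
        (E.ε (q - 1) q (m + 2 * p - 2 * (q - 1)) (n + 2 * p - 2 * q)).hom (y₂.1 (q - 1))) := by
    refine (congr_fun (congrArg (fun z ↦ z.2.1) hxy) q).trans ?_
    refine congrArg₂ _ ?_ rfl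
    exact tateObj_tr E (by lia) _ _ y₁ q
  have h₁ (q : ℤ) (hq : q ≤ p) : y₁.1 q = 0 := y₁.2 q (by lia)
  have h₂ (q : ℤ) (hq : q < p) : y₂.1 q = 0 := y₂.2 q (by lia)
  -- The tail of y₂ in positions q > p, seen in F^{-p-1}: its differential in the cone removes these
  -- positions from y₂.
  let a : (E.tateObj.obj (-p - 1)).X (l + 2 * p + 1) :=
    ⟨fun q ↦ if p < q then E.cst q q (m + 2 * p - 2 * q) (l + 2 * p + 1 - 2 * q) (y₂.1 q) else 0,
      fun q hq ↦ if_neg (by lia)⟩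
  refine ⟨E.cst p p (m + 2 * p - 2 * p) m (y₂.1 p), (a, 0), ?_, Prod.ext ?_ ?_⟩
  · have := congrArg (E.cst p p (n + 2 * p - 2 * p) n) (e₂ p)
    rw [h₁ p le_rfl, h₂ (p - 1) (by lia), map_zero, map_zero, zero_add, add_zero,
      cst_cst E (by lia), cst_self] at this
    rw [this, d_cst E]
    lia
  · refine tateObj_ext _ fun q ↦ ?_
    show -(E.ε p q m (m + 2 * p + 1 - 2 * q)).hom
        (E.cst p p (m + 2 * p - 2 * p) m (y₂.1 p)) +
      -(((E.E q).d (l + 2 * p + 1 - 2 * q) (m + 2 * p + 1 - 2 * q)).hom (a.1 q) +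
        (E.ε (q - 1) q (l + 2 * p + 1 - 2 * (q - 1)) (m + 2 * p + 1 - 2 * q)).hom (a.1 (q - 1))) =
      y₁.1 q
    rw [ε_cst E (by lia)]
    have e₃ := congrArg (E.cst q q (n + 2 * p - 2 * q) (m + 2 * p + 1 - 2 * q)) (e₂ q)
    rw [map_add, map_add, cst_cst E (p := q) (q := q) (by lia), cst_self,
      ← d_cst E (a := m + 2 * p - 2 * q) (b := l + 2 * p + 1 - 2 * q) (by lia),
      cst_ε E (by lia)] at e₃
    rcases lt_or_ge p q with hq | hq
    · have hc : E.cst q q (n + 2 * p - 2 * q) (m + 2 * p + 1 - 2 * q)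
          (E.cst p q n (n + 2 * p - 2 * q) x) = 0 := by
        rw [cst_eq_zero E (by lia : ¬ (p = q ∧ _)), map_zero]
      rw [hc] at e₃
      dsimp only [a]
      rw [if_pos hq]
      rcases (show p = q - 1 ∨ p < q - 1 by lia) with rfl | hq'
      · rw [if_neg (by lia), map_zero, add_zero, eq_neg_of_add_eq_zero_left e₃.symm]
        abel
      · rw [if_pos hq', ε_eq_zero E (by lia : ¬ (p + 1 = q ∧ _)), neg_zero, zero_add,
          ε_cst E (by lia)]
        exact (eq_neg_of_add_eq_zero_left e₃.symm).symm
    · rw [h₁ q hq, ε_eq_zero E (by lia)]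
      dsimp only [a]
      rw [if_neg (by lia), if_neg (by lia)]
      simp
  · refine tateObj_ext _ fun q ↦ ?_
    show E.cst p q m (m + 2 * p - 2 * q) (E.cst p p (m + 2 * p - 2 * p) m (y₂.1 p)) +
      ((E.tateObj.tr (-p - 1) (-p) (l + 2 * p + 1) (m + 2 * p) a).1 q +
        (((E.tateObj.obj (-p)).d (l + 2 * p) (m + 2 * p)).hom 0).1 q) = y₂.1 q
    rw [tateObj_tr _ (by lia), map_zero, cst_cst E (by lia)]
    dsimp only [a]
    refine (congrArg₂ _ rfl (add_zero _)).trans ?_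
    rcases lt_trichotomy q p with hq | rfl | hq
    · rw [if_neg (by lia), h₂ q hq, cst_eq_zero E (by lia), map_zero, add_zero]
    · rw [if_neg (by lia), cst_self, map_zero, add_zero]
    · rw [if_pos hq, cst_cst E (by lia), cst_self, cst_eq_zero E (by lia), zero_add]

variable (k) in
/-- The natural transformation from the identity functor to the functor attaching to a graded mixed
complex that of its Tate realization. -/
noncomputable def unitToMixedTate : 𝟭 (GradedMixedComplex k) ⟶ tate k ⋙ toMixed k where
  app E := E.toMixedTate
  naturality E E' φ := by
    refine Hom.ext (funext fun p ↦ ?_)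
    refine HomologicalComplex.hom_ext _ _ fun n ↦ ?_
    refine ModuleCat.hom_ext (LinearMap.ext fun x ↦
      Prod.ext (tateObj_ext _ fun q ↦ ?_) (tateObj_ext _ fun q ↦ ?_))
    · show -(E'.ε p q n (n + 2 * p + 1 - 2 * q)).hom (((φ.f p).f n).hom x) =
        ((φ.f q).f _).hom (-(E.ε p q n (n + 2 * p + 1 - 2 * q)).hom x)
      rw [map_neg, f_ε]
    · exact (f_cst E φ p q n _ x).symm

end GradedMixedComplex

/-! ### The Tate realization preserves quasi-isomorphisms -/

open Classical in
/-- A sequence indexed by the integers, which vanishes below `p₀`, constructed by recursion. -/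
noncomputable def intSeq {V : ℤ → Type*} [∀ p, Zero (V p)] {p₀ : ℤ} {P : ∀ p, V p → Prop}
    {R : ∀ p, V (p - 1) → V p → Prop} (h₀ : ∀ p < p₀, P p 0)
    (step : ∀ p, p₀ ≤ p → ∀ v, P (p - 1) v → ∃ w, P p w ∧ R p v w) (p : ℤ) : {v : V p // P p v} :=
  if h : p < p₀ then ⟨0, h₀ p h⟩ else
    ⟨(step p (not_lt.1 h) (intSeq h₀ step (p - 1)).1 (intSeq h₀ step (p - 1)).2).choose,
      (step p (not_lt.1 h) (intSeq h₀ step (p - 1)).1 (intSeq h₀ step (p - 1)).2).choose_spec.1⟩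
termination_by (p - p₀ + 1).toNat
decreasing_by all_goals lia

/-- Here R is the equation relating consecutive terms, and P is the part of the past which the next
step of the recursion needs. -/
lemma exists_intSeq {V : ℤ → Type*} [∀ p, Zero (V p)] {p₀ : ℤ} {P : ∀ p, V p → Prop}
    {R : ∀ p, V (p - 1) → V p → Prop} (h₀ : ∀ p < p₀, P p 0)
    (step : ∀ p, p₀ ≤ p → ∀ v, P (p - 1) v → ∃ w, P p w ∧ R p v w) :
    ∃ s : ∀ p, V p, (∀ p < p₀, s p = 0) ∧
    ∀ p, p₀ ≤ p → R p (s (p - 1)) (s p) := by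
  refine ⟨fun p ↦ (intSeq h₀ step p).1, fun p hp ↦ ?_, fun p hp ↦ ?_⟩
  · beta_reduce
    rw [intSeq.eq_1 h₀ step p, dif_pos hp]
  · beta_reduce
    rw [intSeq.eq_1 h₀ step p, dif_neg (not_lt.2 hp)]
    exact (step p hp (intSeq h₀ step (p - 1)).1 (intSeq h₀ step (p - 1)).2).choose_spec.2

namespace GradedMixedComplex

variable {k : Type u} [Field k] {E E' : GradedMixedComplex k}

/-- In position p, the total differential involves position p and, through ε, position p - 1 only.
Since positions start at -i, the element is constructed by increasing p, applying the
quasi-isomorphism in weight p at each step. Completeness of the product makes the infinite recursion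
legitimate. -/
lemma tate_map_quasiIso (φ : E ⟶ E') (hφ : quasiIso k φ) :
    FilteredComplex.quasiIso k ((tate k).map φ) := by
  intro i
  rw [CochainComplex.quasiIso_iff_elements]
  rintro l m n o hlm hmn hno x y hx hxy
  have e₁ (p : ℤ) : ((E.E p).d (n - 2 * p) (o - 2 * p)).hom (x.1 p) +
      (E.ε (p - 1) p (n - 2 * (p - 1)) (o - 2 * p)).hom (x.1 (p - 1)) = 0 :=
    congr_fun (congrArg Subtype.val hx) p
  have e₂ (p : ℤ) : ((φ.f p).f (n - 2 * p)).hom (x.1 p) =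
      ((E'.E p).d (m - 2 * p) (n - 2 * p)).hom (y.1 p) +
      (E'.ε (p - 1) p (m - 2 * (p - 1)) (n - 2 * p)).hom (y.1 (p - 1)) :=
    congr_fun (congrArg Subtype.val hxy) p
  obtain ⟨s, hs, hs'⟩ := exists_intSeq (p₀ := -i)
    (V := fun p ↦ (E.E p).X (m - 2 * p) × (E'.E p).X (l - 2 * p))
    -- The equations in position p hold up to values of ε, so they become exact after applying ε, as
    -- ε² = 0. This weaker form does not mention position p - 1, and it is what shows that the
    -- right-hand side in position p + 1 is a cocycle.
    (P := fun p v ↦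
      (∀ q b, (E.ε p q (n - 2 * p) b).hom
        (((E.E p).d (m - 2 * p) (n - 2 * p)).hom v.1) =
          (E.ε p q (n - 2 * p) b).hom (x.1 p)) ∧
      ∀ q b, (E'.ε p q (m - 2 * p) b).hom (((φ.f p).f (m - 2 * p)).hom v.1 +
        ((E'.E p).d (l - 2 * p) (m - 2 * p)).hom v.2) =
          (E'.ε p q (m - 2 * p) b).hom (y.1 p))
    (R := fun p v w ↦
      ((E.E p).d (m - 2 * p) (n - 2 * p)).hom w.1 =
        x.1 p - (E.ε (p - 1) p (m - 2 * (p - 1)) (n - 2 * p)).hom v.1 ∧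
      ((φ.f p).f (m - 2 * p)).hom w.1 + ((E'.E p).d (l - 2 * p) (m - 2 * p)).hom w.2 =
        y.1 p - (E'.ε (p - 1) p (l - 2 * (p - 1)) (m - 2 * p)).hom v.2)
    (fun p hp ↦ ⟨fun q b ↦ by simp [x.2 p hp], fun q b ↦ by simp [y.2 p hp]⟩)
    (fun p hp v hv ↦ by
      obtain ⟨a, b, h₁, h₂⟩ := (CochainComplex.quasiIso_iff_elements _).1 (hφ p)
        (l - 2 * p) (m - 2 * p) (n - 2 * p) (o - 2 * p) (by lia) (by lia) (by lia)
        (x.1 p - (E.ε (p - 1) p (m - 2 * (p - 1)) (n - 2 * p)).hom v.1)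
        (y.1 p - (E'.ε (p - 1) p (l - 2 * (p - 1)) (m - 2 * p)).hom v.2) (by
          rw [map_sub, d_ε_apply E (b := n - 2 * (p - 1)) (by lia) (by lia), sub_neg_eq_add]
          rw [hv.1]
          exact e₁ p) (by
          rw [map_sub, map_sub, e₂, f_ε,
            d_ε_apply E' (b := m - 2 * (p - 1)) (by lia) (by lia)]
          rw [← hv.2, map_add]
          abel)
      refine ⟨(a, b), ⟨fun q c ↦ ?_, fun q c ↦ ?_⟩, h₁, h₂⟩
      · rw [h₁, map_sub, ε_ε_apply, sub_zero]
      · rw [h₂, map_sub, ε_ε_apply, sub_zero])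
  refine ⟨⟨fun p ↦ (s p).1, fun p hp ↦ by beta_reduce; rw [hs p hp]; rfl⟩,
    ⟨fun p ↦ (s p).2, fun p hp ↦ by beta_reduce; rw [hs p hp]; rfl⟩,
    tateObj_ext _ fun p ↦ ?_, tateObj_ext _ fun p ↦ ?_⟩
  · show ((E.E p).d (m - 2 * p) (n - 2 * p)).hom (s p).1 +
      (E.ε (p - 1) p (m - 2 * (p - 1)) (n - 2 * p)).hom (s (p - 1)).1 = x.1 p
    by_cases hp : p < -i
    · rw [hs p hp, hs (p - 1) (by lia), x.2 p hp]
      simp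
    · rw [(hs' p (not_lt.1 hp)).1, sub_add_cancel]
  · show ((φ.f p).f (m - 2 * p)).hom (s p).1 +
      (((E'.E p).d (l - 2 * p) (m - 2 * p)).hom (s p).2 +
      (E'.ε (p - 1) p (l - 2 * (p - 1)) (m - 2 * p)).hom (s (p - 1)).2) = y.1 p
    by_cases hp : p < -i
    · rw [hs p hp, hs (p - 1) (by lia), y.2 p hp]
      simp
    · rw [← add_assoc, (hs' p (not_lt.1 hp)).2, sub_add_cancel]

end GradedMixedComplex

/-! ### A model of the completion of a filtered complex -/

namespace FilteredComplex

variable {k : Type u} [Field k] (F : FilteredComplex k) {F' : FilteredComplex k}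

lemma tr_family {i j a : ℤ} (h : i = j) (c : ∀ j, (F.obj j).X a) : F.tr i j a a (c i) = c j := by
  subst h
  rw [tr_self]

lemma tr_injective {i j a b : ℤ} (h : i = j) (h' : a = b) {x : (F.obj i).X a}
    (hx : F.tr i j a b x = 0) : x = 0 := by
  subst h h'
  rwa [tr_self] at hx

/-- The elements of degree `m` of the completion of `F`: families `(c, b, f)` of elements
`c_j ∈ F^j` of degree `m + 1`, `b_j ∈ F^j` of degree `m` and `f ∈ F^i` of degree `m`, where the
components with `j ≤ i` are arbitrary. -/
def completionSubmodule (i m : ℤ) : Submodule k ((∀ j : ℤ, (F.obj j).X (m + 1)) ×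
    (∀ j : ℤ, (F.obj j).X m) × (F.obj i).X m) where
  -- The cone of holim_{j ≤ i} F^j → F^i, with (c, b) in the shifted homotopy limit. Extending c
  -- past i by its images and b by zero makes the transition maps the identity on (c, b).
  carrier := {x | (∀ j, i ≤ j → x.1 j = F.tr i j (m + 1) (m + 1) (x.1 i)) ∧
    ∀ j, i < j → x.2.1 j = 0}
  zero_mem' := ⟨fun j _ ↦ (map_zero (F.tr i j (m + 1) (m + 1))).symm, fun _ _ ↦ rfl⟩
  add_mem' := fun {x y} hx hy ↦ ⟨fun j hj ↦ by
    show x.1 j + y.1 j = F.tr i j (m + 1) (m + 1) (x.1 i + y.1 i)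
    rw [map_add, hx.1 j hj, hy.1 j hj], fun j hj ↦ by
    show x.2.1 j + y.2.1 j = 0
    rw [hx.2 j hj, hy.2 j hj, add_zero]⟩
  smul_mem' := fun a x hx ↦ ⟨fun j hj ↦ by
    show a • x.1 j = F.tr i j (m + 1) (m + 1) (a • x.1 i)
    rw [map_smul, hx.1 j hj], fun j hj ↦ by
    show a • x.2.1 j = 0
    rw [hx.2 j hj, smul_zero]⟩

variable {F} in
lemma completion_ext {i m : ℤ} {x y : F.completionSubmodule i m} (h₁ : ∀ j, x.1.1 j = y.1.1 j)
    (h₂ : ∀ j, x.1.2.1 j = y.1.2.1 j) (h₃ : x.1.2.2 = y.1.2.2) : x = y :=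
  Subtype.ext (Prod.ext (funext h₁) (Prod.ext (funext h₂) h₃))

/-- The differential of the completion. -/
noncomputable def completionD (i m m' : ℤ) :
    F.completionSubmodule i m →ₗ[k] F.completionSubmodule i m' where
  toFun x := ⟨(fun j ↦ -((F.obj j).d (m + 1) (m' + 1)).hom (x.1.1 j),
    fun j ↦ F.tr (j - 1) j (m + 1) m' (x.1.1 (j - 1)) - F.tr j j (m + 1) m' (x.1.1 j) +
      ((F.obj j).d m m').hom (x.1.2.1 j),
    F.tr i i (m + 1) m' (x.1.1 i) + ((F.obj i).d m m').hom x.1.2.2), by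
      refine ⟨fun j hj ↦ ?_, fun j hj ↦ ?_⟩
      · dsimp only
        rw [map_neg, x.2.1 j hj, d_tr F rfl]
      · dsimp only
        rw [x.2.2 j hj, x.2.1 j hj.le, x.2.1 (j - 1) (by lia), tr_tr F (by lia) (by lia) rfl,
          tr_tr F (by lia) (by lia) rfl, map_zero, sub_self, add_zero]⟩
  map_add' x y := by
    refine completion_ext (fun j ↦ ?_) (fun j ↦ ?_) ?_
    · show -((F.obj j).d (m + 1) (m' + 1)).hom (x.1.1 j + y.1.1 j) =
        -((F.obj j).d (m + 1) (m' + 1)).hom (x.1.1 j) +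
          -((F.obj j).d (m + 1) (m' + 1)).hom (y.1.1 j)
      rw [map_add, neg_add]
    · show F.tr (j - 1) j (m + 1) m' (x.1.1 (j - 1) + y.1.1 (j - 1)) -
          F.tr j j (m + 1) m' (x.1.1 j + y.1.1 j) +
          ((F.obj j).d m m').hom (x.1.2.1 j + y.1.2.1 j) =
        (F.tr (j - 1) j (m + 1) m' (x.1.1 (j - 1)) - F.tr j j (m + 1) m' (x.1.1 j) +
          ((F.obj j).d m m').hom (x.1.2.1 j)) +
        (F.tr (j - 1) j (m + 1) m' (y.1.1 (j - 1)) - F.tr j j (m + 1) m' (y.1.1 j) +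
          ((F.obj j).d m m').hom (y.1.2.1 j))
      rw [map_add, map_add, map_add]
      abel
    · show F.tr i i (m + 1) m' (x.1.1 i + y.1.1 i) +
          ((F.obj i).d m m').hom (x.1.2.2 + y.1.2.2) =
        (F.tr i i (m + 1) m' (x.1.1 i) + ((F.obj i).d m m').hom x.1.2.2) +
        (F.tr i i (m + 1) m' (y.1.1 i) + ((F.obj i).d m m').hom y.1.2.2)
      rw [map_add, map_add]
      abel
  map_smul' a x := by
    refine completion_ext (fun j ↦ ?_) (fun j ↦ ?_) ?_
    · show -((F.obj j).d (m + 1) (m' + 1)).hom (a • x.1.1 j) =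
        a • -((F.obj j).d (m + 1) (m' + 1)).hom (x.1.1 j)
      rw [map_smul, smul_neg]
    · show F.tr (j - 1) j (m + 1) m' (a • x.1.1 (j - 1)) - F.tr j j (m + 1) m' (a • x.1.1 j) +
          ((F.obj j).d m m').hom (a • x.1.2.1 j) =
        a • (F.tr (j - 1) j (m + 1) m' (x.1.1 (j - 1)) - F.tr j j (m + 1) m' (x.1.1 j) +
          ((F.obj j).d m m').hom (x.1.2.1 j))
      rw [map_smul, map_smul, map_smul, smul_add, smul_sub]
    · show F.tr i i (m + 1) m' (a • x.1.1 i) + ((F.obj i).d m m').hom (a • x.1.2.2) =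
        a • (F.tr i i (m + 1) m' (x.1.1 i) + ((F.obj i).d m m').hom x.1.2.2)
      rw [map_smul, map_smul, smul_add]

variable {F} in
lemma completionD_fst {i m m' : ℤ} (x : F.completionSubmodule i m) (j : ℤ) :
    (F.completionD i m m' x).1.1 j = -((F.obj j).d (m + 1) (m' + 1)).hom (x.1.1 j) := rfl

variable {F} in
lemma completionD_snd {i m m' : ℤ} (x : F.completionSubmodule i m) (j : ℤ) :
    (F.completionD i m m' x).1.2.1 j = F.tr (j - 1) j (m + 1) m' (x.1.1 (j - 1)) -
      F.tr j j (m + 1) m' (x.1.1 j) + ((F.obj j).d m m').hom (x.1.2.1 j) := rfl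

variable {F} in
lemma completionD_thd {i m m' : ℤ} (x : F.completionSubmodule i m) :
    (F.completionD i m m' x).1.2.2 =
      F.tr i i (m + 1) m' (x.1.1 i) + ((F.obj i).d m m').hom x.1.2.2 := rfl

lemma completionD_eq_zero {i m m' : ℤ} (h : m + 1 ≠ m') (x : F.completionSubmodule i m) :
    F.completionD i m m' x = 0 := by
  refine completion_ext (fun j ↦ ?_) (fun j ↦ ?_) ?_
  · refine (completionD_fst x j).trans ?_
    rw [d_eq_zero _ (by lia)]
    exact neg_zero
  · refine (completionD_snd x j).trans ?_
    rw [d_eq_zero _ (by lia), tr_eq_zero _ (by lia), tr_eq_zero _ (by lia), sub_zero]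
    exact add_zero _
  · refine (completionD_thd x).trans ?_
    rw [d_eq_zero _ (by lia), tr_eq_zero _ (by lia)]
    exact add_zero _

lemma completionD_completionD (i m : ℤ) (x : F.completionSubmodule i m) :
    F.completionD i (m + 1) (m + 1 + 1) (F.completionD i m (m + 1) x) = 0 := by
  refine completion_ext (fun j ↦ ?_) (fun j ↦ ?_) ?_
  · rw [completionD_fst, completionD_fst, map_neg, d_d, neg_zero]
    exact neg_zero
  · rw [completionD_snd, completionD_fst, completionD_fst, completionD_snd, map_add, d_d,
      add_zero, map_sub, map_neg, map_neg, tr_self, tr_self, d_tr F rfl]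
    show _ = (0 : (F.obj j).X (m + 1 + 1))
    abel
  · rw [completionD_thd, completionD_fst, completionD_thd, map_add, d_d, add_zero, map_neg,
      d_tr F rfl]
    exact neg_add_cancel _

/-- The completion of `F`, in filtration degree `i`. -/
noncomputable def completionComplex (i : ℤ) : CochainComplex (ModuleCat.{u} k) ℤ where
  X m := ModuleCat.of k (F.completionSubmodule i m)
  d m m' := ModuleCat.ofHom (F.completionD i m m')
  shape m m' h := ModuleCat.hom_ext (LinearMap.ext (F.completionD_eq_zero h))
  d_comp_d' m m' m'' h h' := by
    obtain rfl : m + 1 = m' := h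
    obtain rfl : m + 1 + 1 = m'' := h'
    exact ModuleCat.hom_ext (LinearMap.ext (F.completionD_completionD i m))

/-- The completion of a filtered complex. -/
noncomputable def completionObj : FilteredComplex k where
  obj i := F.completionComplex i
  map {i i'} h :=
    { f m := ModuleCat.ofHom
        { toFun x := ⟨(x.1.1, x.1.2.1, F.tr i i' m m x.1.2.2), by
            have hi := leOfHom h
            refine ⟨fun j hj ↦ ?_, fun j hj ↦ x.2.2 j (by lia)⟩
            show x.1.1 j = F.tr i' j (m + 1) (m + 1) (x.1.1 i')
            rw [x.2.1 j (by lia), x.2.1 i' hi, tr_tr F hi hj rfl]⟩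
          map_add' x y := completion_ext (fun _ ↦ rfl) (fun _ ↦ rfl) (map_add _ _ _)
          map_smul' a x := completion_ext (fun _ ↦ rfl) (fun _ ↦ rfl) (map_smul _ _ _) }
      comm' m m' _ := by
        have hi := leOfHom h
        refine ModuleCat.hom_ext (LinearMap.ext fun x ↦
          completion_ext (fun j ↦ rfl) (fun j ↦ rfl) ?_)
        show F.tr i' i' (m + 1) m' (x.1.1 i') +
            ((F.obj i').d m m').hom (F.tr i i' m m x.1.2.2) =
          F.tr i i' m' m' (F.tr i i (m + 1) m' (x.1.1 i) + ((F.obj i).d m m').hom x.1.2.2)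
        rw [x.2.1 i' hi, d_tr F rfl, map_add, tr_tr F hi le_rfl rfl]
        by_cases hm : m + 1 = m'
        · rw [tr_tr F le_rfl hi hm]
        · rw [tr_eq_zero F (by tauto), tr_eq_zero F (j := i) (by tauto), map_zero] }
  map_id i := by
    refine HomologicalComplex.hom_ext _ _ fun m ↦ ?_
    exact ModuleCat.hom_ext (LinearMap.ext fun x ↦
      completion_ext (fun j ↦ rfl) (fun j ↦ rfl) (F.tr_self i m _))
  map_comp {i i' i''} h h' := by
    refine HomologicalComplex.hom_ext _ _ fun m ↦ ?_
    exact ModuleCat.hom_ext (LinearMap.ext fun x ↦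
      completion_ext (fun j ↦ rfl) (fun j ↦ rfl) (F.tr_tr (leOfHom h) (leOfHom h') rfl _).symm)

variable {F} in
/-- The morphism of completions induced by a morphism of filtered complexes. -/
noncomputable def completionMap (φ : F ⟶ F') : F.completionObj ⟶ F'.completionObj where
  app i :=
    { f m := ModuleCat.ofHom
        { toFun x := ⟨(fun j ↦ ((φ.app j).f (m + 1)).hom (x.1.1 j),
            fun j ↦ ((φ.app j).f m).hom (x.1.2.1 j), ((φ.app i).f m).hom x.1.2.2), by
              refine ⟨fun j hj ↦ ?_, fun j hj ↦ ?_⟩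
              · dsimp only
                rw [x.2.1 j hj, app_tr]
              · dsimp only
                rw [x.2.2 j hj, map_zero]⟩
          map_add' x y :=
            completion_ext (fun _ ↦ map_add _ _ _) (fun _ ↦ map_add _ _ _) (map_add _ _ _)
          map_smul' a x :=
            completion_ext (fun _ ↦ map_smul _ _ _) (fun _ ↦ map_smul _ _ _) (map_smul _ _ _) }
      comm' m m' _ := by
        have hd (j a b : ℤ) (z : (F.obj j).X a) : ((F'.obj j).d a b).hom
            (((φ.app j).f a).hom z) = ((φ.app j).f b).hom (((F.obj j).d a b).hom z) :=
          congr($((φ.app j).comm a b).hom z)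
        refine ModuleCat.hom_ext (LinearMap.ext fun x ↦
          completion_ext (fun j ↦ ?_) (fun j ↦ ?_) ?_)
        · show -((F'.obj j).d (m + 1) (m' + 1)).hom (((φ.app j).f (m + 1)).hom (x.1.1 j)) =
            ((φ.app j).f (m' + 1)).hom (-((F.obj j).d (m + 1) (m' + 1)).hom (x.1.1 j))
          rw [hd, map_neg]
        · show F'.tr (j - 1) j (m + 1) m' (((φ.app (j - 1)).f (m + 1)).hom (x.1.1 (j - 1))) -
              F'.tr j j (m + 1) m' (((φ.app j).f (m + 1)).hom (x.1.1 j)) +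
              ((F'.obj j).d m m').hom (((φ.app j).f m).hom (x.1.2.1 j)) =
            ((φ.app j).f m').hom (F.tr (j - 1) j (m + 1) m' (x.1.1 (j - 1)) -
              F.tr j j (m + 1) m' (x.1.1 j) + ((F.obj j).d m m').hom (x.1.2.1 j))
          rw [hd, map_add, map_sub, app_tr, app_tr]
        · show F'.tr i i (m + 1) m' (((φ.app i).f (m + 1)).hom (x.1.1 i)) +
              ((F'.obj i).d m m').hom (((φ.app i).f m).hom x.1.2.2) =
            ((φ.app i).f m').hom (F.tr i i (m + 1) m' (x.1.1 i) +
              ((F.obj i).d m m').hom x.1.2.2)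
          rw [hd, map_add, app_tr] }
  naturality i i' h := by
    refine HomologicalComplex.hom_ext _ _ fun m ↦ ?_
    exact ModuleCat.hom_ext (LinearMap.ext fun x ↦
      completion_ext (fun j ↦ rfl) (fun j ↦ rfl) (app_tr F φ i i' m m _))

variable (k) in
/-- The completion, as a functor. -/
noncomputable def completion : FilteredComplex k ⥤ FilteredComplex k where
  obj F := F.completionObj
  map φ := completionMap φ

variable (k) in
/-- The natural transformation from a filtered complex to its completion. -/
noncomputable def toCompletion : 𝟭 (FilteredComplex k) ⟶ completion k where
  app F :=
    { app i :=
        { f m := ModuleCat.ofHom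
            { toFun x := ⟨(0, 0, x), fun j _ ↦ (map_zero (F.tr i j (m + 1) (m + 1))).symm,
                fun _ _ ↦ rfl⟩
              map_add' x y :=
                completion_ext (fun _ ↦ (add_zero _).symm) (fun _ ↦ (add_zero _).symm) rfl
              map_smul' a x :=
                completion_ext (fun _ ↦ (smul_zero a).symm) (fun _ ↦ (smul_zero a).symm) rfl }
          comm' m m' _ := by
            refine ModuleCat.hom_ext (LinearMap.ext fun x ↦
              completion_ext (fun j ↦ ?_) (fun j ↦ ?_) ?_)
            · show -((F.obj j).d (m + 1) (m' + 1)).hom 0 = 0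
              rw [map_zero, neg_zero]
            · show F.tr (j - 1) j (m + 1) m' 0 - F.tr j j (m + 1) m' 0 +
                ((F.obj j).d m m').hom 0 = 0
              rw [map_zero, map_zero, map_zero, sub_zero, add_zero]
            · show F.tr i i (m + 1) m' 0 + ((F.obj i).d m m').hom x = ((F.obj i).d m m').hom x
              rw [map_zero, zero_add] }
      naturality i i' h := by
        refine HomologicalComplex.hom_ext _ _ fun m ↦ ?_
        refine ModuleCat.hom_ext (LinearMap.ext fun x ↦
          completion_ext (fun j ↦ rfl) (fun j ↦ rfl) ?_)
        show ((F.map h).f m).hom x = F.tr i i' m m x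
        rw [tr_eq_map F (leOfHom h)]
        rfl }
  naturality F F' φ := by
    refine NatTrans.ext (funext fun i ↦ HomologicalComplex.hom_ext _ _ fun m ↦ ?_)
    exact ModuleCat.hom_ext (LinearMap.ext fun x ↦ completion_ext
      (fun j ↦ (map_zero ((φ.app j).f (m + 1)).hom).symm)
      (fun j ↦ (map_zero ((φ.app j).f m).hom).symm) rfl)

/-- The map from the Tate realization of the graded mixed complex attached to `F` to the
completion of `F`. -/
noncomputable def tateToCompletionApp (i m : ℤ) :
    (toMixedObj k F).tateSubmodule i m →ₗ[k] F.completionSubmodule i m where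
  -- The complex F^j occurs twice: as source of the cone of weight -j - 1, which gives c_j, and as
  -- target of the cone of weight -j, which gives b_j.
  toFun x := ⟨(fun j ↦ F.tr (-(-j - 1) - 1) j (m - 2 * (-j - 1) + 2 * (-j - 1) + 1) (m + 1)
      (x.1 (-j - 1)).1,
    fun j ↦ F.tr (- -j) j (m - 2 * -j + 2 * -j) m (x.1 (-j)).2, 0), by
      have h (j : ℤ) (hj : i ≤ j) :
          F.tr (-(-j - 1) - 1) j (m - 2 * (-j - 1) + 2 * (-j - 1) + 1) (m + 1)
            (x.1 (-j - 1)).1 = 0 := by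
        rw [x.2 (-j - 1) (by lia)]
        exact map_zero _
      refine ⟨fun j hj ↦ ?_, fun j hj ↦ ?_⟩
      · dsimp only
        rw [h j hj, h i le_rfl, map_zero]
      · dsimp only
        rw [x.2 (-j) (by lia)]
        exact map_zero _⟩
  map_add' x y := completion_ext (fun _ ↦ map_add _ _ _) (fun _ ↦ map_add _ _ _)
    (add_zero _).symm
  map_smul' a x := completion_ext (fun _ ↦ map_smul _ _ _) (fun _ ↦ map_smul _ _ _)
    (smul_zero _).symm

lemma tateToCompletionApp_d (i m m' : ℤ) (x : (toMixedObj k F).tateSubmodule i m) :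
    F.completionD i m m' (F.tateToCompletionApp i m x) =
      F.tateToCompletionApp i m' ((toMixedObj k F).tateD i m m' x) := by
  refine completion_ext (fun j ↦ ?_) (fun j ↦ ?_) ?_
  · show -((F.obj j).d (m + 1) (m' + 1)).hom (F.tr (-(-j - 1) - 1) j _ (m + 1)
        (x.1 (-j - 1)).1) =
      F.tr (-(-j - 1) - 1) j (m' - 2 * (-j - 1) + 2 * (-j - 1) + 1) (m' + 1)
        (-((F.obj (-(-j - 1) - 1)).d _ _).hom (x.1 (-j - 1)).1 +
          (((toMixedObj k F).ε (-j - 1 - 1) (-j - 1) _ _).hom (x.1 (-j - 1 - 1))).1)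
    rw [toMixedObj_ε_fst, add_zero, map_neg, d_tr]
    lia
  · show F.tr (j - 1) j (m + 1) m' (F.tr (-(-(j - 1) - 1) - 1) (j - 1) _ (m + 1)
          (x.1 (-(j - 1) - 1)).1) -
        F.tr j j (m + 1) m' (F.tr (-(-j - 1) - 1) j _ (m + 1) (x.1 (-j - 1)).1) +
        ((F.obj j).d m m').hom (F.tr (- -j) j _ m (x.1 (-j)).2) =
      F.tr (- -j) j (m' - 2 * -j + 2 * -j) m' (F.tr (- -j - 1) (- -j) _ _ (x.1 (-j)).1 +
        ((F.obj (- -j)).d _ _).hom (x.1 (-j)).2 +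
        (((toMixedObj k F).ε (-j - 1) (-j) _ _).hom (x.1 (-j - 1))).2)
    rw [toMixedObj_ε_snd F (by lia), map_add, map_add, map_neg,
      d_tr F (a' := m' - 2 * -j + 2 * -j) (by lia), tr_tr F (by lia) (by lia) (by lia),
      tr_tr F (by lia) (by lia) (by lia)]
    by_cases hm : m + 1 = m'
    · rw [tr_tr F (by lia) (by lia) (by lia), tr_tr F (by lia) (by lia) (by lia)]
      -- The weights -(j - 1) - 1 and -j are equal but not syntactically so; with the weight
      -- generalized, the terms depending on it can be rewritten.
      have hx : ∀ q, q = -j → F.tr (-q - 1) j (m - 2 * q + 2 * q + 1) m' (x.1 q).1 =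
          F.tr (- -j - 1) j (m - 2 * -j + 2 * -j + 1) m' (x.1 (-j)).1 := by
        rintro q rfl
        rfl
      rw [hx _ (by lia)]
      abel
    · rw [tr_eq_zero F (by lia), tr_eq_zero F (by lia), tr_eq_zero F (b := m' - 2 * -j + 2 * -j)
        (by lia), tr_eq_zero F (b := m' - 2 * -j + 2 * -j) (by lia)]
      simp
  · show F.tr i i (m + 1) m' (F.tr (-(-i - 1) - 1) i _ (m + 1) (x.1 (-i - 1)).1) +
      ((F.obj i).d m m').hom 0 = 0
    rw [x.2 (-i - 1) (by lia), map_zero, add_zero]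
    exact (congrArg _ (map_zero _)).trans (map_zero _)

lemma tateToCompletionApp_eq_zero {i m : ℤ} {x : (toMixedObj k F).tateSubmodule i m}
    (hx : F.tateToCompletionApp i m x = 0) : x = 0 := by
  have h₁ (j : ℤ) : F.tr (-(-j - 1) - 1) j (m - 2 * (-j - 1) + 2 * (-j - 1) + 1) (m + 1)
      (x.1 (-j - 1)).1 = 0 := congr_fun (congrArg (fun z ↦ z.1.1) hx) j
  have h₂ (j : ℤ) : F.tr (- -j) j (m - 2 * -j + 2 * -j) m (x.1 (-j)).2 = 0 :=
    congr_fun (congrArg (fun z ↦ z.1.2.1) hx) j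
  refine Subtype.ext (funext fun p ↦ Prod.ext ?_ ?_)
  · obtain ⟨j, rfl⟩ : ∃ j, p = -j - 1 := ⟨-p - 1, by lia⟩
    exact tr_injective F (by lia) (by lia) (h₁ j)
  · obtain ⟨j, rfl⟩ : ∃ j, p = -j := ⟨-p, by lia⟩
    exact tr_injective F (by lia) (by lia) (h₂ j)

/-- The weights p ≥ -i give c_j for j < i and b_j for j ≤ i, so exactly c_i and f are missing from
the image. -/
lemma exists_tateToCompletionApp_eq {i m : ℤ} (z : F.completionSubmodule i m)
    (h : z.1.2.2 = 0) (h' : z.1.1 i = 0) :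
    ∃ x, F.tateToCompletionApp i m x = z := by
  refine ⟨⟨fun p ↦ (F.tr (-p - 1) (-p - 1) (m + 1) (m - 2 * p + 2 * p + 1) (z.1.1 (-p - 1)),
    F.tr (-p) (-p) m (m - 2 * p + 2 * p) (z.1.2.1 (-p))), fun p hp ↦ ?_⟩,
    completion_ext (fun j ↦ ?_) (fun j ↦ ?_) h.symm⟩
  · dsimp only
    rw [z.2.1 (-p - 1) (by lia), z.2.2 (-p) (by lia), h', map_zero, map_zero, map_zero]
    rfl
  · show F.tr (-(-j - 1) - 1) j _ (m + 1) (F.tr (-(-j - 1) - 1) (-(-j - 1) - 1) (m + 1) _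
      (z.1.1 (-(-j - 1) - 1))) = z.1.1 j
    rw [tr_tr F (by lia) (by lia) (by lia), tr_family F (by lia)]
  · show F.tr (- -j) j _ m (F.tr (- -j) (- -j) m _ (z.1.2.1 (- -j))) = z.1.2.1 j
    rw [tr_tr F (by lia) (by lia) (by lia), tr_family F (by lia)]

variable (k) in
/-- The natural transformation from the Tate realization of the graded mixed complex attached to a
filtered complex to the completion of this filtered complex. -/
noncomputable def tateToCompletion :
    toMixed k ⋙ GradedMixedComplex.tate k ⟶ completion k where
  app F :=
    { app i :=
        { f m := ModuleCat.ofHom (F.tateToCompletionApp i m)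
          comm' m m' _ := ModuleCat.hom_ext (LinearMap.ext (F.tateToCompletionApp_d i m m')) }
      naturality i i' h := by
        refine HomologicalComplex.hom_ext _ _ fun m ↦ ?_
        exact ModuleCat.hom_ext (LinearMap.ext fun x ↦ completion_ext (fun _ ↦ rfl)
          (fun _ ↦ rfl) (map_zero (F.tr i i' m m)).symm) }
  naturality F F' φ := by
    refine NatTrans.ext (funext fun i ↦ HomologicalComplex.hom_ext _ _ fun m ↦ ?_)
    exact ModuleCat.hom_ext (LinearMap.ext fun x ↦ completion_ext
      (fun j ↦ (app_tr F φ _ _ _ _ _).symm) (fun j ↦ (app_tr F φ _ _ _ _ _).symm)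
      (map_zero ((φ.app i).f m).hom).symm)

/-- The map is injective, and the quotient of the completion by its image consists of the pairs
(c_i, f), which form the cone of the identity of F^i, an acyclic complex. -/
lemma tateToCompletion_app_quasiIso : quasiIso k ((tateToCompletion k).app F) := by
  intro i
  rw [CochainComplex.quasiIso_iff_elements]
  rintro l _ _ _ rfl rfl rfl x y hx hxy
  let x₀ : (toMixedObj k F).tateSubmodule i (l + 1 + 1) := x
  let y₀ : F.completionSubmodule i (l + 1) := y
  have hxy₀ : F.tateToCompletionApp i (l + 1 + 1) x₀ = F.completionD i (l + 1) (l + 1 + 1) y₀ :=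
    hxy
  -- The contraction of the cone of the identity moves f to position i of c. As `F.tr i j` is zero
  -- for j < i, the components below i vanish. Subtracting the boundary of y' kills f, and then c_i
  -- because of the cocycle condition.
  let y' : F.completionSubmodule i l := ⟨(fun j ↦ F.tr i j (l + 1) (l + 1) y₀.1.2.2, 0, 0),
    fun j hj ↦ by
      dsimp only
      rw [tr_tr F le_rfl hj rfl], fun j _ ↦ rfl⟩
  have h₀ : 0 = F.tr i i (l + 1 + 1) (l + 1 + 1) (y₀.1.1 i) +
      ((F.obj i).d (l + 1) (l + 1 + 1)).hom y₀.1.2.2 :=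
    congrArg (fun z ↦ z.1.2.2) hxy₀
  obtain ⟨x', hx'⟩ := F.exists_tateToCompletionApp_eq (y₀ - F.completionD i l (l + 1) y')
    (by
      show y₀.1.2.2 - (F.tr i i (l + 1) (l + 1) (F.tr i i (l + 1) (l + 1) y₀.1.2.2) +
        ((F.obj i).d l (l + 1)).hom 0) = 0
      rw [tr_self, tr_self, map_zero, add_zero, sub_self])
    (by
      show y₀.1.1 i - -((F.obj i).d (l + 1) (l + 1 + 1)).hom
        (F.tr i i (l + 1) (l + 1) y₀.1.2.2) = 0
      rw [tr_self, sub_neg_eq_add, h₀, tr_self])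
  refine ⟨x', y', ?_, ?_⟩
  · refine sub_eq_zero.1 (F.tateToCompletionApp_eq_zero (x :=
      (toMixedObj k F).tateD i (l + 1) (l + 1 + 1) x' - x₀) ?_)
    rw [map_sub, ← tateToCompletionApp_d, hx', hxy₀, map_sub, sub_sub_cancel_left, neg_eq_zero]
    exact F.completionD_completionD i l y'
  · show F.tateToCompletionApp i (l + 1) x' + F.completionD i l (l + 1) y' = y₀
    rw [hx', sub_add_cancel]

/-- The acyclicity of the homotopy limit of the tower `(F^j)_{j ≤ i}`. -/
def IsTowerAcyclic (i : ℤ) : Prop :=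
  ∀ (l : ℤ) (c : ∀ j, (F.obj j).X (l + 1 + 1)) (b : ∀ j, (F.obj j).X (l + 1)),
    (∀ j ≤ i, ((F.obj j).d (l + 1 + 1) (l + 1 + 1 + 1)).hom (c j) = 0) →
    (∀ j ≤ i, F.tr (j - 1) j (l + 1 + 1) (l + 1 + 1) (c (j - 1)) - c j +
      ((F.obj j).d (l + 1) (l + 1 + 1)).hom (b j) = 0) →
    ∃ (c' : ∀ j, (F.obj j).X (l + 1)) (b' : ∀ j, (F.obj j).X l), ∀ j ≤ i,
      -((F.obj j).d (l + 1) (l + 1 + 1)).hom (c' j) = c j ∧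
      F.tr (j - 1) j (l + 1) (l + 1) (c' (j - 1)) - c' j +
        ((F.obj j).d l (l + 1)).hom (b' j) = b j

open Classical in
/-- The extension to all indices of families `c_j` and `b_j` for `j ≤ i`, as an element of the
completion. -/
noncomputable def completionMk {i m : ℤ} (c : ∀ j, (F.obj j).X (m + 1)) (b : ∀ j, (F.obj j).X m)
    (f : (F.obj i).X m) : F.completionSubmodule i m :=
  ⟨(fun j ↦ if j ≤ i then c j else F.tr i j (m + 1) (m + 1) (c i),
    fun j ↦ if j ≤ i then b j else 0, f), by
    refine ⟨fun j hj ↦ ?_, fun j hj ↦ if_neg (not_le.2 hj)⟩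
    dsimp only
    rw [if_pos le_rfl]
    split_ifs with h
    · exact (tr_family F (le_antisymm hj h) c).symm
    · rfl⟩

lemma completionMk_fst {i m : ℤ} (c : ∀ j, (F.obj j).X (m + 1)) (b : ∀ j, (F.obj j).X m)
    (f : (F.obj i).X m) {j : ℤ} (h : j ≤ i) : (F.completionMk c b f).1.1 j = c j :=
  if_pos h

lemma completionMk_snd {i m : ℤ} (c : ∀ j, (F.obj j).X (m + 1)) (b : ∀ j, (F.obj j).X m)
    (f : (F.obj i).X m) {j : ℤ} (h : j ≤ i) : (F.completionMk c b f).1.2.1 j = b j :=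
  if_pos h

variable {F} in
lemma completion_ext_le {i m : ℤ} {x y : F.completionSubmodule i m}
    (h₁ : ∀ j ≤ i, x.1.1 j = y.1.1 j)
    (h₂ : ∀ j ≤ i, x.1.2.1 j = y.1.2.1 j) (h₃ : x.1.2.2 = y.1.2.2) : x = y := by
  refine completion_ext (fun j ↦ ?_) (fun j ↦ ?_) h₃
  · rcases le_total j i with h | h
    · exact h₁ j h
    · rw [x.2.1 j h, y.2.1 j h, h₁ i le_rfl]
  · rcases le_or_gt j i with h | h
    · exact h₂ j h
    · rw [x.2.2 j h, y.2.2 j h]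

/-- The cokernel of F^i → completion consists of the pairs (c, b), that is, of the shifted homotopy
limit of the F^j. The component f only records an element of F^i and does not affect acyclicity. -/
lemma toCompletion_quasiIso_iff (i : ℤ) :
    QuasiIso (((toCompletion k).app F).app i) ↔ F.IsTowerAcyclic i := by
  rw [CochainComplex.quasiIso_iff_elements]
  constructor
  · intro H l c b hc hb
    obtain ⟨x', y', -, h⟩ := H l _ _ _ rfl rfl rfl (c i) (F.completionMk c b 0) (hc i le_rfl) (by
      refine completion_ext_le (fun j hj ↦ ?_) (fun j hj ↦ ?_) ?_
      · refine Eq.trans ?_ (completionD_fst (F.completionMk c b 0) j).symm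
        rw [completionMk_fst F c b 0 hj, hc j hj, neg_zero]
        rfl
      · refine Eq.trans ?_ (completionD_snd (F.completionMk c b 0) j).symm
        rw [completionMk_fst F c b 0 hj, completionMk_fst F c b 0 (by lia),
          completionMk_snd F c b 0 hj, tr_self, hb j hj]
        rfl
      · refine Eq.trans ?_ (completionD_thd (F.completionMk c b 0)).symm
        rw [completionMk_fst F c b 0 le_rfl, tr_self]
        exact ((congrArg _ (map_zero _)).trans (add_zero _)).symm)
    refine ⟨y'.1.1, y'.1.2.1, fun j hj ↦ ⟨?_, ?_⟩⟩
    · have h' : 0 + -((F.obj j).d (l + 1) (l + 1 + 1)).hom (y'.1.1 j) =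
        (F.completionMk c b 0).1.1 j := congr_fun (congrArg (fun z ↦ z.1.1) h) j
      rwa [zero_add, completionMk_fst F c b 0 hj] at h'
    · have h' : 0 + (F.tr (j - 1) j (l + 1) (l + 1) (y'.1.1 (j - 1)) -
        F.tr j j (l + 1) (l + 1) (y'.1.1 j) + ((F.obj j).d l (l + 1)).hom (y'.1.2.1 j)) =
        (F.completionMk c b 0).1.2.1 j := congr_fun (congrArg (fun z ↦ z.1.2.1) h) j
      rwa [zero_add, completionMk_snd F c b 0 hj, tr_self] at h'
  · rintro H l _ _ _ rfl rfl rfl x y hx hxy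
    let y₀ : F.completionSubmodule i (l + 1) := y
    have h₁ (j : ℤ) : 0 = -((F.obj j).d (l + 1 + 1) (l + 1 + 1 + 1)).hom (y₀.1.1 j) :=
      congr_fun (congrArg (fun z ↦ z.1.1) hxy) j
    have h₂ (j : ℤ) : 0 = F.tr (j - 1) j (l + 1 + 1) (l + 1 + 1) (y₀.1.1 (j - 1)) -
        F.tr j j (l + 1 + 1) (l + 1 + 1) (y₀.1.1 j) +
        ((F.obj j).d (l + 1) (l + 1 + 1)).hom (y₀.1.2.1 j) :=
      congr_fun (congrArg (fun z ↦ z.1.2.1) hxy) j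
    have h₃ : x = F.tr i i (l + 1 + 1) (l + 1 + 1) (y₀.1.1 i) +
        ((F.obj i).d (l + 1) (l + 1 + 1)).hom y₀.1.2.2 :=
      congrArg (fun z ↦ z.1.2.2) hxy
    obtain ⟨c', b', h⟩ := H l y₀.1.1 y₀.1.2.1 (fun j _ ↦ neg_eq_zero.1 (h₁ j).symm)
      (fun j _ ↦ by rw [h₂ j, tr_self])
    refine ⟨y₀.1.2.2 - c' i, F.completionMk c' b' 0, ?_,
      completion_ext_le (fun j hj ↦ ?_) (fun j hj ↦ ?_) ?_⟩
    · refine (map_sub _ _ _).trans ?_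
      rw [h₃, tr_self, ← (h i le_rfl).1]
      exact (sub_eq_add_neg _ _).trans (add_comm _ _)
    · refine Eq.trans ?_ (h j hj).1
      refine (zero_add _).trans ((completionD_fst (F.completionMk c' b' 0) j).trans ?_)
      rw [completionMk_fst F c' b' 0 hj]
    · refine Eq.trans ?_ (h j hj).2
      refine (zero_add _).trans ((completionD_snd (F.completionMk c' b' 0) j).trans ?_)
      rw [completionMk_fst F c' b' 0 hj, completionMk_fst F c' b' 0 (by lia),
        completionMk_snd F c' b' 0 hj, tr_self]
    · show y₀.1.2.2 - c' i + (F.completionD i l (l + 1) (F.completionMk c' b' 0)).1.2.2 =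
        y₀.1.2.2
      rw [completionD_thd, completionMk_fst F c' b' 0 le_rfl, tr_self]
      refine (congrArg _ ((congrArg _ (map_zero _)).trans (add_zero _))).trans ?_
      exact sub_add_cancel _ _

end FilteredComplex

/-! ### The Tate realization is complete -/

namespace GradedMixedComplex

variable {k : Type u} [Field k] (E : GradedMixedComplex k)

open FilteredComplex

/-- The transition maps are inclusions, and for each position q the elements of F^j have no
component q once j < -q. Hence 1 - shift is bijective: its inverse is given by sums which are finite
in each position, and a compatible family in all F^j is zero. -/
lemma isTowerAcyclic_tateObj (i : ℤ) : E.tateObj.IsTowerAcyclic i := by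
  intro l c b hc hb
  -- Minus the sum of b_s over all s ≤ j; in position q the terms with s < -q vanish, so the range
  -- is finite.
  let c' (j : ℤ) : (E.tateObj.obj j).X (l + 1) :=
    ⟨fun q ↦ -∑ s ∈ Finset.Icc (-q) j, (b s).1 q, fun q hq ↦ by
      beta_reduce
      rw [Finset.Icc_eq_empty (by lia), Finset.sum_empty, neg_zero]⟩
  have hc' (j : ℤ) : E.tateObj.tr (j - 1) j (l + 1) (l + 1) (c' (j - 1)) - c' j = b j := by
    refine tateObj_ext _ fun q ↦ ?_
    have e : (E.tateObj.tr (j - 1) j (l + 1) (l + 1) (c' (j - 1)) - c' j).1 q =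
      (E.tateObj.tr (j - 1) j (l + 1) (l + 1) (c' (j - 1))).1 q - (c' j).1 q := rfl
    rw [e, tateObj_tr _ (by lia), cst_self]
    dsimp only [c']
    by_cases hq : -q ≤ j
    · rw [show Finset.Icc (-q) j = insert j (Finset.Icc (-q) (j - 1)) by ext s; simp; lia,
        Finset.sum_insert (by simp)]
      abel
    · rw [Finset.Icc_eq_empty (by lia), Finset.Icc_eq_empty (by lia), sub_self]
      exact ((b j).2 q (by lia)).symm
  -- What remains of c after subtracting the boundary. It is compatible with the transition maps,
  -- hence zero.
  let z (j : ℤ) := c j + ((E.tateObj.obj j).d (l + 1) (l + 1 + 1)).hom (c' j)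
  have hz (j : ℤ) (hj : j ≤ i) : E.tateObj.tr (j - 1) j (l + 1 + 1) (l + 1 + 1) (z (j - 1)) =
      z j := by
    have h₁ := congrArg ((E.tateObj.obj j).d (l + 1) (l + 1 + 1)).hom (hc' j)
    rw [map_sub, d_tr _ (a' := l + 1 + 1) rfl] at h₁
    have h₂ := hb j hj
    rw [← h₁] at h₂
    dsimp only [z]
    rw [map_add, ← sub_eq_zero, ← h₂]
    abel
  have hz' (q : ℤ) (n : ℕ) : ∀ j ≤ i, (z j).1 q = (z (j - n)).1 q := by
    induction n with
    | zero =>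
      intro j _
      rw [Nat.cast_zero, sub_zero]
    | succ n hn =>
      intro j hj
      rw [hn j hj, ← hz (j - n) (by lia), tateObj_tr _ (by lia), cst_self,
        show j - (n + 1 : ℕ) = j - n - 1 by push_cast; ring]
  refine ⟨c', 0, fun j hj ↦ ⟨?_, ?_⟩⟩
  · have : z j = 0 := tateObj_ext _ fun q ↦ by
      -- Descending this many steps reaches an index at most -q - 1, where the component q vanishes.
      rw [hz' q (q + j + 1).toNat j hj]
      exact (z (j - (q + j + 1).toNat)).2 q (by lia)
    exact (eq_neg_of_add_eq_zero_left this).symm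
  · rw [hc']
    exact (congrArg _ (map_zero _)).trans (add_zero _)

end GradedMixedComplex

/-! ### Elements of homotopy limits of towers of complexes -/

section

open CochainComplex HomComplex

variable {k : Type u} [Field k]

section

variable {K L : CochainComplex (ModuleCat.{u} k) ℤ} (φ : K ⟶ L)

lemma mappingCone_ext {m n : ℤ} (h : m + 1 = n) {z z' : (mappingCone φ).X m}
    (h₁ : ((mappingCone.fst φ).1.v m n h).hom z = ((mappingCone.fst φ).1.v m n h).hom z')
    (h₂ : ((mappingCone.snd φ).v m m (add_zero m)).hom z =
      ((mappingCone.snd φ).v m m (add_zero m)).hom z') : z = z' := by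
  have e (w : (mappingCone φ).X m) : _ = w := congr($(mappingCone.id_X φ m n h).hom w)
  rw [← e z, ← e z']
  exact congrArg₂ (fun p q : (mappingCone φ).X m ↦ p + q)
    (congrArg ((mappingCone.inl φ).v n m (by lia)).hom h₁)
    (congrArg ((mappingCone.inr φ).f m).hom h₂)

lemma exists_mappingCone {m n : ℤ} (h : m + 1 = n) (a : K.X n) (b : L.X m) :
    ∃ z : (mappingCone φ).X m, ((mappingCone.fst φ).1.v m n h).hom z = a ∧
      ((mappingCone.snd φ).v m m (add_zero m)).hom z = b := by
  refine ⟨((mappingCone.inl φ).v n m (by lia)).hom a + ((mappingCone.inr φ).f m).hom b, ?_, ?_⟩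
  · rw [map_add]
    refine (congrArg₂ (· + ·) congr($(mappingCone.inl_v_fst_v φ n m h).hom a)
      congr($(mappingCone.inr_f_fst_v φ m n h).hom b)).trans ?_
    exact add_zero a
  · rw [map_add]
    refine (congrArg₂ (· + ·) congr($(mappingCone.inl_v_snd_v φ n m (by lia)).hom a)
      congr($(mappingCone.inr_f_snd_v φ m).hom b)).trans ?_
    exact zero_add b

lemma mappingCone_map_fst {K' L' : CochainComplex (ModuleCat.{u} k) ℤ} (φ' : K' ⟶ L')
    (a : K ⟶ K') (b : L ⟶ L') (comm : φ ≫ b = a ≫ φ') {m n : ℤ} (h : m + 1 = n) :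
    (mappingCone.map φ φ' a b comm).f m ≫ (mappingCone.fst φ').1.v m n h =
      (mappingCone.fst φ).1.v m n h ≫ a.f n := by
  refine mappingCone.ext_from _ n m h ?_ ?_
  · simp [mappingCone.map]
  · simp [mappingCone.map]

lemma mappingCone_map_snd {K' L' : CochainComplex (ModuleCat.{u} k) ℤ} (φ' : K' ⟶ L')
    (a : K ⟶ K') (b : L ⟶ L') (comm : φ ≫ b = a ≫ φ') (m : ℤ) :
    (mappingCone.map φ φ' a b comm).f m ≫ (mappingCone.snd φ').v m m (add_zero m) =
      (mappingCone.snd φ).v m m (add_zero m) ≫ b.f m := by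
  refine mappingCone.ext_from _ (m + 1) m rfl ?_ ?_
  · simp [mappingCone.map]
  · simp [mappingCone.map]

/-- The projection to the second component is the cochain descending (0, id); evaluating its
coboundary yields the formula with its signs. -/
lemma mappingCocone_d_snd_v {l m n : ℤ} (h : l + 1 = m) (h' : m + 1 = n) :
    (mappingCocone φ).d m n ≫ (mappingCocone.snd φ).v n m (by lia) =
      -((mappingCocone.fst φ).f m ≫ φ.f m) -
        (mappingCocone.snd φ).v m l (by lia) ≫ L.d l m := by
  have e : mappingCocone.snd φ =
      mappingCocone.descCochain φ (0 : Cochain K L (-1)) (Cochain.ofHom (𝟙 L)) (by lia) := by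
    refine Cochain.ext _ _ fun a b hab ↦ ?_
    rw [← cancel_epi (𝟙 _), ← mappingCocone.id_X φ a b hab]
    simp
  have h₁ := mappingCocone.δ_descCochain φ (0 : Cochain K L (-1)) (Cochain.ofHom (𝟙 L))
    (by lia) 1 (by lia)
  rw [← e] at h₁
  have h₂ := Cochain.congr_v h₁ m m (by lia)
  rw [δ_v (-1) 0 rfl _ m m _ l n (by lia) h'] at h₂
  simp at h₂
  rw [← h₂]
  abel

lemma mappingCocone_ext {l m : ℤ} (h : l + 1 = m) {z z' : (mappingCocone φ).X m}
    (h₁ : ((mappingCocone.fst φ).f m).hom z = ((mappingCocone.fst φ).f m).hom z')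
    (h₂ : ((mappingCocone.snd φ).v m l (by lia)).hom z =
      ((mappingCocone.snd φ).v m l (by lia)).hom z') : z = z' := by
  have e (w : (mappingCocone φ).X m) : _ = w :=
    congr($(mappingCocone.id_X φ m l (by lia)).hom w)
  rw [← e z, ← e z']
  exact congrArg₂ (fun p q : (mappingCocone φ).X m ↦ p + q)
    (congrArg ((mappingCocone.inl φ).v m m (add_zero m)).hom h₁)
    (congrArg ((mappingCocone.inr φ).1.v l m h).hom h₂)

lemma exists_mappingCocone {l m : ℤ} (h : l + 1 = m) (a : K.X m) (b : L.X l) :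
    ∃ z : (mappingCocone φ).X m, ((mappingCocone.fst φ).f m).hom z = a ∧
      ((mappingCocone.snd φ).v m l (by lia)).hom z = b := by
  refine ⟨((mappingCocone.inl φ).v m m (add_zero m)).hom a +
    ((mappingCocone.inr φ).1.v l m h).hom b, ?_, ?_⟩
  · rw [map_add]
    refine (congrArg₂ (· + ·) congr($(mappingCocone.inl_v_fst_f φ m).hom a)
      congr($(mappingCocone.inr_v_fst_f φ l m h).hom b)).trans ?_
    exact add_zero a
  · rw [map_add]
    refine (congrArg₂ (· + ·) congr($(mappingCocone.inl_v_snd_v φ m l (by lia)).hom a)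
      congr($(mappingCocone.inr_v_snd_v φ l m h).hom b)).trans ?_
    exact zero_add b

end

variable (C : ℕ → CochainComplex (ModuleCat.{u} k) ℤ)

/-- The components of a product of complexes form a product. -/
noncomputable def isLimitPiEval (m : ℤ) :
    IsLimit (Fan.mk ((∏ᶜ C).X m) fun n ↦ (Pi.π C n).f m) :=
  isLimitOfHasProductOfPreservesLimit (HomologicalComplex.eval _ _ m) C

/-- Elements are represented by maps from k, to which the universal property of the product applies.
-/
lemma pi_ext {m : ℤ} {z z' : (∏ᶜ C).X m}
    (h : ∀ n, ((Pi.π C n).f m).hom z = ((Pi.π C n).f m).hom z') : z = z' := by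
  have : ModuleCat.ofHom (LinearMap.toSpanSingleton k _ z) =
      ModuleCat.ofHom (LinearMap.toSpanSingleton k _ z') :=
    Fan.IsLimit.hom_ext (isLimitPiEval C m) _ _ fun n ↦
      ModuleCat.hom_ext (LinearMap.ext_ring (by
        show ((Pi.π C n).f m).hom ((1 : k) • z) = ((Pi.π C n).f m).hom ((1 : k) • z')
        rw [one_smul, one_smul, h]))
  have h' : (1 : k) • z = (1 : k) • z' := congr($(this).hom 1)
  rwa [one_smul, one_smul] at h'

lemma exists_pi {m : ℤ} (a : ∀ n, (C n).X m) :
    ∃ z : (∏ᶜ C).X m, ∀ n, ((Pi.π C n).f m).hom z = a n := by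
  let g := Fan.IsLimit.lift (isLimitPiEval C m)
    fun n ↦ ModuleCat.ofHom (LinearMap.toSpanSingleton k _ (a n))
  refine ⟨g.hom 1, fun n ↦ ?_⟩
  have := congr($(Fan.IsLimit.fac (isLimitPiEval C m)
    (fun n ↦ ModuleCat.ofHom (LinearMap.toSpanSingleton k _ (a n))) n).hom 1)
  exact this.trans (one_smul k (a n))

variable (t : ∀ n, C (n + 1) ⟶ C n)

/-- The first component of an element of a homotopy limit. -/
noncomputable def holimFst (m : ℤ) (n : ℕ) : (towerHolim C t).X m →ₗ[k] (C n).X m :=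
  ((Pi.π C n).f m).hom ∘ₗ ((mappingCocone.fst (oneSubShift C t)).f m).hom

/-- The second component of an element of a homotopy limit. -/
noncomputable def holimSnd {l m : ℤ} (h : l + 1 = m) (n : ℕ) :
    (towerHolim C t).X m →ₗ[k] (C n).X l :=
  ((Pi.π C n).f l).hom ∘ₗ ((mappingCocone.snd (oneSubShift C t)).v m l (by lia)).hom

variable {C t}

lemma towerHolim_ext {l m : ℤ} (h : l + 1 = m) {z z' : (towerHolim C t).X m}
    (h₁ : ∀ n, holimFst C t m n z = holimFst C t m n z')
    (h₂ : ∀ n, holimSnd C t h n z = holimSnd C t h n z') : z = z' :=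
  mappingCocone_ext _ h (pi_ext C h₁) (pi_ext C h₂)

lemma exists_towerHolim {l m : ℤ} (h : l + 1 = m) (a : ∀ n, (C n).X m) (b : ∀ n, (C n).X l) :
    ∃ z : (towerHolim C t).X m, (∀ n, holimFst C t m n z = a n) ∧
      ∀ n, holimSnd C t h n z = b n := by
  obtain ⟨a', ha⟩ := exists_pi C a
  obtain ⟨b', hb⟩ := exists_pi C b
  obtain ⟨z, rfl, rfl⟩ := exists_mappingCocone (oneSubShift C t) h a' b'
  exact ⟨z, ha, hb⟩

lemma holimFst_d (m m' : ℤ) (n : ℕ) (z : (towerHolim C t).X m) :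
    holimFst C t m' n (((towerHolim C t).d m m').hom z) =
      ((C n).d m m').hom (holimFst C t m n z) :=
  congr($((mappingCocone.fst (oneSubShift C t) ≫ Pi.π C n).comm m m').hom z).symm

lemma holimSnd_d {l m m' : ℤ} (h : l + 1 = m) (h' : m + 1 = m') (n : ℕ)
    (z : (towerHolim C t).X m) :
    holimSnd C t h' n (((towerHolim C t).d m m').hom z) =
      -(holimFst C t m n z - ((t n).f m).hom (holimFst C t m (n + 1) z)) -
        ((C n).d l m).hom (holimSnd C t h n z) := by
  have h₁ := congr($(mappingCocone_d_snd_v (oneSubShift C t) h h').hom z)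
  refine (congrArg ((Pi.π C n).f m).hom h₁).trans ?_
  refine (map_sub ((Pi.π C n).f m).hom _ _).trans ?_
  refine congrArg₂ (· - ·) ((map_neg ((Pi.π C n).f m).hom _).trans (congrArg _ ?_)) ?_
  · have h₂ : oneSubShift C t ≫ Pi.π C n = Pi.π C n - Pi.π C (n + 1) ≫ t n := by
      simp [oneSubShift]
    exact congr(($h₂).f m |>.hom (((mappingCocone.fst (oneSubShift C t)).f m).hom z))
  · exact congr($((Pi.π C n).comm l m).hom
      (((mappingCocone.snd (oneSubShift C t)).v m l (by lia)).hom z)).symm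

variable {A : CochainComplex (ModuleCat.{u} k) ℤ} (f : ∀ n, A ⟶ C n)
  (hf : ∀ n, f (n + 1) ≫ t n = f n)

lemma holimFst_lift (m : ℤ) (n : ℕ) (x : A.X m) :
    holimFst C t m n (((towerHolimLift C t f hf).f m).hom x) = ((f n).f m).hom x := by
  have h₁ : towerHolimLift C t f hf ≫ mappingCocone.fst (oneSubShift C t) ≫ Pi.π C n = f n :=
    (mappingCocone.lift_fst_assoc (oneSubShift C t) _ _ _ _).trans (Pi.lift_π _ _)
  exact congr(($h₁).f m |>.hom x)

lemma holimSnd_lift {l m : ℤ} (h : l + 1 = m) (n : ℕ) (x : A.X m) :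
    holimSnd C t h n (((towerHolimLift C t f hf).f m).hom x) = 0 := by
  have h₁ : (towerHolimLift C t f hf).f m ≫
      (mappingCocone.snd (oneSubShift C t)).v m l (by lia) = 0 :=
    mappingCocone.lift_f_snd_v (oneSubShift C t) _ _ _ _ _ _
  refine (congrArg ((Pi.π C n).f l).hom congr(($h₁).hom x)).trans ?_
  exact map_zero ((Pi.π C n).f l).hom

end

/-! ### Complete filtered complexes in terms of elements -/

namespace FilteredComplex

variable {k : Type u} [Field k] (F : FilteredComplex k)

open CochainComplex

/-- The component in `F^j` of an element of `F^i / F^j`. -/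
noncomputable def quotFst {j i : ℤ} (h : j ≤ i) {m n : ℤ} (hm : m + 1 = n) :
    (F.quot h).X m →ₗ[k] (F.obj j).X n :=
  ((mappingCone.fst (F.map (homOfLE h))).1.v m n hm).hom

/-- The component in `F^i` of an element of `F^i / F^j`. -/
noncomputable def quotSnd {j i : ℤ} (h : j ≤ i) (m : ℤ) : (F.quot h).X m →ₗ[k] (F.obj i).X m :=
  ((mappingCone.snd (F.map (homOfLE h))).v m m (add_zero m)).hom

variable {F}

lemma quot_ext {j i : ℤ} {h : j ≤ i} {m n : ℤ} (hm : m + 1 = n) {z z' : (F.quot h).X m}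
    (h₁ : F.quotFst h hm z = F.quotFst h hm z') (h₂ : F.quotSnd h m z = F.quotSnd h m z') :
    z = z' :=
  mappingCone_ext _ hm h₁ h₂

lemma exists_quot {j i : ℤ} (h : j ≤ i) {m n : ℤ} (hm : m + 1 = n) (a : (F.obj j).X n)
    (b : (F.obj i).X m) : ∃ z, F.quotFst h hm z = a ∧ F.quotSnd h m z = b :=
  exists_mappingCone _ hm a b

lemma quotFst_d {j i : ℤ} (h : j ≤ i) {m n o : ℤ} (hm : m + 1 = n) (hn : n + 1 = o)
    (z : (F.quot h).X m) : F.quotFst h hn (((F.quot h).d m n).hom z) =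
      -((F.obj j).d n o).hom (F.quotFst h hm z) :=
  congr($(mappingCone.d_fst_v (F.map (homOfLE h)) m n o hm hn).hom z)

lemma quotSnd_d {j i : ℤ} (h : j ≤ i) {m n : ℤ} (hm : m + 1 = n)
    (z : (F.quot h).X m) : F.quotSnd h n (((F.quot h).d m n).hom z) =
      F.tr j i n n (F.quotFst h hm z) + ((F.obj i).d m n).hom (F.quotSnd h m z) := by
  rw [tr_eq_map F h]
  exact congr($(mappingCone.d_snd_v (F.map (homOfLE h)) m n hm).hom z)

lemma quotFst_quotMap {j' j i : ℤ} (h' : j' ≤ j) (h : j ≤ i) {m n : ℤ} (hm : m + 1 = n)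
    (z : (F.quot (h'.trans h)).X m) : F.quotFst h hm (((F.quotMap h' h).f m).hom z) =
      F.tr j' j n n (F.quotFst (h'.trans h) hm z) := by
  rw [tr_eq_map F h']
  exact congr($(mappingCone_map_fst (F.map (homOfLE (h'.trans h))) (F.map (homOfLE h))
    (F.map (homOfLE h')) (𝟙 _) (by rw [Category.comp_id, ← F.map_comp]; rfl) hm).hom z)

lemma quotSnd_quotMap {j' j i : ℤ} (h' : j' ≤ j) (h : j ≤ i) (m : ℤ)
    (z : (F.quot (h'.trans h)).X m) : F.quotSnd h m (((F.quotMap h' h).f m).hom z) =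
      F.quotSnd (h'.trans h) m z := by
  exact congr($(mappingCone_map_snd (F.map (homOfLE (h'.trans h))) (F.map (homOfLE h))
    (F.map (homOfLE h')) (𝟙 _) (by rw [Category.comp_id, ← F.map_comp]; rfl) m).hom z)

lemma quotFst_toQuot {j i : ℤ} (h : j ≤ i) {m n : ℤ} (hm : m + 1 = n) (x : (F.obj i).X m) :
    F.quotFst h hm (((F.toQuot h).f m).hom x) = 0 :=
  congr($(mappingCone.inr_f_fst_v (F.map (homOfLE h)) m n hm).hom x)

lemma quotSnd_toQuot {j i : ℤ} (h : j ≤ i) (m : ℤ) (x : (F.obj i).X m) :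
    F.quotSnd h m (((F.toQuot h).f m).hom x) = x :=
  congr($(mappingCone.inr_f_snd_v (F.map (homOfLE h)) m).hom x)


/-! The coordinates of an element of `lim_{j ≤ i} F^i / F^j`. -/

section

variable (F) (i : ℤ)

/-- The homotopy limit of the quotients `F^i / F^j` for `j ≤ i`. -/
noncomputable abbrev limQuot : CochainComplex (ModuleCat.{u} k) ℤ :=
  towerHolim (fun n : ℕ ↦ F.quot (show i - n ≤ i by lia))
    (fun n : ℕ ↦ F.quotMap (show i - (n + 1 : ℕ) ≤ i - n by lia) (by lia))

variable {F i}

/-- An element of the homotopy limit has two components for each ν, and each is an element of a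
cone, hence the four coordinates. Those in F^{i-ν} describe the tower of the F^j, and those in F^i
describe a constant tower. -/
lemma exists_limQuot {l m n : ℤ} (hm : l + 1 = m) (hn : m + 1 = n)
    (a₁ : ∀ ν : ℕ, (F.obj (i - ν)).X n) (a₂ : ℕ → (F.obj i).X m)
    (a₃ : ∀ ν : ℕ, (F.obj (i - ν)).X m) (a₄ : ℕ → (F.obj i).X l) :
    ∃ z : (F.limQuot i).X m, ∀ ν,
      F.quotFst _ hn (holimFst _ _ m ν z) = a₁ ν ∧ F.quotSnd _ m (holimFst _ _ m ν z) = a₂ ν ∧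
      F.quotFst _ hm (holimSnd _ _ hm ν z) = a₃ ν ∧
      F.quotSnd _ l (holimSnd _ _ hm ν z) = a₄ ν := by
  choose u hu hu' using fun ν : ℕ ↦ exists_quot (F := F) (show i - ν ≤ i by lia) hn (a₁ ν) (a₂ ν)
  choose v hv hv' using fun ν : ℕ ↦ exists_quot (F := F) (show i - ν ≤ i by lia) hm (a₃ ν) (a₄ ν)
  obtain ⟨z, hz, hz'⟩ := exists_towerHolim (C := fun n : ℕ ↦ F.quot (show i - n ≤ i by lia))
    (t := fun n : ℕ ↦ F.quotMap (show i - (n + 1 : ℕ) ≤ i - n by lia) (by lia)) hm u v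
  exact ⟨z, fun ν ↦ by rw [hz, hz', hu, hu', hv, hv']; exact ⟨rfl, rfl, rfl, rfl⟩⟩

lemma limQuot_ext {l m n : ℤ} (hm : l + 1 = m) (hn : m + 1 = n) {z z' : (F.limQuot i).X m}
    (h₁ : ∀ ν, F.quotFst _ hn (holimFst _ _ m ν z) = F.quotFst _ hn (holimFst _ _ m ν z'))
    (h₂ : ∀ ν, F.quotSnd _ m (holimFst _ _ m ν z) = F.quotSnd _ m (holimFst _ _ m ν z'))
    (h₃ : ∀ ν, F.quotFst _ hm (holimSnd _ _ hm ν z) = F.quotFst _ hm (holimSnd _ _ hm ν z'))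
    (h₄ : ∀ ν, F.quotSnd _ l (holimSnd _ _ hm ν z) = F.quotSnd _ l (holimSnd _ _ hm ν z')) :
    z = z' :=
  towerHolim_ext hm (fun ν ↦ quot_ext hn (h₁ ν) (h₂ ν)) (fun ν ↦ quot_ext hm (h₃ ν) (h₄ ν))

lemma quotFst_holimFst_d {m n o : ℤ} (hn : m + 1 = n) (ho : n + 1 = o) (ν : ℕ)
    (z : (F.limQuot i).X m) :
    F.quotFst _ ho (holimFst _ _ n ν (((F.limQuot i).d m n).hom z)) =
      -((F.obj (i - ν)).d n o).hom (F.quotFst _ hn (holimFst _ _ m ν z)) := by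
  rw [holimFst_d]
  exact quotFst_d _ hn ho _

lemma quotSnd_holimFst_d {m n : ℤ} (hn : m + 1 = n) (ν : ℕ) (z : (F.limQuot i).X m) :
    F.quotSnd _ n (holimFst _ _ n ν (((F.limQuot i).d m n).hom z)) =
      F.tr (i - ν) i n n (F.quotFst _ hn (holimFst _ _ m ν z)) +
        ((F.obj i).d m n).hom (F.quotSnd _ m (holimFst _ _ m ν z)) := by
  rw [holimFst_d]
  exact quotSnd_d _ hn _

lemma quotFst_holimSnd_d {l m n : ℤ} (hm : l + 1 = m) (hn : m + 1 = n) (ν : ℕ)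
    (z : (F.limQuot i).X m) :
    F.quotFst _ hn (holimSnd _ _ hn ν (((F.limQuot i).d m n).hom z)) =
      F.tr (i - (ν + 1 : ℕ)) (i - ν) n n (F.quotFst _ hn (holimFst _ _ m (ν + 1) z)) -
        F.quotFst _ hn (holimFst _ _ m ν z) +
        ((F.obj (i - ν)).d m n).hom (F.quotFst _ hm (holimSnd _ _ hm ν z)) := by
  rw [holimSnd_d hm hn, map_sub, map_neg, map_sub, quotFst_quotMap, quotFst_d _ hm hn, neg_sub,
    sub_neg_eq_add]

lemma quotSnd_holimSnd_d {l m n : ℤ} (hm : l + 1 = m) (hn : m + 1 = n) (ν : ℕ)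
    (z : (F.limQuot i).X m) :
    F.quotSnd _ m (holimSnd _ _ hn ν (((F.limQuot i).d m n).hom z)) =
      F.quotSnd _ m (holimFst _ _ m (ν + 1) z) - F.quotSnd _ m (holimFst _ _ m ν z) -
        (F.tr (i - ν) i m m (F.quotFst _ hm (holimSnd _ _ hm ν z)) +
          ((F.obj i).d l m).hom (F.quotSnd _ l (holimSnd _ _ hm ν z))) := by
  rw [holimSnd_d hm hn, map_sub, map_neg, map_sub, quotSnd_quotMap, quotSnd_d _ hm, neg_sub]

variable {m : ℤ} (ν : ℕ) (x : (F.obj i).X m)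

lemma quotFst_holimFst_toLimQuot {n : ℤ} (hn : m + 1 = n) :
    F.quotFst _ hn (holimFst _ _ m ν (((F.toLimQuot i).f m).hom x)) = 0 := by
  rw [toLimQuot, holimFst_lift, quotFst_toQuot]

lemma quotSnd_holimFst_toLimQuot :
    F.quotSnd _ m (holimFst _ _ m ν (((F.toLimQuot i).f m).hom x)) = x := by
  rw [toLimQuot, holimFst_lift, quotSnd_toQuot]

lemma holimSnd_toLimQuot {l : ℤ} (hm : l + 1 = m) :
    holimSnd _ _ hm ν (((F.toLimQuot i).f m).hom x) = 0 :=
  holimSnd_lift _ _ hm ν x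

end

end FilteredComplex

/-! ### Completeness as acyclicity of the tower of the F^j. -/

namespace FilteredComplex

variable {k : Type u} [Field k] (F : FilteredComplex k)

/-- The family indexed by all integers attached to a family indexed by the integers `i - ν`. -/
noncomputable def familyOfNat (i : ℤ) {a : ℤ} (z : ∀ ν : ℕ, (F.obj (i - ν)).X a) (j : ℤ) :
    (F.obj j).X a :=
  F.tr (i - (i - j).toNat) j a a (z (i - j).toNat)

variable {F} in
lemma familyOfNat_eq {i a : ℤ} (z : ∀ ν : ℕ, (F.obj (i - ν)).X a) {j : ℤ} {ν : ℕ}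
    (h : j = i - ν) : F.familyOfNat i z j = F.tr (i - ν) j a a (z ν) := by
  obtain rfl : ν = (i - j).toNat := by lia
  rfl

variable {F} in
-- A cocycle (c, b) of the tower is supplemented by coordinates in F^i so that the image of c_i in
-- the limit of the quotients is a boundary. The hypothesis then provides an element y' whose
-- coordinates in F^{i-ν} have boundary (c, b), since elements coming from F^i have no such
-- coordinates.
lemma isTowerAcyclic_of_quasiIso {i : ℤ} (H : QuasiIso (F.toLimQuot i)) : F.IsTowerAcyclic i := by
  rw [CochainComplex.quasiIso_iff_elements] at H
  intro l c b hc hb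
  have hb' (ν : ℕ) : F.tr (i - (ν + 1 : ℕ)) (i - ν) (l + 1 + 1) (l + 1 + 1) (c (i - (ν + 1 : ℕ))) -
      c (i - ν) + ((F.obj (i - ν)).d (l + 1) (l + 1 + 1)).hom (b (i - ν)) = 0 := by
    rw [← hb (i - ν) (by lia), show i - (ν + 1 : ℕ) = i - ν - 1 by push_cast; ring]
  -- Summing the relations between c_{i-s-1} and c_{i-s} in F^i telescopes to c_i minus the image of
  -- c_{i-ν}, as a boundary.
  let f (ν : ℕ) : (F.obj i).X (l + 1) :=
    ∑ s ∈ Finset.range ν, F.tr (i - s) i (l + 1) (l + 1) (b (i - s))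
  have hf (ν : ℕ) : c i = F.tr (i - ν) i (l + 1 + 1) (l + 1 + 1) (c (i - ν)) +
      ((F.obj i).d (l + 1) (l + 1 + 1)).hom (f ν) := by
    induction ν with
    | zero =>
      dsimp only [f]
      rw [Finset.range_zero, Finset.sum_empty, map_zero, add_zero, tr_family F (by simp)]
    | succ ν hν =>
      have e := congrArg (F.tr (i - ν) i (l + 1 + 1) (l + 1 + 1)) (hb' ν)
      rw [map_zero, map_add, map_sub, tr_tr F (by push_cast; lia) (by lia) rfl,
        ← d_tr F (a := l + 1) (b := l + 1) (by lia)] at e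
      dsimp only [f] at hν ⊢
      rw [hν, Finset.sum_range_succ, map_add, ← sub_eq_zero, ← neg_eq_zero, ← e]
      abel
  obtain ⟨y, hy⟩ := exists_limQuot (F := F) (i := i) (l := l) (m := l + 1) (n := l + 1 + 1) rfl
    rfl (fun ν ↦ c (i - ν)) f (fun ν ↦ b (i - ν)) 0
  obtain ⟨x', y', -, h⟩ := H (l) _ _ _ rfl rfl rfl (c i) y (hc i le_rfl) (by
    refine limQuot_ext (l := l + 1) rfl rfl (fun ν ↦ ?_) (fun ν ↦ ?_) (fun ν ↦ ?_)
      (fun ν ↦ ?_)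
    · rw [quotFst_holimFst_toLimQuot, quotFst_holimFst_d (n := l + 1 + 1) rfl, (hy ν).1,
        hc _ (by lia), neg_zero]
    · rw [quotSnd_holimFst_toLimQuot, quotSnd_holimFst_d (n := l + 1 + 1) rfl, (hy ν).1,
        (hy ν).2.1]
      exact hf ν
    · rw [holimSnd_toLimQuot, map_zero, quotFst_holimSnd_d (l := l) rfl rfl, (hy ν).1,
        (hy (ν + 1)).1, (hy ν).2.2.1, hb' ν]
    · rw [holimSnd_toLimQuot, map_zero, quotSnd_holimSnd_d (l := l) rfl rfl, (hy ν).2.1,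
        (hy (ν + 1)).2.1, (hy ν).2.2.1, (hy ν).2.2.2]
      dsimp only [f]
      rw [Finset.sum_range_succ, Pi.zero_apply, map_zero]
      abel)
  have h₁ (ν : ℕ) : -((F.obj (i - ν)).d (l + 1) (l + 1 + 1)).hom
      (F.quotFst _ rfl (holimFst _ _ l ν y')) = c (i - ν) := by
    have e := congrArg (fun z ↦ F.quotFst _ rfl (holimFst _ _ (l + 1) ν z)) h
    beta_reduce at e
    rw [map_add, map_add, quotFst_holimFst_toLimQuot, quotFst_holimFst_d (n := l + 1) rfl,
      zero_add, (hy ν).1] at e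
    exact e
  have h₂ (ν : ℕ) : F.tr (i - (ν + 1 : ℕ)) (i - ν) (l + 1) (l + 1)
      (F.quotFst _ rfl (holimFst _ _ l (ν + 1) y')) - F.quotFst _ rfl (holimFst _ _ l ν y') +
      ((F.obj (i - ν)).d l (l + 1)).hom
        (F.quotFst _ (sub_add_cancel l 1) (holimSnd _ _ (sub_add_cancel l 1) ν y')) =
      b (i - ν) := by
    have e := congrArg (fun z ↦ F.quotFst _ rfl (holimSnd _ _ (rfl : l + 1 = l + 1) ν z)) h
    beta_reduce at e
    rw [map_add, map_add, holimSnd_toLimQuot, map_zero,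
      quotFst_holimSnd_d (sub_add_cancel l 1) rfl, zero_add, (hy ν).2.2.1] at e
    exact e
  refine ⟨F.familyOfNat i fun ν ↦ F.quotFst _ rfl (holimFst _ _ l ν y'), F.familyOfNat i fun ν ↦
    F.quotFst _ (sub_add_cancel l 1) (holimSnd _ _ (sub_add_cancel l 1) ν y'), fun j hj ↦ ?_⟩
  obtain ⟨ν, rfl⟩ : ∃ ν : ℕ, j = i - ν := ⟨(i - j).toNat, by lia⟩
  rw [familyOfNat_eq _ rfl, familyOfNat_eq _ rfl, tr_self, tr_self,
    familyOfNat_eq (ν := ν + 1) _ (by push_cast; ring), tr_tr F (by push_cast; lia) (by lia) rfl]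
  exact ⟨h₁ ν, h₂ ν⟩

variable {F} in
-- The coordinates in F^{i-ν} of y form a cocycle of the tower, hence a boundary of some (c', b').
-- The other coordinates lie in the constant tower F^i, whose homotopy limit is F^i; they reduce to
-- the single element a₂(0) - c'_i.
lemma quasiIso_of_isTowerAcyclic {i : ℤ} (H : F.IsTowerAcyclic i) : QuasiIso (F.toLimQuot i) := by
  rw [CochainComplex.quasiIso_iff_elements]
  rintro l _ _ _ rfl rfl rfl x y hx hxy
  let a₁ (ν : ℕ) : (F.obj (i - ν)).X (l + 1 + 1) := F.quotFst _ rfl (holimFst _ _ (l + 1) ν y)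
  let a₂ (ν : ℕ) : (F.obj i).X (l + 1) := F.quotSnd _ (l + 1) (holimFst _ _ (l + 1) ν y)
  let a₃ (ν : ℕ) : (F.obj (i - ν)).X (l + 1) := F.quotFst _ rfl (holimSnd _ _ rfl ν y)
  let a₄ (ν : ℕ) : (F.obj i).X l := F.quotSnd _ l (holimSnd _ _ rfl ν y)
  have h₁ (ν : ℕ) : ((F.obj (i - ν)).d (l + 1 + 1) (l + 1 + 1 + 1)).hom (a₁ ν) = 0 := by
    have e := congrArg (fun z ↦ F.quotFst _ rfl (holimFst _ _ (l + 1 + 1) ν z)) hxy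
    beta_reduce at e
    rw [quotFst_holimFst_toLimQuot, quotFst_holimFst_d (n := l + 1 + 1) rfl] at e
    exact neg_eq_zero.1 e.symm
  have h₂ (ν : ℕ) : x = F.tr (i - ν) i (l + 1 + 1) (l + 1 + 1) (a₁ ν) +
      ((F.obj i).d (l + 1) (l + 1 + 1)).hom (a₂ ν) := by
    have e := congrArg (fun z ↦ F.quotSnd _ _ (holimFst _ _ (l + 1 + 1) ν z)) hxy
    beta_reduce at e
    rw [quotSnd_holimFst_toLimQuot, quotSnd_holimFst_d (n := l + 1 + 1) rfl] at e
    exact e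
  have h₃ (ν : ℕ) : F.tr (i - (ν + 1 : ℕ)) (i - ν) (l + 1 + 1) (l + 1 + 1) (a₁ (ν + 1)) -
      a₁ ν + ((F.obj (i - ν)).d (l + 1) (l + 1 + 1)).hom (a₃ ν) = 0 := by
    have e := congrArg (fun z ↦ F.quotFst _ rfl (holimSnd _ _ (rfl : l + 1 + 1 = l + 1 + 1) ν z))
      hxy
    beta_reduce at e
    rw [holimSnd_toLimQuot, map_zero, quotFst_holimSnd_d (l := l) rfl rfl] at e
    exact e.symm
  have h₄ (ν : ℕ) : a₂ (ν + 1) - a₂ ν - (F.tr (i - ν) i (l + 1) (l + 1) (a₃ ν) +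
      ((F.obj i).d l (l + 1)).hom (a₄ ν)) = 0 := by
    have e := congrArg (fun z ↦ F.quotSnd _ _ (holimSnd _ _ (rfl : l + 1 + 1 = l + 1 + 1) ν z))
      hxy
    beta_reduce at e
    rw [holimSnd_toLimQuot, map_zero, quotSnd_holimSnd_d (l := l) rfl rfl] at e
    exact e.symm
  obtain ⟨c', b', h⟩ := H l (F.familyOfNat i a₁) (F.familyOfNat i a₃) (fun j hj ↦ by
    obtain ⟨ν, rfl⟩ : ∃ ν : ℕ, j = i - ν := ⟨(i - j).toNat, by lia⟩
    rw [familyOfNat_eq _ rfl, tr_self, h₁]) (fun j hj ↦ by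
    obtain ⟨ν, rfl⟩ : ∃ ν : ℕ, j = i - ν := ⟨(i - j).toNat, by lia⟩
    rw [familyOfNat_eq _ rfl, familyOfNat_eq _ rfl, tr_self, tr_self,
      familyOfNat_eq (ν := ν + 1) _ (by push_cast; ring),
      tr_tr F (by push_cast; lia) (by lia) rfl, h₃])
  have k₁ (ν : ℕ) : -((F.obj (i - ν)).d (l + 1) (l + 1 + 1)).hom (c' (i - ν)) = a₁ ν := by
    have := (h (i - ν) (by lia)).1
    rwa [familyOfNat_eq _ rfl, tr_self] at this
  have k₂ (ν : ℕ) : F.tr (i - (ν + 1 : ℕ)) (i - ν) (l + 1) (l + 1) (c' (i - (ν + 1 : ℕ))) -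
      c' (i - ν) + ((F.obj (i - ν)).d l (l + 1)).hom (b' (i - ν)) = a₃ ν := by
    have := (h (i - ν) (by lia)).2
    rwa [familyOfNat_eq _ rfl, tr_self,
      show i - ν - 1 = i - (ν + 1 : ℕ) by push_cast; ring] at this
  -- These sums telescope the relations between consecutive a₂(ν), once the tower coordinates are
  -- replaced by boundaries. The fourth coordinate of the primitive can then be zero.
  let f (ν : ℕ) : (F.obj i).X l :=
    ∑ s ∈ Finset.range ν, (F.tr (i - s) i l l (b' (i - s)) + a₄ s)
  have k₃ (ν : ℕ) : a₂ 0 - c' i + (F.tr (i - ν) i (l + 1) (l + 1) (c' (i - ν)) +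
      ((F.obj i).d l (l + 1)).hom (f ν)) = a₂ ν := by
    induction ν with
    | zero =>
      dsimp only [f]
      rw [Finset.range_zero, Finset.sum_empty, map_zero, add_zero, tr_family F (by simp),
        sub_add_cancel]
    | succ ν hν =>
      have e := congrArg (F.tr (i - ν) i (l + 1) (l + 1)) (k₂ ν)
      rw [map_add, map_sub, tr_tr F (by push_cast; lia) (by lia) rfl,
        ← d_tr F (a := l) (b := l) (by lia)] at e
      have e' := h₄ ν
      rw [← e, ← hν] at e'
      dsimp only [f] at e' ⊢
      rw [Finset.sum_range_succ, map_add, map_add, ← sub_eq_zero, ← neg_eq_zero, ← e']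
      abel
  obtain ⟨y', hy'⟩ := exists_limQuot (F := F) (i := i) (l := l - 1) (m := l) (n := l + 1)
    (by lia) rfl (fun ν ↦ c' (i - ν)) f (fun ν ↦ b' (i - ν)) 0
  refine ⟨a₂ 0 - c' i, y', ?_, limQuot_ext (l := l) rfl rfl (fun ν ↦ ?_) (fun ν ↦ ?_)
    (fun ν ↦ ?_) (fun ν ↦ ?_)⟩
  · have e := h₂ 0
    rw [← k₁ 0, map_neg, tr_family F (by simp) (fun j ↦ ((F.obj j).d (l + 1) (l + 1 + 1)).hom
      (c' j))] at e
    rw [map_sub, e]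
    abel
  · rw [map_add, map_add, quotFst_holimFst_toLimQuot, quotFst_holimFst_d (n := l + 1) rfl,
      (hy' ν).1, zero_add]
    exact k₁ ν
  · rw [map_add, map_add, quotSnd_holimFst_toLimQuot, quotSnd_holimFst_d (n := l + 1) rfl,
      (hy' ν).1, (hy' ν).2.1]
    exact k₃ ν
  · rw [map_add, map_add, holimSnd_toLimQuot, map_zero,
      quotFst_holimSnd_d (sub_add_cancel l 1) rfl, (hy' ν).1, (hy' (ν + 1)).1, (hy' ν).2.2.1,
      zero_add]
    exact k₂ ν
  · rw [map_add, map_add, holimSnd_toLimQuot, map_zero,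
      quotSnd_holimSnd_d (sub_add_cancel l 1) rfl, (hy' ν).2.1, (hy' (ν + 1)).2.1,
      (hy' ν).2.2.1, (hy' ν).2.2.2, zero_add]
    dsimp only [f]
    rw [Finset.sum_range_succ, Pi.zero_apply, map_zero, add_zero, add_sub_cancel_left,
      add_sub_cancel_left]

lemma toLimQuot_quasiIso_iff (i : ℤ) : QuasiIso (F.toLimQuot i) ↔ F.IsTowerAcyclic i :=
  ⟨isTowerAcyclic_of_quasiIso, quasiIso_of_isTowerAcyclic⟩

lemma isComplete_iff : F.IsComplete ↔ quasiIso k ((toCompletion k).app F) :=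
  forall_congr' fun i ↦ (F.toLimQuot_quasiIso_iff i).trans (F.toCompletion_quasiIso_iff i).symm

/-- The morphisms of filtered complexes which become equivalences in the localization are the
quasi-isomorphisms. -/
lemma quasiIso_of_isEquivalence {D : SSet.{u + 1}} {γ : nerve (FilteredComplex k) ⟶ D}
    (hγ : InftyCat.IsLocalizationAt (quasiIso k) γ) {F F' : FilteredComplex k} (w : F ⟶ F')
    (hw : InftyCat.IsEquivalence ((nerve.edgeMk w).map γ)) : quasiIso k w := by
  intro i
  rw [quasiIso_iff]
  intro n
  rw [quasiIsoAt_iff_isIso_homologyMap]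
  -- The functor F ↦ H^n(F^i) to vector spaces inverts quasi-isomorphisms, so it sends every map
  -- inverted by γ to an isomorphism.
  refine hγ.isIso_map ((evaluation ℤ (CochainComplex (ModuleCat.{u} k) ℤ)).obj i ⋙
    HomologicalComplex.homologyFunctor _ _ n) (fun X Y f hf ↦ ?_) hw
  have := hf i
  exact (quasiIsoAt_iff_isIso_homologyMap (f.app i) n).1 inferInstance

end FilteredComplex

/-! ### The theorem on the filtered Tate realization. -/

theorem proposition1p1 (k : Type u) [Field k] [CharZero k]
    (M Fil : SSet.{u + 1})
    (γM : nerve (GradedMixedComplex k) ⟶ M) (γF : nerve (FilteredComplex k) ⟶ Fil)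
    (hM : InftyCat.IsLocalizationAt (GradedMixedComplex.quasiIso k) γM)
    (hF : InftyCat.IsLocalizationAt (FilteredComplex.quasiIso k) γF) :
    (∃ T : M ⟶ Fil, InftyCat.IsInducedBy γM γF (GradedMixedComplex.tate k) T) ∧
    ∀ T : M ⟶ Fil, InftyCat.IsInducedBy γM γF (GradedMixedComplex.tate k) T →
      InftyCat.IsFullyFaithful T ∧
      (∀ y : Fil _⦋0⦌, InftyCat.InEssImage T y ↔
        ∃ X : FilteredComplex k, X.IsComplete ∧ InftyCat.Equivalent (InftyCat.objOf γF X) y) ∧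
      (∀ X : FilteredComplex k,
        InftyCat.InEssImage T (InftyCat.objOf γF X) ↔ X.IsComplete) := by
  have hα := FilteredComplex.isComplete_iff (k := k)
  refine ⟨InftyCat.IsLocalizationAt.exists_isInducedBy hM hF (GradedMixedComplex.tate k)
    fun _ _ f hf ↦ GradedMixedComplex.tate_map_quasiIso f hf, fun T hT ↦ ?_⟩
  -- Here t is the Tate realization, g is `toMixed`, and R is the completion. The last argument is
  -- the completeness of Tate realizations.
  have h := InftyCat.isFullyFaithful_of_isInducedBy hM hF
    (fun _ _ w hw ↦ FilteredComplex.quasiIso_of_isEquivalence hF w hw)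
    (fun _ _ f hf ↦ FilteredComplex.toMixed_map_quasiIso _ f hf) hT
    (GradedMixedComplex.unitToMixedTate k) (fun E ↦ E.toMixedTate_f_quasiIso)
    (FilteredComplex.toCompletion k) (FilteredComplex.tateToCompletion k)
    (fun X ↦ X.tateToCompletion_app_quasiIso)
    (fun E i ↦ (FilteredComplex.toCompletion_quasiIso_iff _ i).2 (E.isTowerAcyclic_tateObj i))
  refine ⟨h.1, fun y ↦ (h.2.1 y).trans ?_, fun X ↦ (h.2.2 X).trans (hα X).symm⟩
  exact exists_congr fun X ↦ and_congr_left' (hα X).symm
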